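/- Let $\Omega\subset\mathbb{R}^d$ be bounded and open with $0\in\Omega$, and let $$\mathscr{L}=f+X_0+\sum_{j=1}^r Y_j^*Y_j ,$$ where $f:\mathbb{R}^d\to\mathbb{R}$, $X_0=X_0^l(x)\partial_l,\ Y_j=Y_j^l(x)\partial_l$ $(1\le j\le r)$ are real vector fields on $\mathbb{R}^d$ and $Y^*v=-\partial_l(Y^lv)$ is the formal $L^2(\mathbb{R}^d,dx)$-adjoint. Write $\|\cdot\|$ for the $L^2(\mathbb{R}^d,dx)$ norm and $\|u\|_{(s)}=\big(\int_{\mathbb{R}^d}|\hat u(\xi)|^2(1+4\pi^2|\xi|^2)^s\,d\xi\big)^{1/2}$, $\hat u(\xi)=\int e^{-2\pi i\xi\cdot x}u(x)\,dx$. For $Q$ compact, $C_0^\infty(Q:\mathbb{C})$ denotes the smooth functions $u:\mathbb{R}^d\to\mathbb{C}$ supported in $Q$. Consider the following two assumptions. (A1) $f$ is bounded, measurable and compactly supported, and $X_0,Y_1,\dots,Y_r$ have compactly supported $C^1$ coefficients. (A2) $f$ is bounded, measurable and compactly supported; the coefficients of $X_0$ are compactly supported and of class $C^{3/2}$; those of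 $Y_1,\dots,Y_r$ are compactly supported and of class $C^{5/2}$ (for an integer $m$, $C^{m+1/2}$ means $C^m$ with $\tfrac12$-Hölder continuous derivatives of order $m$); and there are $0\le\gamma_1<\min(1,d/2)$ and $0\le\gamma_2<\min(2,d/2)$ such that for all $1\le l\le d$ and $1\le j\le r$ the weak (distributional) partial derivatives on $\mathbb{R}^d$, of orders two and three of $X_0^l$ and of orders three and four of $Y_j^l$, are locally integrable functions, and the functions $|x|^{\gamma_1}\partial^\sigma X_0^l$ $(|\sigma|=2)$, $|x|^{\gamma_2}\partial^\sigma X_0^l$ $(|\sigma|=3)$, $|x|^{\gamma_1}\partial^\sigma Y_j^l$ $(|\sigma|=3)$, $|x|^{\gamma_2}\partial^\sigma Y_j^l$ $(|\sigma|=4)$ are essentially bounded. Let $\mathcal{F}_0$ be the set of real vector fields $V$ with $C_0^\infty(\mathbb{R}^d)$ coefficients for which there is a constant $C>0$ such that $\|Vu\|^2\le C\sum_{j=1}^r\|Y_ju\|^2$ for all $u\in C_0^\infty(\mathbb{R}^d:\mathbb{C})$, and let $\mathcal{F}_0^B$ be the set of real vector fields with bounded, measurable, compactly supported coefficients satisfying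 the same condition. Let $\mathrm{Lie}(\mathcal{F}_0)$ be the smallest real vector space of vector fields that contains $\mathcal{F}_0$ and is closed under the bracket $[V,W]=VW-WV$. Given a vector field $X$, let $\mathcal{F}_1$ consist of $X$ and of all $[V,W]$ with $V,W\in\mathcal{F}_0$; for $k\ge2$ let $\mathcal{F}_k$ consist of all $[V,W]$ with $V\in\mathcal{F}_0$, $W\in\mathcal{F}_{k-1}$, and all $[V,W]$ with $V\in\mathcal{F}_1$, $W\in\mathcal{F}_{k-2}$. (i) Assume (A2), and that $X_0=X+\Upsilon$, where $X$ is a real vector field with $C_0^\infty(\mathbb{R}^d)$ coefficients and $\Upsilon\in\mathcal{F}_0^B$. Let $Q\subset\Omega$ be compact, $\gamma\in(0,1)$, $k\ge0$ an integer, $V_k\in\mathcal{F}_k$, and $\epsilon\le2^{-k}$ a real number. Then there is a constant $C>0$ such that $$\|V_ku\|_{(\epsilon-1-\gamma)}\le C\big(\|\mathscr{L}u\|+\|u\|\big)\qquad\text{for all }u\in C_0^\infty(Q:\mathbb{C}).$$ (ii) Assume (A1). For every $V\in\mathrm{Lie}(\mathcal{F}_0)$ and every compact $Q\subset\Omega$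 there are constants $C,\epsilon>0$ such that $$\|Vu\|_{(\epsilon-1)}\le C\big(\|\mathscr{L}u\|+\|u\|\big)\qquad\text{for all }u\in C_0^\infty(Q:\mathbb{C}).$$ -/

import Mathlib

open MeasureTheory
open scoped ENNReal NNReal FourierTransform ContDiff

namespace RoughOperator

/-- `ℝ^d` with its Euclidean norm. A real vector field `Y = Y^l ∂_l` on `ℝ^d` is represented by the
map `x ↦ (Y^1(x), …, Y^d(x))`, an element of `Space d → Space d`. -/
abbrev Space (d : ℕ) : Type := EuclideanSpace ℝ (Fin d)

/-- The standard basis vector `e_l` of `ℝ^d`. -/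
noncomputable def basisVec {d : ℕ} (l : Fin d) : Space d := EuclideanSpace.single l 1

/-! ### Function spaces -/

/-- `h ∈ B_0`: bounded, measurable, with compact support. -/
def BoundedMeasurableCompact {d : ℕ} {F : Type*} [NormedAddCommGroup F] [MeasurableSpace F]
    (h : Space d → F) : Prop :=
  Measurable h ∧ (∃ M : ℝ, ∀ x, ‖h x‖ ≤ M) ∧ HasCompactSupport h

/-- `h ∈ C^{m+α}_0` for an integer `m` and `α ∈ (0,1)`: `h` is `m` times continuously
differentiable, its derivatives of order `m` are Hölder continuous with exponent `α`, and `h` has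
compact support. -/
def HolderCompact {d : ℕ} {F : Type*} [NormedAddCommGroup F] [NormedSpace ℝ F]
    (m : ℕ) (α : ℝ≥0) (h : Space d → F) : Prop :=
  ContDiff ℝ m h ∧ MemHolder α (iteratedFDeriv ℝ m h) ∧ HasCompactSupport h

/-- `h ∈ C^∞_0(ℝ^d)`. -/
def SmoothCompact {d : ℕ} {F : Type*} [NormedAddCommGroup F] [NormedSpace ℝ F]
    (h : Space d → F) : Prop :=
  ContDiff ℝ ∞ h ∧ HasCompactSupport h

/-- `u ∈ C^∞_0(Q : ℂ)`: `u` is smooth on `ℝ^d` and supported in `Q`. -/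
def SmoothSupportedIn {d : ℕ} (Q : Set (Space d)) (u : Space d → ℂ) : Prop :=
  ContDiff ℝ ∞ u ∧ tsupport u ⊆ Q

/-! ### Norms -/

/-- The `L^2(ℝ^d, dx)` norm, with values in `[0, ∞]`. -/
noncomputable def normL2 {d : ℕ} (u : Space d → ℂ) : ℝ≥0∞ := eLpNorm u 2 volume

/-- The Sobolev norm `‖u‖_(s) = (∫ |û(ξ)|² (1 + 4π²|ξ|²)^s dξ)^{1/2}`, with values in `[0, ∞]`,
where `û(ξ) = ∫ e^{-2πi ξ·x} u(x) dx`. -/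
noncomputable def normSobolev {d : ℕ} (s : ℝ) (u : Space d → ℂ) : ℝ≥0∞ :=
  (∫⁻ ξ : Space d, ‖𝓕 u ξ‖ₑ ^ 2 *
    ENNReal.ofReal ((1 + 4 * Real.pi ^ 2 * ‖ξ‖ ^ 2) ^ s)) ^ (1 / 2 : ℝ)

/-! ### The operator -/

/-- The function `Y u = Y^l ∂_l u`. -/
noncomputable def applyField {d : ℕ} (Y : Space d → Space d) (u : Space d → ℂ) :
    Space d → ℂ :=
  fun x => fderiv ℝ u x (Y x)

/-- The formal `L^2` adjoint of `Y = Y^l ∂_l`, that is `Y^* v = - ∂_l (Y^l v)`. -/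
noncomputable def applyAdjoint {d : ℕ} (Y : Space d → Space d) (v : Space d → ℂ) :
    Space d → ℂ :=
  fun x => - ∑ l : Fin d, fderiv ℝ (fun y => ((Y y l : ℝ) : ℂ) * v y) x (basisVec l)

/-- The operator `L u = f u + X_0 u + ∑_j Y_j^* Y_j u`. -/
noncomputable def opL {d r : ℕ} (f : Space d → ℝ) (X₀ : Space d → Space d)
    (Y : Fin r → Space d → Space d) (u : Space d → ℂ) : Space d → ℂ :=
  fun x => (f x : ℂ) * u x + applyField X₀ u x
    + ∑ j : Fin r, applyAdjoint (Y j) (applyField (Y j) u) x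

/-! ### Regularity assumptions on the coefficients -/

/-- `g` is the weak (distributional) partial derivative `∂_{i_1} ⋯ ∂_{i_m} h` on `ℝ^d`. -/
def IsWeakPartial {d m : ℕ} (i : Fin m → Fin d) (h g : Space d → ℝ) : Prop :=
  LocallyIntegrable g volume ∧
    ∀ φ : Space d → ℝ, SmoothCompact φ →
      ∫ x, h x * iteratedFDeriv ℝ m φ x (fun k => basisVec (i k)) = (-1) ^ m * ∫ x, g x * φ x

/-- `‖ h^{(m)} |x|^γ ‖_∞ < ∞`: every partial derivative of `h` of order `m` is a function which,
multiplied by the weight `|x|^γ`, is essentially bounded. -/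
def WeightedDerivBound {d : ℕ} (m : ℕ) (γ : ℝ) (h : Space d → ℝ) : Prop :=
  ∀ i : Fin m → Fin d, ∃ g : Space d → ℝ,
    IsWeakPartial i h g ∧ eLpNorm (fun x => g x * ‖x‖ ^ γ) ⊤ volume < ⊤

/-- The first base regularity assumption: `f ∈ B_0` and `X_0, Y_1, …, Y_r ∈ T C^1_0`. -/
def AssumptionA1 {d r : ℕ} (f : Space d → ℝ) (X₀ : Space d → Space d)
    (Y : Fin r → Space d → Space d) : Prop :=
  BoundedMeasurableCompact f ∧ (ContDiff ℝ 1 X₀ ∧ HasCompactSupport X₀) ∧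
    ∀ j, ContDiff ℝ 1 (Y j) ∧ HasCompactSupport (Y j)

/-- The second base regularity assumption: `f ∈ B_0`, `X_0 ∈ T C^{3/2}_0`,
`Y_1, …, Y_r ∈ T C^{5/2}_0`, and the weighted bounds on the derivatives of the coefficients of
orders two and three (for `X_0`) and three and four (for `Y_j`). -/
def AssumptionA2 {d r : ℕ} (f : Space d → ℝ) (X₀ : Space d → Space d)
    (Y : Fin r → Space d → Space d) : Prop :=
  BoundedMeasurableCompact f ∧ HolderCompact 1 (1 / 2) X₀ ∧ (∀ j, HolderCompact 2 (1 / 2) (Y j)) ∧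
    ∃ γ₁ γ₂ : ℝ, 0 ≤ γ₁ ∧ γ₁ < min 1 ((d : ℝ) / 2) ∧ 0 ≤ γ₂ ∧ γ₂ < min 2 ((d : ℝ) / 2) ∧
      (∀ l : Fin d, WeightedDerivBound 2 γ₁ (fun x => X₀ x l) ∧
        WeightedDerivBound 3 γ₂ (fun x => X₀ x l)) ∧
      (∀ (j : Fin r) (l : Fin d), WeightedDerivBound 3 γ₁ (fun x => Y j x l) ∧
        WeightedDerivBound 4 γ₂ (fun x => Y j x l))

/-! ### Families of vector fields -/

/-- The comparison condition `‖V u‖² ≤ C ∑_j ‖Y_j u‖²` for all `u ∈ C^∞_0(ℝ^d : ℂ)`, with a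
constant `C` independent of `u`. -/
def Comparison {d r : ℕ} (Y : Fin r → Space d → Space d) (V : Space d → Space d) : Prop :=
  ∃ C : ℝ, 0 < C ∧ ∀ u : Space d → ℂ, SmoothCompact u →
    normL2 (applyField V u) ^ 2 ≤ ENNReal.ofReal C * ∑ j, normL2 (applyField (Y j) u) ^ 2

/-- `F_0`: the smooth compactly supported vector fields satisfying the comparison condition. -/
def familyZero {d r : ℕ} (Y : Fin r → Space d → Space d) : Set (Space d → Space d) :=
  {V | SmoothCompact V ∧ Comparison Y V}

/-- `F_0^B`: the bounded measurable compactly supported vector fields satisfying the comparison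
condition. -/
def familyZeroB {d r : ℕ} (Y : Fin r → Space d → Space d) : Set (Space d → Space d) :=
  {V | BoundedMeasurableCompact V ∧ Comparison Y V}

/-- `F_1`: the brackets `[V, W]` with `V, W ∈ F_0`, together with `X`. -/
def familyOne {d r : ℕ} (Y : Fin r → Space d → Space d) (X : Space d → Space d) :
    Set (Space d → Space d) :=
  {U | (∃ V ∈ familyZero Y, ∃ W ∈ familyZero Y, U = VectorField.lieBracket ℝ V W) ∨ U = X}

/-- `F_k`: for `k ≥ 2` it consists of the brackets `[V, W]` with `V ∈ F_0`, `W ∈ F_{k-1}` and the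
brackets `[V, W]` with `V ∈ F_1`, `W ∈ F_{k-2}`. -/
def family {d r : ℕ} (Y : Fin r → Space d → Space d) (X : Space d → Space d) :
    ℕ → Set (Space d → Space d)
  | 0 => familyZero Y
  | 1 => familyOne Y X
  | (k + 2) =>
    {U | (∃ V ∈ familyZero Y, ∃ W ∈ family Y X (k + 1), U = VectorField.lieBracket ℝ V W) ∨
      (∃ V ∈ familyOne Y X, ∃ W ∈ family Y X k, U = VectorField.lieBracket ℝ V W)}

/-- `Lie(S)`: the smallest real vector space of vector fields that contains `S` and is closed under
the bracket. -/
inductive LieGenerated {d : ℕ} (S : Set (Space d → Space d)) : (Space d → Space d) → Prop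
  | of (V : Space d → Space d) (hV : V ∈ S) : LieGenerated S V
  | zero : LieGenerated S 0
  | add (V W : Space d → Space d) (hV : LieGenerated S V) (hW : LieGenerated S W) :
      LieGenerated S (V + W)
  | smul (c : ℝ) (V : Space d → Space d) (hV : LieGenerated S V) : LieGenerated S (c • V)
  | bracket (V W : Space d → Space d) (hV : LieGenerated S V) (hW : LieGenerated S W) :
      LieGenerated S (VectorField.lieBracket ℝ V W)

end RoughOperator

open RoughOperator

set_option linter.unusedSectionVars false

/-! Negative Sobolev norms are traded for the semiclassical resolvent R = (1 - h²Δ)⁻¹. With N(u) =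
‖ℒu‖ + ‖u‖, the statement propagated through brackets is `ResolventEstimate`: ‖R V u‖ ≤ C h^(ε-1)
N(u), uniformly in u and in h ∈ (0,1]. A derivative next to R costs h⁻¹, while commuting a field
past R costs O(1), because the commutator with 1 - h²Δ carries a factor h². Each step is thus a
count of powers of h. Summing over h = 2⁻ⁿ recovers the Sobolev norm with an arbitrarily small loss
γ (`normSobolev_le_of_opR`). All operators are endomorphisms of the Schwartz space with the L² norm,
so composition and formal adjoints raise no domain questions.

Four estimates carry the theorem. (a) Energy: pairing ℒu with u gives ‖V u‖ ≤ C N(u) for every V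
that satisfies the comparison condition (`comparison_bound`). (b) Bracket with V ∈ F₀: ‖R[V,W]u‖² is
expanded and integrated by parts; V u is O(1) and R W u is O(h^(ε-1)), so the square is O(h^(ε-2))
and ε becomes ε/2 (`bracket_bound`). (c) Drift: X u equals an L² function minus ∑ Y_j*Y_j u; testing
against R²X u gives ‖R X u‖² = O(h⁻¹), hence ε = 1/2 (`drift_bound`). (d) Bracket with X: X u is not
in L², so the main terms ⟨X u, P u⟩, P = Z*R²W, Z = [X,W], are rewritten through the equation. This
needs Y_j P u, which a second energy argument controls (`energy_bound`); two square roots turn ε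
into ε/4 (`drift_bracket_bound`).

For (c) and (d) the rough fields Y_j are mollified. The commutators involve three derivatives of the
coefficients, and the third ones only have to be multipliers from H¹ to L². The weight |x|^γ₁ with
γ₁ < min(1, d/2) provides this through Hardy's inequality, uniformly along the mollification,
because the constant in `hardy_inequality` does not depend on the centre (`hardy_of_mollify`). The
limit is taken at fixed u and h (`exists_approximation`, `resolventEstimate_of_approximation`).

Part (i) is an induction on k, with the Jacobi identity for brackets with [V₁,V₂] ∈ F₁
(`family_resolventEstimate`). Part (ii) uses only (a), (b) and Jacobi, so C¹ coefficients suffice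
(`LieGenerated.resolventEstimate`). -/

namespace RoughOperator

section

/-! ### Families of operators with bounds in powers of a small parameter -/

section Families

variable {ι E : Type*} [NormedAddCommGroup E] [InnerProductSpace ℂ E]

/-- The family of operators `T i` is `O(h i ^ s)`, uniformly in `i`. -/
def OpBound (h : ι → ℝ) (s : ℝ) (T : ι → Module.End ℂ E) : Prop :=
  ∃ c : ℝ, 0 ≤ c ∧ ∀ i φ, ‖T i φ‖ ≤ c * h i ^ s * ‖φ‖

/-- The family of vectors `x i` is `O(h i ^ s * N i)`, uniformly in `i`. -/
def VecBound (h N : ι → ℝ) (s : ℝ) (x : ι → E) : Prop :=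
  ∃ c : ℝ, 0 ≤ c ∧ ∀ i, ‖x i‖ ≤ c * h i ^ s * N i

/-- The family of scalars `z i` is `O(h i ^ s * N i ^ 2)`, uniformly in `i`. -/
def ScalarBound (h N : ι → ℝ) (s : ℝ) (z : ι → ℂ) : Prop :=
  ∃ c : ℝ, 0 ≤ c ∧ ∀ i, ‖z i‖ ≤ c * h i ^ s * N i ^ 2

/-- The inner product of two families of vectors. -/
noncomputable def ip (x y : ι → E) : ι → ℂ := fun i => inner ℂ (x i) (y i)

/-- The values of the parameter lie in `(0, 1]`. -/
def SmallParam (h : ι → ℝ) : Prop := ∀ i, 0 < h i ∧ h i ≤ 1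

lemma ip_add_left (x y z : ι → E) : ip (x + y) z = ip x z + ip y z := by
  funext i; simp [ip]
lemma ip_add_right (x y z : ι → E) : ip x (y + z) = ip x y + ip x z := by
  funext i; simp [ip]
lemma ip_sub_left (x y z : ι → E) : ip (x - y) z = ip x z - ip y z := by
  funext i; simp [ip]
lemma ip_sub_right (x y z : ι → E) : ip x (y - z) = ip x y - ip x z := by
  funext i; simp [ip]
lemma ip_neg_left (x y : ι → E) : ip (-x) y = - ip x y := by
  funext i; simp [ip]
lemma ip_neg_right (x y : ι → E) : ip x (-y) = - ip x y := by
  funext i; simp [ip]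
lemma star_ip (x y : ι → E) : star (ip x y) = ip y x := by
  funext i; simp [ip]

variable {h N : ι → ℝ} {s t : ℝ}

lemma OpBound.add {S T : ι → Module.End ℂ E} (hS : OpBound h s S) (hT : OpBound h s T) :
    OpBound h s (S + T) := by
  obtain ⟨c, hc, H⟩ := hS
  obtain ⟨c', hc', H'⟩ := hT
  refine ⟨c + c', by positivity, fun i φ => ?_⟩
  calc ‖(S + T) i φ‖ ≤ ‖S i φ‖ + ‖T i φ‖ := norm_add_le _ _
    _ ≤ _ := by linarith [H i φ, H' i φ]

lemma OpBound.neg {T : ι → Module.End ℂ E} (hT : OpBound h s T) : OpBound h s (-T) := by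
  obtain ⟨c, hc, H⟩ := hT
  exact ⟨c, hc, fun i φ => by simpa using H i φ⟩

lemma OpBound.sub {S T : ι → Module.End ℂ E} (hS : OpBound h s S) (hT : OpBound h s T) :
    OpBound h s (S - T) := by
  rw [sub_eq_add_neg]; exact hS.add hT.neg

lemma OpBound.mul (hh : SmallParam h) {S T : ι → Module.End ℂ E} (hS : OpBound h s S)
    (hT : OpBound h t T) : OpBound h (s + t) (S * T) := by
  obtain ⟨c, hc, H⟩ := hS
  obtain ⟨c', hc', H'⟩ := hT
  refine ⟨c * c', by positivity, fun i φ => ?_⟩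
  have h0 := (hh i).1
  have hp : 0 ≤ c * h i ^ s := by positivity
  calc ‖(S * T) i φ‖ = ‖S i (T i φ)‖ := rfl
    _ ≤ c * h i ^ s * ‖T i φ‖ := H _ _
    _ ≤ c * h i ^ s * (c' * h i ^ t * ‖φ‖) := by gcongr; exact H' _ _
    _ = _ := by rw [Real.rpow_add h0]; ring

lemma OpBound.mono (hh : SmallParam h) {T : ι → Module.End ℂ E} (hT : OpBound h s T) (hst : t ≤ s) :
    OpBound h t T := by
  obtain ⟨c, hc, H⟩ := hT
  refine ⟨c, hc, fun i φ => (H i φ).trans ?_⟩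
  gcongr c * ?_ * _
  exact Real.rpow_le_rpow_of_exponent_ge (hh i).1 (hh i).2 hst

/-- Duality: ‖Sφ‖² = ⟨T Sφ, φ⟩, then cancel one factor ‖Sφ‖. Bounds with the resolvent on the right
thereby give bounds with it on the left. -/
lemma OpBound.adjoint {S T : ι → Module.End ℂ E} (hT : OpBound h s T)
    (hh : SmallParam h) (hST : ∀ x y : ι → E, ip (T • x) y = ip x (S • y)) : OpBound h s S := by
  obtain ⟨c, hc, H⟩ := hT
  refine ⟨c, hc, fun i φ => ?_⟩
  have h0 := (hh i).1
  rcases eq_or_ne ‖S i φ‖ 0 with h1 | h1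
  · rw [h1]; positivity
  have h2 : 0 < ‖S i φ‖ := lt_of_le_of_ne (norm_nonneg _) h1.symm
  have h3 := congrFun (hST (fun _ => S i φ) (fun _ => φ)) i
  simp only [ip, Pi.smul_apply', Module.End.smul_def] at h3
  have h4 : ‖S i φ‖ ^ 2 ≤ c * h i ^ s * ‖S i φ‖ * ‖φ‖ := by
    have : ‖(inner ℂ (S i φ) (S i φ) : ℂ)‖ = ‖S i φ‖ ^ 2 := by
      rw [inner_self_eq_norm_sq_to_K]; simp
    rw [← this, ← h3]
    exact (norm_inner_le_norm _ _).trans (by gcongr; exact H _ _)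
  have : ‖S i φ‖ * ‖S i φ‖ ≤ (c * h i ^ s * ‖φ‖) * ‖S i φ‖ := by nlinarith
  exact le_of_mul_le_mul_right this h2

lemma VecBound.add {x y : ι → E} (hx : VecBound h N s x) (hy : VecBound h N s y) :
    VecBound h N s (x + y) := by
  obtain ⟨c, hc, H⟩ := hx
  obtain ⟨c', hc', H'⟩ := hy
  refine ⟨c + c', by positivity, fun i => ?_⟩
  calc ‖(x + y) i‖ ≤ ‖x i‖ + ‖y i‖ := norm_add_le _ _
    _ ≤ _ := by linarith [H i, H' i]

lemma VecBound.neg {x : ι → E} (hx : VecBound h N s x) : VecBound h N s (-x) := by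
  obtain ⟨c, hc, H⟩ := hx
  exact ⟨c, hc, fun i => by simpa using H i⟩

lemma VecBound.sub {x y : ι → E} (hx : VecBound h N s x) (hy : VecBound h N s y) :
    VecBound h N s (x - y) := by
  rw [sub_eq_add_neg]; exact hx.add hy.neg

lemma VecBound.mono (hh : SmallParam h) (hN : 0 ≤ N) {x : ι → E} (hx : VecBound h N s x)
    (hst : t ≤ s) : VecBound h N t x := by
  obtain ⟨c, hc, H⟩ := hx
  refine ⟨c, hc, fun i => (H i).trans ?_⟩
  gcongr c * ?_ * _
  · exact hN i
  · exact Real.rpow_le_rpow_of_exponent_ge (hh i).1 (hh i).2 hst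

lemma OpBound.smul (hh : SmallParam h) {T : ι → Module.End ℂ E} {x : ι → E}
    (hT : OpBound h s T) (hx : VecBound h N t x) : VecBound h N (s + t) (T • x) := by
  obtain ⟨c, hc, H⟩ := hT
  obtain ⟨c', hc', H'⟩ := hx
  refine ⟨c * c', by positivity, fun i => ?_⟩
  have h0 := (hh i).1
  calc ‖(T • x) i‖ = ‖T i (x i)‖ := rfl
    _ ≤ c * h i ^ s * ‖x i‖ := H _ _
    _ ≤ c * h i ^ s * (c' * h i ^ t * N i) := by gcongr; exact H' _
    _ = _ := by rw [Real.rpow_add h0]; ring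

lemma VecBound.inner (hh : SmallParam h) (hN : 0 ≤ N) {x y : ι → E}
    (hx : VecBound h N s x) (hy : VecBound h N t y) : ScalarBound h N (s + t) (ip x y) := by
  obtain ⟨c, hc, H⟩ := hx
  obtain ⟨c', hc', H'⟩ := hy
  refine ⟨c * c', by positivity, fun i => ?_⟩
  have h0 := (hh i).1
  have h1 := hN i
  simp only [Pi.zero_apply] at h1
  calc ‖ip x y i‖ ≤ ‖x i‖ * ‖y i‖ := norm_inner_le_norm _ _
    _ ≤ (c * h i ^ s * N i) * (c' * h i ^ t * N i) := by
        gcongr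
        · exact H _
        · exact H' _
    _ = _ := by rw [Real.rpow_add h0]; ring

lemma ScalarBound.add {x y : ι → ℂ} (hx : ScalarBound h N s x) (hy : ScalarBound h N s y) :
    ScalarBound h N s (x + y) := by
  obtain ⟨c, hc, H⟩ := hx
  obtain ⟨c', hc', H'⟩ := hy
  refine ⟨c + c', by positivity, fun i => ?_⟩
  calc ‖(x + y) i‖ ≤ ‖x i‖ + ‖y i‖ := norm_add_le _ _
    _ ≤ _ := by linarith [H i, H' i]

lemma ScalarBound.neg {x : ι → ℂ} (hx : ScalarBound h N s x) : ScalarBound h N s (-x) := by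
  obtain ⟨c, hc, H⟩ := hx
  exact ⟨c, hc, fun i => by simpa using H i⟩

lemma ScalarBound.sub {x y : ι → ℂ} (hx : ScalarBound h N s x) (hy : ScalarBound h N s y) :
    ScalarBound h N s (x - y) := by
  rw [sub_eq_add_neg]; exact hx.add hy.neg

lemma ScalarBound.star {x : ι → ℂ} (hx : ScalarBound h N s x) : ScalarBound h N s (star x) := by
  obtain ⟨c, hc, H⟩ := hx
  exact ⟨c, hc, fun i => by simpa using H i⟩

lemma ScalarBound.sum {κ : Type*} (F : Finset κ) {x : κ → ι → ℂ}
    (hx : ∀ j ∈ F, ScalarBound h N s (x j)) : ScalarBound h N s (∑ j ∈ F, x j) := by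
  classical
  induction F using Finset.induction_on with
  | empty => exact ⟨0, le_rfl, fun i => by simp⟩
  | insert a F ha ih =>
    rw [Finset.sum_insert ha]
    exact (hx a (by simp)).add (ih fun j hj => hx j (by simp [hj]))

lemma OpBound.sum {κ : Type*} (F : Finset κ) {x : κ → ι → Module.End ℂ E}
    (hx : ∀ j ∈ F, OpBound h s (x j)) : OpBound h s (∑ j ∈ F, x j) := by
  classical
  induction F using Finset.induction_on with
  | empty => exact ⟨0, le_rfl, fun i => by simp⟩
  | insert a F ha ih =>
    rw [Finset.sum_insert ha]
    exact (hx a (by simp)).add (ih fun j hj => hx j (by simp [hj]))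

lemma VecBound.sum {κ : Type*} (F : Finset κ) {x : κ → ι → E}
    (hx : ∀ j ∈ F, VecBound h N s (x j)) : VecBound h N s (∑ j ∈ F, x j) := by
  classical
  induction F using Finset.induction_on with
  | empty => exact ⟨0, le_rfl, fun i => by simp⟩
  | insert a F ha ih =>
    rw [Finset.sum_insert ha]
    exact (hx a (by simp)).add (ih fun j hj => hx j (by simp [hj]))

lemma ScalarBound.mono (hh : SmallParam h) {x : ι → ℂ} (hx : ScalarBound h N s x)
    (hst : t ≤ s) : ScalarBound h N t x := by
  obtain ⟨c, hc, H⟩ := hx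
  refine ⟨c, hc, fun i => (H i).trans ?_⟩
  gcongr c * ?_ * _
  exact Real.rpow_le_rpow_of_exponent_ge (hh i).1 (hh i).2 hst

/-- Every estimate for R Z u is obtained for its square; the square root taken here is what halves
exponents at each bracket. -/
lemma VecBound.of_ip_self (hh : SmallParam h) (hN : 0 ≤ N) {x : ι → E}
    (hx : ScalarBound h N s (ip x x)) : VecBound h N (s / 2) x := by
  obtain ⟨c, hc, H⟩ := hx
  refine ⟨√c, by positivity, fun i => ?_⟩
  have h0 := (hh i).1
  have h1 : 0 ≤ N i := hN i
  have h2 : ‖ip x x i‖ = ‖x i‖ ^ 2 := by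
    simp only [ip]; rw [inner_self_eq_norm_sq_to_K]; simp
  have h3 := H i
  rw [h2] at h3
  refine (pow_le_pow_iff_left₀ (norm_nonneg _) (by positivity) two_ne_zero).1 ?_
  rw [mul_pow, mul_pow, Real.sq_sqrt hc, ← Real.rpow_natCast (h i ^ (s / 2)), ← Real.rpow_mul h0.le]
  rwa [show s / 2 * ((2 : ℕ) : ℝ) = s by norm_num]

end Families

end

/-! ### Abstract bracket and drift estimates, by counting powers of h -/

section

section Abstract

variable {ι E : Type*} [NormedAddCommGroup E] [InnerProductSpace ℂ E]

/-- `R` is a symmetric bounded family of operators with inverse `L`. -/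
structure IsResolvent (h : ι → ℝ) (R L : ι → Module.End ℂ E) : Prop where
  mul_L : R * L = 1
  L_mul : L * R = 1
  symm : ∀ x y : ι → E, ip (R • x) y = ip x (R • y)
  bound : OpBound h 0 R

/-- `A` behaves like a first order differential operator with formal adjoint `-A - g`, relative to
the semiclassical resolvent `R = L⁻¹`. -/
structure FieldLike (h : ι → ℝ) (R L A g : ι → Module.End ℂ E) : Prop where
  adj : ∀ x y : ι → E, ip (A • x) y = - ip x (A • y) - ip x (g • y)
  R_mul : OpBound h (-1) (R * A)
  mul_R : OpBound h (-1) (A * R)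
  R_comm : OpBound h 0 (R * (A * L - L * A))
  comm_R : OpBound h 0 ((A * L - L * A) * R)
  bound : OpBound h 0 g
  R_comm_zero : OpBound h 0 (R * (g * L - L * g))

variable {h N : ι → ℝ} {s t : ℝ} {R L A g : ι → Module.End ℂ E}

/-- The identity [A, R] = -R [A, L] R for an inverse. It keeps a resolvent on each side of [A, L],
so that either R[A, L] or [A, L]R can be used as a bounded factor. -/
lemma IsResolvent.comm (hR : IsResolvent h R L) (A : ι → Module.End ℂ E) :
    A * R = R * A - R * (A * L - L * A) * R := by
  have : R * (A * L - L * A) * R = R * A * (L * R) - (R * L) * A * R := by noncomm_ring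
  rw [this, hR.mul_L, hR.L_mul]
  noncomm_ring

lemma IsResolvent.smul_R (hR : IsResolvent h R L) (A : ι → Module.End ℂ E) (y : ι → E) :
    A • R • y = R • (A • y) - R • ((A * L - L * A) * R) • y := by
  rw [← mul_smul, hR.comm A, sub_smul, mul_smul, mul_smul, mul_smul, mul_smul]

lemma IsResolvent.R_smul (hR : IsResolvent h R L) (A : ι → Module.End ℂ E) (y : ι → E) :
    R • A • y = A • (R • y) + (R * (A * L - L * A)) • R • y := by
  rw [hR.smul_R A y]; simp only [mul_smul]; abel

/-- Moving A through R² while leaving one R outside: that R is then shifted to the other slot of the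
inner product. -/
lemma IsResolvent.smul_RR (hR : IsResolvent h R L) (A : ι → Module.End ℂ E) (y : ι → E) :
    A • R • R • y = R • (R • A • y - R • ((A * L - L * A) * R) • y
      - ((A * L - L * A) * R) • R • y) := by
  rw [hR.smul_R A (R • y), hR.smul_R A y]
  simp only [smul_sub]

/-- The relation `adj` says g = -(A + A*), which is symmetric; formally, compare `adj` with its
complex conjugate. -/
lemma FieldLike.symm (hA : FieldLike h R L A g) (x y : ι → E) : ip (g • x) y = ip x (g • y) := by
  have h1 := hA.adj x y
  have h2 := congrArg star (hA.adj y x)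
  simp only [star_sub, star_neg, star_ip] at h2
  have h3 : ip x (g • y) = - ip x (A • y) - ip (A • x) y := by rw [h1]; ring
  rw [h3, h2]; ring

lemma FieldLike.adj' (hA : FieldLike h R L A g) (x y : ι → E) :
    ip x (A • y) = - ip (A • x) y - ip (g • x) y := by
  rw [hA.symm, hA.adj]; ring

/-- The bracket step: an estimate for `W u` and for `V u` yields one for `[V, W] u`. -/
theorem bracket_bound (hh : SmallParam h) (hN : 0 ≤ N) (hR : IsResolvent h R L)
    {V W gV gW Z : ι → Module.End ℂ E} (hV : FieldLike h R L V gV) (hW : FieldLike h R L W gW)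
    (hZ : Z = V * W - W * V) (hRZ : OpBound h (-1) (R * Z))
    (hVZ : OpBound h (-1) (R * (V * Z - Z * V))) (hWZ : OpBound h (-1) (R * (W * Z - Z * W)))
    {u : ι → E} (hu : VecBound h N 0 u) (hVu : VecBound h N 0 (V • u)) {ε : ℝ} (hε : ε ≤ 1)
    (hWu : VecBound h N (ε - 1) (R • W • u)) (hZWu : VecBound h N (ε - 2) (R • R • Z • W • u)) :
    VecBound h N (ε / 2 - 1) (R • Z • u) := by
  -- The trivial bound for R Z u, with no gain; it serves only in the commutator remainders.
  have hRZu : VecBound h N (-1) (R • Z • u) := by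
    rw [← mul_smul]; exact (hRZ.smul hh hu).mono hh hN (by linarith)
  -- Expansion of ⟨Zu, R²Zu⟩ with Z = VW - WV. In VWu the field V is moved to the right slot,
  -- leaving RWu on the left. In WVu the field W is moved, leaving Vu on the left and R²ZWu on the
  -- right. The rest is commutators and divergences.
  have e1 : ip (R • Z • u) (R • Z • u)
      = - ip (R • W • u) (R • Z • V • u + R • (V * Z - Z * V) • u
            - R • ((V * L - L * V) * R) • Z • u - ((V * L - L * V) * R) • R • Z • u)
        - ip (gV • R • W • u + (R * (gV * L - L * gV)) • R • W • u) (R • Z • u)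
        + ip (V • u) (R • R • Z • W • u + R • R • (W * Z - Z * W) • u
            - R • R • ((W * L - L * W) * R) • Z • u - R • ((W * L - L * W) * R) • R • Z • u)
        + ip (V • u) (gW • R • R • Z • u) := by
    have a1 : ip (R • Z • u) (R • Z • u)
        = ip (V • W • u) (R • R • Z • u) - ip (W • V • u) (R • R • Z • u) := by
      rw [hR.symm, ← ip_sub_left]
      congr 1
      rw [hZ, sub_smul, mul_smul, mul_smul]
    rw [a1, hV.adj (W • u), hW.adj (V • u), hR.smul_RR V, hR.smul_RR W, ← hR.R_smul gV, hR.symm, hR.symm,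
      ← hV.symm]
    simp only [sub_smul (V * Z), sub_smul (W * Z), mul_smul V Z, mul_smul Z V, mul_smul W Z,
      mul_smul Z W, smul_sub, smul_add, ip_add_right, ip_sub_right]
    ring
  have hb : ScalarBound h N (ε - 2) (ip (R • Z • u) (R • Z • u)) := by
    rw [e1]
    have hRr : ∀ {a : ℝ} {y : ι → E}, VecBound h N a y → VecBound h N a (R • y) :=
      fun {a y} hy => (hR.bound.smul hh hy).mono hh hN (by linarith)
    have hRZ' : ∀ {a : ℝ} {y : ι → E}, VecBound h N a y → VecBound h N (a - 1) (R • Z • y) :=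
      fun {a y} hy => by
        rw [← mul_smul]; exact (hRZ.smul hh hy).mono hh hN (by linarith)
    have hcomm : ∀ {A g : ι → Module.End ℂ E}, FieldLike h R L A g →
        VecBound h N (-1) (R • ((A * L - L * A) * R) • Z • u) := fun {A g} hA => by
      have : R • ((A * L - L * A) * R) • Z • u = (R * (A * L - L * A)) • R • Z • u := by
        simp only [mul_smul]
      rw [this]
      exact (hA.R_comm.smul hh hRZu).mono hh hN (by linarith)
    have hcomm' : ∀ {A g : ι → Module.End ℂ E}, FieldLike h R L A g →
        VecBound h N (-1) (((A * L - L * A) * R) • R • Z • u) := fun {A g} hA =>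
      (hA.comm_R.smul hh hRZu).mono hh hN (by linarith)
    have hop : ∀ {T : ι → Module.End ℂ E}, OpBound h (-1) (R * T) →
        VecBound h N (-1) (R • T • u) := fun {T} hT => by
      rw [← mul_smul]; exact (hT.smul hh hu).mono hh hN (by linarith)
    refine ScalarBound.add (ScalarBound.add (ScalarBound.sub (ScalarBound.neg ?_) ?_) ?_) ?_
    -- Main term of the first kind: RWu is O(h^(ε-1)) and its partner, led by RZVu, is O(h⁻¹).
    · refine (hWu.inner hh hN ((((hRZ' hVu).mono hh hN (by linarith)).add (hop hVZ)).sub (hcomm hV)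
        |>.sub (hcomm' hV))).mono hh (by linarith)
    · refine (VecBound.inner (s := ε - 1) hh hN (VecBound.add ?_ ?_) hRZu).mono hh (by linarith)
      · exact (hV.bound.smul hh hWu).mono hh hN (by linarith)
      · exact (hV.R_comm_zero.smul hh hWu).mono hh hN (by linarith)
    -- Main term of the second kind: Vu is O(1) and R²ZWu is O(h^(ε-2)); the remaining terms are
    -- O(h⁻¹), which is enough because ε ≤ 1.
    · refine (hVu.inner (t := ε - 2) hh hN (((hZWu.add ?_).sub ?_).sub ?_)).mono hh (by linarith)
      · exact (hRr (hop hWZ)).mono hh hN (by linarith)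
      · exact (hRr (hcomm hW)).mono hh hN (by linarith)
      · exact (hRr (hcomm' hW)).mono hh hN (by linarith)
    · exact (hVu.inner hh hN (hW.bound.smul hh (hRr hRZu))).mono hh (by linarith)
  exact (VecBound.of_ip_self hh hN hb).mono hh hN (by linarith)

/-- The estimate for the drift field. -/
theorem drift_bound (hh : SmallParam h) (hN : 0 ≤ N) (hR : IsResolvent h R L)
    {κ : Type*} [Fintype κ] {X gX : ι → Module.End ℂ E} {Y gY : κ → ι → Module.End ℂ E}
    (hX : FieldLike h R L X gX) (hY : ∀ j, FieldLike h R L (Y j) (gY j))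
    (hYX : ∀ j, OpBound h (-1) (R * (Y j * X - X * Y j)))
    {u F : ι → E} (hu : VecBound h N 0 u) (hYu : ∀ j, VecBound h N 0 (Y j • u))
    (hFN : VecBound h N 0 F)
    (hF : ∀ y, ip (X • u) y = ip F y - ∑ j, ip (Y j • u) (Y j • y)) :
    VecBound h N (-1 / 2) (R • X • u) := by
  have hRr : ∀ {a : ℝ} {y : ι → E}, VecBound h N a y → VecBound h N a (R • y) :=
    fun {a y} hy => (hR.bound.smul hh hy).mono hh hN (by linarith)
  have hRX : ∀ {y : ι → E}, VecBound h N 0 y → VecBound h N (-1) (R • X • y) :=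
    fun {y} hy => by rw [← mul_smul]; exact (hX.R_mul.smul hh hy).mono hh hN (by linarith)
  -- The weak equation `hF` tested on y = R²Xu. In Y_j R² X u the field Y_j is commuted to the right
  -- until it hits u, where it costs nothing.
  have e1 : ip (R • X • u) (R • X • u) = ip F (R • R • X • u) - ∑ j, ip (Y j • u)
      (R • (R • X • Y j • u + R • (Y j * X - X * Y j) • u
        - (R * (Y j * L - L * Y j)) • R • X • u - ((Y j * L - L * Y j) * R) • R • X • u)) := by
    rw [hR.symm, hF]
    congr 1
    refine Finset.sum_congr rfl fun j _ => ?_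
    rw [hR.smul_RR]
    simp only [sub_smul (Y j * X), mul_smul, smul_sub]
    congr 2
    abel_nf
  have hb : ScalarBound h N (-1) (ip (R • X • u) (R • X • u)) := by
    rw [e1]
    refine ((hFN.inner hh hN (hRr (hRX hu))).mono hh (by linarith)).sub
      (ScalarBound.sum _ fun j _ => ?_)
    refine ((hYu j).inner (t := -1) hh hN (hRr (((hRX (hYu j)).add ?_).sub ?_ |>.sub ?_))).mono hh
      (by linarith)
    · rw [← mul_smul]; exact ((hYX j).smul hh hu).mono hh hN (by linarith)
    · exact ((hY j).R_comm.smul hh (hRX hu)).mono hh hN (by linarith)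
    · exact ((hY j).comm_R.smul hh (hRX hu)).mono hh hN (by linarith)
  exact (VecBound.of_ip_self hh hN hb).mono hh hN (by linarith)

end Abstract

end

/-! ### Abstract energy estimate and the bracket with the drift -/

section

section Abstract

variable {ι E : Type*} [NormedAddCommGroup E] [InnerProductSpace ℂ E]
variable {h N : ι → ℝ} {s t : ℝ} {R L A g : ι → Module.End ℂ E}

/-- One resolvent is reserved for S and one for T. In each term of the expansion the commutator
stands next to a resolvent of its own. -/
lemma IsResolvent.comm_RR (hR : IsResolvent h R L) (A S T : ι → Module.End ℂ E) :
    A * (S * R * R * T) - S * R * R * T * A = (A * S - S * A) * R * (R * T)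
      - S * R * (R * (A * L - L * A)) * (R * T) - S * R * ((A * L - L * A) * R) * (R * T)
      + S * R * (R * (A * T - T * A)) := by
  have h1 : S * (A * R - (R * A - R * (A * L - L * A) * R)) * R * T
      + S * R * (A * R - (R * A - R * (A * L - L * A) * R)) * T = 0 := by
    rw [← hR.comm A]; simp
  rw [← sub_eq_zero, ← h1]
  noncomm_ring

/-- Commuting with a field does not worsen the order: S and T contribute h⁻¹ each, and the
commutators of A with L contribute O(1). -/
lemma IsResolvent.comm_RR_bound (hh : SmallParam h) (hR : IsResolvent h R L)
    (hA : FieldLike h R L A g) {S T : ι → Module.End ℂ E} (hSR : OpBound h (-1) (S * R))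
    (hRT : OpBound h (-1) (R * T)) (hAS : OpBound h (-1) ((A * S - S * A) * R))
    (hAT : OpBound h (-1) (R * (A * T - T * A))) :
    OpBound h (-2) (A * (S * R * R * T) - S * R * R * T * A) := by
  rw [hR.comm_RR]
  refine OpBound.add (OpBound.sub (OpBound.sub ?_ ?_) ?_) ?_
  · exact (hAS.mul hh hRT).mono hh (by norm_num)
  · exact ((hSR.mul hh hA.R_comm).mul hh hRT).mono hh (by norm_num)
  · exact ((hSR.mul hh hA.comm_R).mul hh hRT).mono hh (by norm_num)
  · exact (hSR.mul hh hAT).mono hh (by norm_num)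

lemma FieldLike.adj_mul_R (hh : SmallParam h) (hR : IsResolvent h R L) (hA : FieldLike h R L A g) :
    OpBound h (-1) ((-A - g) * R) := by
  rw [sub_mul, neg_mul]
  exact hA.mul_R.neg.sub ((hA.bound.mul hh hR.bound).mono hh (by norm_num))

lemma FieldLike.ip_smul (hA : FieldLike h R L A g) (x y : ι → E) :
    ip (A • x) y = ip x ((-A - g) • y) := by
  rw [hA.adj, sub_smul, neg_smul, ip_sub_right, ip_neg_right]

lemma FieldLike.smul_ip (hA : FieldLike h R L A g) (x y : ι → E) :
    ip x (A • y) = ip ((-A - g) • x) y := by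
  rw [hA.adj', sub_smul, neg_smul, ip_sub_left, ip_neg_left]

/-- Bounds for the brackets of the field `A` with `S` and with the adjoint correction `g` of `S`. -/
structure BracketLike (h : ι → ℝ) (R A S g : ι → Module.End ℂ E) : Prop where
  R_mul : OpBound h (-1) (R * (A * S - S * A))
  mul_R : OpBound h (-1) ((A * S - S * A) * R)
  bound : OpBound h 0 (A * g - g * A)

lemma BracketLike.adj_mul_R {S : ι → Module.End ℂ E} (hh : SmallParam h) (hR : IsResolvent h R L)
    (H : BracketLike h R A S g) : OpBound h (-1) ((A * (-S - g) - (-S - g) * A) * R) := by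
  have : (A * (-S - g) - (-S - g) * A) * R = -((A * S - S * A) * R) - (A * g - g * A) * R := by
    noncomm_ring
  rw [this]
  exact H.mul_R.neg.sub ((H.bound.mul hh hR.bound).mono hh (by norm_num))

/-- Energy estimate for `P u`. -/
lemma energy_bound (hh : SmallParam h) (hN : 0 ≤ N) {κ : Type*} [Fintype κ]
    {X gX P P' : ι → Module.End ℂ E} {Y : κ → ι → Module.End ℂ E}
    (hX : FieldLike h R L X gX)
    (hPP : ∀ x y : ι → E, ip (P • x) y = ip x (P' • y))
    {u F : ι → E} (hu : VecBound h N 0 u) (hYu : ∀ j, VecBound h N 0 (Y j • u))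
    (hFN : VecBound h N 0 F)
    (hF : ∀ y, ip (X • u) y = ip F y - ∑ j, ip (Y j • u) (Y j • y))
    {a b : ℝ} (hab : a ≤ b)
    (hPu : VecBound h N b (P • u)) (hP' : OpBound h (-2) P')
    (hXP : OpBound h (-2) (X * P - P * X))
    (hYP' : ∀ j, OpBound h (-2) (Y j * P' - P' * Y j))
    (hYP : ∀ j, VecBound h N a ((Y j * P - P * Y j) • u)) (hba : 2 * a ≤ b - 2) (j : κ) :
    VecBound h N a (Y j • P • u) := by
  have hP'' : ∀ x y : ι → E, ip x (P • y) = ip (P' • x) y := fun x y => by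
    rw [← star_ip, hPP, star_ip]
  set w : κ → ι → E := fun j => (Y j * P - P * Y j) • u with hw
  -- P is moved from one slot to the other as P', and the weak equation is applied to y = P'Pu.
  -- Commuting X past P then isolates ⟨X P u, P u⟩, whose real part has order zero.
  have e1 : ∑ j, ip (Y j • P • u) (Y j • P • u) = star (ip F (P' • P • u))
      - star (ip ((X * P - P * X) • u) (P • u)) * (-1) - star (ip (X • P • u) (P • u))
      + ∑ j, (- ip ((Y j * P' - P' * Y j) • P • u) (Y j • u) + ip (Y j • P • u) (w j)) := by
    have e2 : ∀ j, ip (Y j • P • u) (Y j • P • u) = ip (Y j • P' • P • u) (Y j • u)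
        + (- ip ((Y j * P' - P' * Y j) • P • u) (Y j • u) + ip (Y j • P • u) (w j)) := fun j => by
      have : Y j • P • u = P • Y j • u + w j := by
        simp only [hw, sub_smul, mul_smul]; abel
      conv_lhs => rw [this, ip_add_right, ← this, hP'']
      simp only [sub_smul, mul_smul, ip_sub_left]
      ring
    have e3 := congrArg star (hF (P' • P • u))
    rw [Finset.sum_congr rfl fun j _ => e2 j, Finset.sum_add_distrib]
    congr 1
    simp only [star_sub, star_sum, star_ip] at e3 ⊢
    have e4 : ∑ j, ip (Y j • P' • P • u) (Y j • u)
        = ip (P' • P • u) F - ip (P' • P • u) (X • u) := by rw [e3]; ring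
    rw [e4, ← hP'' (P • u) (X • u)]
    simp only [sub_smul, mul_smul, ip_sub_right]
    ring
  -- X is skew up to its divergence, so only the bounded operator gX survives in the real part.
  have hre : ∀ i, (star (ip (X • P • u) (P • u)) i).re = - (ip (P • u) (gX • P • u) i).re / 2 := by
    intro i
    have h1 := congrArg Complex.re (congrFun (hX.adj (P • u) (P • u)) i)
    have h2 := congrArg Complex.re (congrFun (star_ip (P • u) (X • P • u)) i)
    simp only [Pi.sub_apply, Pi.neg_apply, Complex.sub_re, Complex.neg_re, Pi.star_apply,
      Complex.star_def, Complex.conj_re] at h1 h2 ⊢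
    rw [← h2] at h1
    linarith
  have hPPu : VecBound h N (b - 2) (P' • P • u) := (hP'.smul hh hPu).mono hh hN (by linarith)
  obtain ⟨c1, hc1, H1⟩ := (hFN.inner hh hN hPPu).mono (t := 2 * a) hh (by linarith)
  obtain ⟨c2, hc2, H2⟩ := ((hXP.smul hh hu).inner hh hN hPu).mono (t := 2 * a) hh (by linarith)
  obtain ⟨c3, hc3, H3⟩ := (hPu.inner hh hN (hX.bound.smul hh hPu)).mono (t := 2 * a) hh
    (by linarith)
  have H4 : ∀ j, ∃ c, 0 ≤ c ∧ ∀ i, ‖ip ((Y j * P' - P' * Y j) • P • u) (Y j • u) i‖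
      ≤ c * h i ^ (2 * a) * N i ^ 2 := fun j =>
    (((hYP' j).smul hh hPu).inner hh hN (hYu j)).mono (t := 2 * a) hh (by linarith)
  choose c4 hc4 H4 using H4
  choose c5 hc5 H5 using hYP
  -- The factor 2 compensates for half of ∑ ‖Y_j P u‖² being absorbed into the left-hand side.
  refine ⟨√(2 * (c1 + c2 + c3 + ∑ j, (c4 j + c5 j ^ 2))), by positivity, fun i => ?_⟩
  have h0 := (hh i).1
  have hNi : 0 ≤ N i := hN i
  set p := h i ^ (2 * a) * N i ^ 2 with hp
  have hp0 : 0 ≤ p := by positivity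
  have hpa : (h i ^ a * N i) ^ 2 = p := by
    rw [mul_pow, ← Real.rpow_natCast, ← Real.rpow_mul h0.le, hp]; congr 2; push_cast; ring
  have hsq : ∀ j, (ip (Y j • P • u) (Y j • P • u) i).re = ‖(Y j • P • u) i‖ ^ 2 := fun j => by
    simp only [ip]; rw [inner_self_eq_norm_sq_to_K]; norm_cast
  have hmain := congrArg Complex.re (congrFun e1 i)
  simp only [Finset.sum_apply, Pi.add_apply, Pi.sub_apply, Complex.re_sum, Complex.add_re,
    Complex.sub_re, hsq, hre, Pi.neg_apply, Complex.neg_re] at hmain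
  have b1 : (star (ip F (P' • P • u)) i).re ≤ c1 * p := by
    refine (Complex.re_le_norm _).trans ?_
    have := H1 i
    rw [Pi.star_apply, norm_star]; linarith
  have b2 : -((star (ip ((X * P - P * X) • u) (P • u)) * (-1)) i).re ≤ c2 * p := by
    refine (neg_le_abs _).trans ((Complex.abs_re_le_norm _).trans ?_)
    have := H2 i
    simp only [Pi.mul_apply, Pi.star_apply, Pi.neg_apply, Pi.one_apply, norm_mul, norm_star,
      norm_neg, norm_one, mul_one]; linarith
  have b3 : -(-(ip (P • u) (gX • P • u) i).re / 2) ≤ c3 * p := by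
    have h1 := (Complex.re_le_norm (ip (P • u) (gX • P • u) i))
    have := H3 i
    have h3 : 0 ≤ c3 * p := by positivity
    linarith
  -- The pairing of Y_j P u with the commutator [Y_j, P]u is split by ab ≤ a²/2 + b²/2; the first
  -- half is the term absorbed later.
  have b4 : ∑ j, (-(ip ((Y j * P' - P' * Y j) • P • u) (Y j • u) i).re
      + (ip (Y j • P • u) (w j) i).re)
      ≤ ∑ j, (c4 j * p + (‖(Y j • P • u) i‖ ^ 2 / 2 + c5 j ^ 2 * p / 2)) := by
    refine Finset.sum_le_sum fun j _ => add_le_add ?_ ?_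
    · refine (neg_le_abs _).trans ((Complex.abs_re_le_norm _).trans ?_)
      have := H4 j i
      linarith
    · refine (Complex.re_le_norm _).trans ((norm_inner_le_norm _ _).trans ?_)
      have h5 := H5 j i
      have h6 : ‖w j i‖ ^ 2 ≤ c5 j ^ 2 * p := by
        rw [← hpa, ← mul_pow]
        exact pow_le_pow_left₀ (norm_nonneg _) (by rw [← mul_assoc]; exact h5) 2
      nlinarith [sq_nonneg (‖(Y j • P • u) i‖ - ‖w j i‖)]
  simp only [Finset.sum_add_distrib, ← Finset.sum_div, ← Finset.sum_mul] at b4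
  have hle : ‖(Y j • P • u) i‖ ^ 2 ≤ ∑ j, ‖(Y j • P • u) i‖ ^ 2 :=
    Finset.single_le_sum (f := fun j => ‖(Y j • P • u) i‖ ^ 2) (fun _ _ => by positivity)
      (Finset.mem_univ j)
  have h5p : 0 ≤ (∑ j, c5 j ^ 2) * p := mul_nonneg (Finset.sum_nonneg fun _ _ => sq_nonneg _) hp0
  have h4p : 0 ≤ ∑ j, c4 j := Finset.sum_nonneg fun j _ => hc4 j
  have h5q : 0 ≤ ∑ j, c5 j ^ 2 := Finset.sum_nonneg fun _ _ => sq_nonneg _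
  refine (pow_le_pow_iff_left₀ (norm_nonneg _) (by positivity) two_ne_zero).1 ?_
  rw [mul_assoc, mul_pow, hpa, Real.sq_sqrt (by rw [Finset.sum_add_distrib]; positivity),
    Finset.sum_add_distrib]
  simp only [Finset.sum_add_distrib] at hmain
  nlinarith

/-- The bracket step for the drift field. -/
theorem drift_bracket_bound (hh : SmallParam h) (hN : 0 ≤ N) (hR : IsResolvent h R L)
    {κ : Type*} [Fintype κ] {X W Z gX gW gZ : ι → Module.End ℂ E}
    {Y gY : κ → ι → Module.End ℂ E}
    (hX : FieldLike h R L X gX) (hW : FieldLike h R L W gW) (hZf : FieldLike h R L Z gZ)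
    (hY : ∀ j, FieldLike h R L (Y j) (gY j)) (hZ : Z = X * W - W * X)
    (hYW : ∀ j, BracketLike h R (Y j) W gW) (hYZ : ∀ j, BracketLike h R (Y j) Z gZ)
    (hXW : BracketLike h R X W gW) (hXZ : BracketLike h R X Z gZ)
    (hZW : OpBound h (-1) (R * (Z * W - W * Z)))
    {u F : ι → E} (hu : VecBound h N 0 u) (hYu : ∀ j, VecBound h N 0 (Y j • u))
    (hFN : VecBound h N 0 F)
    (hF : ∀ y, ip (X • u) y = ip F y - ∑ j, ip (Y j • u) (Y j • y))
    {δ : ℝ} (hδ0 : 0 ≤ δ) (hδ : δ ≤ 1 / 4) (hXu : VecBound h N (-1 / 2) (R • X • u))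
    (hWu : VecBound h N (4 * δ - 1) (R • W • u))
    (hB : ∀ j, VecBound h N (2 * δ - 1) (R • (Y j * W - W * Y j) • u)) :
    VecBound h N (δ - 1) (R • Z • u) := by
  have hRop : ∀ {T : ι → Module.End ℂ E}, OpBound h (-1) (R * T) →
      VecBound h N (-1) (R • T • u) := fun {T} hT => by
    rw [← mul_smul]; exact (hT.smul hh hu).mono hh hN (by linarith)
  -- P = Z*R²W and P' = W*R²Z are formal adjoints of each other. Moving X in ⟨XWu, R²Zu⟩ and W in
  -- ⟨WXu, R²Zu⟩ produces the same quantity ⟨Xu, Pu⟩, up to conjugation and sign.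
  set P := (-Z - gZ) * R * R * W with hP
  set P' := (-W - gW) * R * R * Z with hP'
  have hPP : ∀ x y : ι → E, ip (P • x) y = ip x (P' • y) := fun x y => by
    rw [hP, hP']
    simp only [mul_smul]
    rw [← hW.ip_smul, ← hR.symm, ← hR.symm, hZf.smul_ip]
  have hPu : VecBound h N (4 * δ - 2) (P • u) := by
    have : P • u = ((-Z - gZ) * R) • R • W • u := by simp only [hP, mul_smul]
    rw [this]
    exact ((hZf.adj_mul_R hh hR).smul hh hWu).mono hh hN (by linarith)
  have hP'b : OpBound h (-2) P' := by
    have : P' = (-W - gW) * R * (R * Z) := by rw [hP']; noncomm_ring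
    rw [this]
    exact ((hW.adj_mul_R hh hR).mul hh hZf.R_mul).mono hh (by norm_num)
  -- Orders for the energy estimate: b = 4δ - 2 for Pu and a = 2δ - 2, which saturates 2a ≤ b - 2.
  -- This is the first of the two square roots.
  have hYPu : ∀ j, VecBound h N (2 * δ - 2) (Y j • P • u) := by
    refine fun j => energy_bound hh hN hX hPP hu hYu hFN hF (b := 4 * δ - 2)
      (by linarith) hPu hP'b ?_ (fun j => ?_) (fun j => ?_) (by linarith) j
    · exact hR.comm_RR_bound hh hX (hZf.adj_mul_R hh hR) hW.R_mul (hXZ.adj_mul_R hh hR) hXW.R_mul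
    · exact hR.comm_RR_bound hh (hY j) (hW.adj_mul_R hh hR) hZf.R_mul ((hYW j).adj_mul_R hh hR)
        (hYZ j).R_mul
    · rw [hP, hR.comm_RR]
      simp only [add_smul, sub_smul _ _ u]
      refine VecBound.add (VecBound.sub (VecBound.sub ?_ ?_) ?_) ?_
      · rw [mul_smul, mul_smul R W]
        exact (((hYZ j).adj_mul_R hh hR).smul hh hWu).mono hh hN (by linarith)
      · rw [mul_smul, mul_smul R W]
        exact (((hZf.adj_mul_R hh hR).mul hh (hY j).R_comm).smul hh hWu).mono hh hN (by linarith)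
      · rw [mul_smul, mul_smul R W]
        exact (((hZf.adj_mul_R hh hR).mul hh (hY j).comm_R).smul hh hWu).mono hh hN (by linarith)
      -- The only term of [Y_j, P]u in which W itself is hit. It needs the estimate for [Y_j, W]u,
      -- where half of the gain 4δ has already been lost.
      · rw [mul_smul, mul_smul R]
        exact ((hZf.adj_mul_R hh hR).smul hh (hB j)).mono hh hN (by linarith)
  have hT : ScalarBound h N (2 * δ - 2) (ip (X • u) (P • u)) := by
    rw [hF]
    refine ((hFN.inner hh hN hPu).mono hh (by linarith)).sub (ScalarBound.sum _ fun j _ => ?_)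
    exact ((hYu j).inner hh hN (hYPu j)).mono hh (by linarith)
  -- The two main terms ⟨Xu, Pu⟩ are separated from remainders in which RWu or RXu meets a factor of
  -- order h⁻¹.
  have e1 : ip (R • Z • u) (R • Z • u) = - star (ip (X • u) (P • u)) - ip (X • u) (P • u)
      - ip (R • W • u) (R • (X * Z - Z * X) • u - (R * (X * L - L * X)) • R • Z • u
        - ((X * L - L * X) * R) • R • Z • u)
      - ip (gX • R • W • u + (R * (gX * L - L * gX)) • R • W • u) (R • Z • u)
      - ip (R • X • u) (R • (Z * W - W * Z) • u + (R * (W * L - L * W)) • R • Z • u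
        + ((W * L - L * W) * R) • R • Z • u - (R * (Z * L - L * Z)) • R • W • u
        - ((Z * L - L * Z) * R) • R • W • u)
      + ip (gW • R • X • u + (R * (gW * L - L * gW)) • R • X • u) (R • Z • u)
      - ip (gZ • R • X • u + (R * (gZ * L - L * gZ)) • R • X • u) (R • W • u) := by
    have a1 : ip (R • Z • u) (R • Z • u)
        = ip (X • W • u) (R • R • Z • u) - ip (W • X • u) (R • R • Z • u) := by
      rw [hR.symm, ← ip_sub_left]
      congr 1
      rw [hZ, sub_smul, mul_smul, mul_smul]
    have a2 : ip (X • W • u) (R • R • Z • u) = - star (ip (X • u) (P • u))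
      - ip (R • W • u) (R • (X * Z - Z * X) • u - (R * (X * L - L * X)) • R • Z • u
        - ((X * L - L * X) * R) • R • Z • u)
      - ip (gX • R • W • u + (R * (gX * L - L * gX)) • R • W • u) (R • Z • u) := by
      rw [star_ip, hX.adj, hR.smul_RR X, ← hX.symm, ← hR.symm (gX • W • u), hR.R_smul gX]
      have : ip (P • u) (X • u) = ip (R • W • u) (R • Z • X • u) := by
        rw [← hR.symm (R • W • u), hZf.smul_ip]
        simp only [hP, mul_smul]
      rw [this, ← hR.symm]
      simp only [sub_smul (X * Z), mul_smul, smul_sub, ip_sub_right]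
      ring
    have a3 : ip (W • X • u) (R • R • Z • u) = ip (X • u) (P • u)
      + ip (R • X • u) (R • (Z * W - W * Z) • u + (R * (W * L - L * W)) • R • Z • u
        + ((W * L - L * W) * R) • R • Z • u - (R * (Z * L - L * Z)) • R • W • u
        - ((Z * L - L * Z) * R) • R • W • u)
      - ip (gW • R • X • u + (R * (gW * L - L * gW)) • R • X • u) (R • Z • u)
      + ip (gZ • R • X • u + (R * (gZ * L - L * gZ)) • R • X • u) (R • W • u) := by
      have b1 : ip (X • u) (P • u) = - ip (X • u) (Z • R • R • W • u)
          - ip (X • u) (gZ • R • R • W • u) := by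
        simp only [hP, mul_smul, sub_smul (-Z), neg_smul, ip_sub_right, ip_neg_right]
      rw [b1, hW.adj, ← hR.R_smul gW, ← hR.R_smul gZ, hR.symm (gW • X • u), hR.symm (gZ • X • u),
        hW.symm, hZf.symm, hR.smul_RR W, hR.smul_RR Z, ← hR.symm, ← hR.symm]
      simp only [sub_smul (Z * W), mul_smul, smul_sub, ip_sub_right, ip_add_right]
      ring
    rw [a1, a2, a3]
    ring
  have hRZu := hRop hZf.R_mul
  have hRWu := hRop hW.R_mul
  have hcR : ∀ {A g : ι → Module.End ℂ E} {y : ι → E} {a : ℝ}, FieldLike h R L A g →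
      VecBound h N a y → VecBound h N a ((R * (A * L - L * A)) • y) := fun {A g y a} hA hy =>
    (hA.R_comm.smul hh hy).mono hh hN (by linarith)
  have hRc : ∀ {A g : ι → Module.End ℂ E} {y : ι → E} {a : ℝ}, FieldLike h R L A g →
      VecBound h N a y → VecBound h N a (((A * L - L * A) * R) • y) := fun {A g y a} hA hy =>
    (hA.comm_R.smul hh hy).mono hh hN (by linarith)
  have hg : ∀ {A g : ι → Module.End ℂ E} {y : ι → E} {a : ℝ}, FieldLike h R L A g →
      VecBound h N a y → VecBound h N a (g • y + (R * (g * L - L * g)) • y) :=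
    fun {A g y a} hA hy => ((hA.bound.smul hh hy).mono hh hN (by linarith)).add
      ((hA.R_comm_zero.smul hh hy).mono hh hN (by linarith))
  have hb : ScalarBound h N (2 * δ - 2) (ip (R • Z • u) (R • Z • u)) := by
    rw [e1]
    refine ((((((hT.star.neg.sub hT).sub ?_).sub ?_).sub ?_).add ?_).sub ?_)
    · exact (hWu.inner hh hN (((hRop hXZ.R_mul).sub (hcR hX hRZu)).sub (hRc hX hRZu))).mono hh
        (by linarith)
    · exact ((hg hX hWu).inner hh hN hRZu).mono hh (by linarith)
    -- RXu contributes h^(-1/2) and its partner h⁻¹. The total h^(-3/2) is admissible exactly when δ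
    -- ≤ 1/4.
    · exact (hXu.inner hh hN (((((hRop hZW).add (hcR hW hRZu)).add (hRc hW hRZu)).sub
        (hcR hZf hRWu)).sub (hRc hZf hRWu))).mono hh (by linarith)
    · exact ((hg hW hXu).inner hh hN hRZu).mono hh (by linarith)
    · exact ((hg hZf hXu).inner hh hN hRWu).mono hh (by linarith)
  exact (VecBound.of_ip_self hh hN hb).mono hh hN (by linarith)

end Abstract

end

section

open scoped SchwartzMap LineDeriv

/-! ### Schwartz functions with the `L²` inner product -/

/-- The space of Schwartz functions, to be normed by the `L²` norm. -/
def SchwartzL2 (d : ℕ) : Type := 𝓢(Space d, ℂ)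

variable {d : ℕ}

namespace SchwartzL2

noncomputable instance : AddCommGroup (SchwartzL2 d) := inferInstanceAs (AddCommGroup 𝓢(Space d, ℂ))
noncomputable instance : Module ℂ (SchwartzL2 d) := inferInstanceAs (Module ℂ 𝓢(Space d, ℂ))

/-- A Schwartz function as an element of `SchwartzL2`. -/
noncomputable def of : 𝓢(Space d, ℂ) ≃ₗ[ℂ] SchwartzL2 d := LinearEquiv.refl ℂ _

/-- The embedding into `L²`. -/
noncomputable def toL2 : SchwartzL2 d →ₗ[ℂ] Lp ℂ 2 (volume : Measure (Space d)) :=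
  (SchwartzMap.toLpCLM ℂ ℂ 2 (volume : Measure (Space d))).toLinearMap ∘ₗ
    (of (d := d)).symm.toLinearMap

lemma toL2_of (φ : 𝓢(Space d, ℂ)) : toL2 (of φ) = φ.toLp 2 := rfl

lemma toL2_injective : Function.Injective (toL2 (d := d)) :=
  SchwartzMap.injective_toLp (F := ℂ) 2 (volume : Measure (Space d))

noncomputable instance : NormedAddCommGroup (SchwartzL2 d) :=
  NormedAddCommGroup.induced (SchwartzL2 d) (Lp ℂ 2 (volume : Measure (Space d))) toL2
    toL2_injective

lemma norm_def (φ : SchwartzL2 d) : ‖φ‖ = ‖toL2 φ‖ := rfl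

noncomputable instance : InnerProductSpace ℂ (SchwartzL2 d) where
  norm_smul_le c φ := by simp only [norm_def, map_smul]; exact norm_smul_le _ _
  inner φ ψ := inner ℂ (toL2 φ) (toL2 ψ)
  norm_sq_eq_re_inner φ := norm_sq_eq_re_inner (𝕜 := ℂ) (toL2 φ)
  conj_inner_symm φ ψ := inner_conj_symm (𝕜 := ℂ) (toL2 φ) (toL2 ψ)
  add_left φ ψ χ := by simp only [map_add]; exact inner_add_left _ _ _
  smul_left φ ψ c := by simp only [map_smul]; exact inner_smul_left _ _ _

lemma inner_of (φ ψ : 𝓢(Space d, ℂ)) :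
    inner ℂ (of φ) (of ψ) = ∫ x, inner ℂ (φ x) (ψ x) :=
  SchwartzMap.inner_toL2_toL2_eq φ ψ volume

lemma norm_of (φ : 𝓢(Space d, ℂ)) : ‖of φ‖ = (eLpNorm φ 2 volume).toReal := by
  rw [norm_def, toL2_of, SchwartzMap.norm_toLp]

lemma norm_of_sq (φ : 𝓢(Space d, ℂ)) : ‖of φ‖ ^ 2 = ∫ x, ‖φ x‖ ^ 2 := by
  have h := inner_self_eq_norm_sq_to_K (𝕜 := ℂ) (of φ)
  rw [inner_of] at h
  have h2 : ∫ x, inner ℂ (φ x) (φ x) = ((∫ x, ‖φ x‖ ^ 2 : ℝ) : ℂ) := by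
    rw [← integral_complex_ofReal]
    refine integral_congr_ae (Filter.Eventually.of_forall fun x => ?_)
    simp [inner_self_eq_norm_sq_to_K]
  rw [h2] at h
  exact (Complex.ofReal_injective (by push_cast at h ⊢; exact h)).symm

lemma enorm_of (φ : 𝓢(Space d, ℂ)) : ENNReal.ofReal ‖of φ‖ = eLpNorm φ 2 volume := by
  rw [norm_of, ENNReal.ofReal_toReal (SchwartzMap.eLpNorm_lt_top φ 2 volume).ne]

lemma norm_le_of_pointwise {φ ψ : 𝓢(Space d, ℂ)} {c : ℝ} (hc : 0 ≤ c)
    (h : ∀ x, ‖φ x‖ ≤ c * ‖ψ x‖) : ‖of φ‖ ≤ c * ‖of ψ‖ := by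
  rw [norm_of, norm_of]
  have := eLpNorm_le_mul_eLpNorm_of_ae_le_mul (μ := volume) (f := φ) (g := ψ)
    (Filter.Eventually.of_forall h) 2
  refine (ENNReal.toReal_mono ?_ this).trans_eq ?_
  · exact (ENNReal.mul_lt_top ENNReal.ofReal_lt_top (SchwartzMap.eLpNorm_lt_top ψ 2 volume)).ne
  · rw [ENNReal.toReal_mul, ENNReal.toReal_ofReal hc]

end SchwartzL2

open SchwartzL2

/-! ### Derivatives, multiplications, Fourier multipliers -/

/-- The algebra of operators on Schwartz functions. -/
abbrev SchwartzOp (d : ℕ) : Type := Module.End ℂ (SchwartzL2 d)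

/-- The coefficients: real Schwartz functions. -/
abbrev Coef (d : ℕ) : Type := 𝓢(Space d, ℝ)

/-- A linear map on Schwartz functions as an operator. -/
noncomputable def toOp (T : 𝓢(Space d, ℂ) →L[ℂ] 𝓢(Space d, ℂ)) : SchwartzOp d :=
  of.toLinearMap ∘ₗ T.toLinearMap ∘ₗ (of (d := d)).symm.toLinearMap

lemma op_ext {S T : SchwartzOp d} (h : ∀ φ : 𝓢(Space d, ℂ), S (of φ) = T (of φ)) : S = T :=
  LinearMap.ext h

/-- The partial derivative `∂_l`. -/
noncomputable def opD (l : Fin d) : SchwartzOp d :=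
  toOp (LineDeriv.lineDerivOpCLM ℂ 𝓢(Space d, ℂ) (basisVec l))

lemma opD_of (l : Fin d) (φ : 𝓢(Space d, ℂ)) : opD l (of φ) = of (∂_{basisVec l} φ) := rfl

lemma ofReal_hasTemperateGrowth (a : Coef d) :
    Function.HasTemperateGrowth (fun x => ((a x : ℝ) : ℂ)) :=
  Function.Complex.hasTemperateGrowth_ofReal.comp a.hasTemperateGrowth

/-- Multiplication by a real Schwartz function. -/
noncomputable def opM (a : Coef d) : SchwartzOp d :=
  toOp (SchwartzMap.smulLeftCLM ℂ (fun x => ((a x : ℝ) : ℂ)))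

lemma opM_of_apply (a : Coef d) (φ : 𝓢(Space d, ℂ)) (x : Space d) :
    of.symm (opM a (of φ)) x = (a x : ℂ) * φ x :=
  SchwartzMap.smulLeftCLM_apply_apply (ofReal_hasTemperateGrowth a) φ x

/-- The product of two coefficients. -/
noncomputable def coefMul (a b : Coef d) : Coef d :=
  SchwartzMap.pairing (ContinuousLinearMap.mul ℝ ℝ) a b

lemma coefMul_apply (a b : Coef d) (x : Space d) : coefMul a b x = a x * b x := rfl

lemma opM_add (a b : Coef d) : opM (a + b) = opM a + opM b := by
  refine op_ext fun φ => of.symm.injective (SchwartzMap.ext fun x => ?_)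
  rw [LinearMap.add_apply, map_add, add_apply]
  simp only [opM_of_apply, add_apply]
  push_cast; ring

lemma opM_smul (c : ℝ) (a : Coef d) : opM (c • a) = (c : ℂ) • opM a := by
  refine op_ext fun φ => of.symm.injective (SchwartzMap.ext fun x => ?_)
  rw [LinearMap.smul_apply, map_smul, smul_apply]
  simp only [opM_of_apply, smul_apply, smul_eq_mul]
  push_cast; ring

lemma opM_zero : opM (0 : Coef d) = 0 := by
  have := opM_smul 0 (0 : Coef d); simpa using this

lemma opM_neg (a : Coef d) : opM (-a) = - opM a := by
  have := opM_smul (-1) a; simpa using this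

lemma opM_sub (a b : Coef d) : opM (a - b) = opM a - opM b := by
  rw [sub_eq_add_neg, opM_add, opM_neg, sub_eq_add_neg]

lemma opM_sum {κ : Type*} (F : Finset κ) (a : κ → Coef d) :
    opM (∑ j ∈ F, a j) = ∑ j ∈ F, opM (a j) := by
  classical
  induction F using Finset.induction_on with
  | empty => simp [opM_zero]
  | insert j F hj ih => rw [Finset.sum_insert hj, Finset.sum_insert hj, opM_add, ih]

lemma opM_mul (a b : Coef d) : opM (coefMul a b) = opM a * opM b := by
  refine op_ext fun φ => of.symm.injective (SchwartzMap.ext fun x => ?_)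
  have h1 : (opM a * opM b) (of φ) = opM a (of (of.symm (opM b (of φ)))) := rfl
  rw [h1]
  simp only [opM_of_apply, coefMul_apply]
  push_cast; ring

lemma opM_comm (a b : Coef d) : opM a * opM b = opM b * opM a := by
  rw [← opM_mul, ← opM_mul]
  congr 1
  ext x
  simp [coefMul_apply, mul_comm]

lemma opD_comm (k l : Fin d) : opD k * opD l = opD l * opD k := by
  refine op_ext fun φ => ?_
  change of (∂_{basisVec k} (∂_{basisVec l} φ)) = of (∂_{basisVec l} (∂_{basisVec k} φ))
  congr 1
  ext x
  simp only [SchwartzMap.lineDerivOp_apply_eq_fderiv]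
  have hs : IsSymmSndFDerivAt ℝ φ x :=
    (φ.smooth 2).contDiffAt.isSymmSndFDerivAt (by simp)
  have key : ∀ k l : Fin d, fderiv ℝ (∂_{basisVec l} φ : 𝓢(Space d, ℂ)) x (basisVec k)
      = fderiv ℝ (fderiv ℝ φ) x (basisVec k) (basisVec l) := fun k l => by
    have h1 : ((∂_{basisVec l} φ : 𝓢(Space d, ℂ)) : Space d → ℂ)
        = fun y => fderiv ℝ φ y (basisVec l) := by
      ext y; exact SchwartzMap.lineDerivOp_apply_eq_fderiv _ _ _
    have h2 : DifferentiableAt ℝ (fderiv ℝ φ) x :=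
      ((φ.smooth 2).fderiv_right (m := 1) (by norm_num)).differentiable (by norm_num) x
    rw [h1, fderiv_clm_apply h2 (by fun_prop)]
    simp
  rw [key, key]
  exact hs _ _

/-- The Leibniz rule as an operator identity; the commutator algebra of fields rests on it together
with `opD_comm` and `opM_comm`. -/
lemma opD_mul_opM (l : Fin d) (a : Coef d) :
    opD l * opM a = opM a * opD l + opM (∂_{basisVec l} a) := by
  refine op_ext fun φ => of.symm.injective (SchwartzMap.ext fun x => ?_)
  have h1 : (opD l * opM a) (of φ) = of (∂_{basisVec l} (of.symm (opM a (of φ)))) := rfl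
  have h2 : (opM a * opD l) (of φ) = opM a (of (∂_{basisVec l} φ)) := rfl
  rw [LinearMap.add_apply, map_add, add_apply, h1, h2]
  simp only [opM_of_apply, LinearEquiv.symm_apply_apply, SchwartzMap.lineDerivOp_apply_eq_fderiv]
  have h3 : ((of.symm (opM a (of φ)) : 𝓢(Space d, ℂ)) : Space d → ℂ)
      = fun y => (a y : ℂ) * φ y := by ext y; exact opM_of_apply a φ y
  have ha : HasFDerivAt (fun y => ((a y : ℝ) : ℂ)) (Complex.ofRealCLM ∘L fderiv ℝ a x) x :=
    Complex.ofRealCLM.hasFDerivAt.comp x (a.hasFDerivAt x)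
  have h4 : HasFDerivAt (fun y => ((a y : ℝ) : ℂ) * φ y) _ x := ha.mul (φ.hasFDerivAt x)
  rw [h3, h4.fderiv]
  simp
  ring

lemma lineDerivOp_mul (l : Fin d) (a b : Coef d) :
    ∂_{basisVec l} (coefMul a b) = coefMul (∂_{basisVec l} a) b + coefMul a (∂_{basisVec l} b) := by
  ext x
  rw [add_apply, coefMul_apply, coefMul_apply]
  simp only [SchwartzMap.lineDerivOp_apply_eq_fderiv]
  have h3 : ((coefMul a b : Coef d) : Space d → ℝ) = fun y => a y * b y := rfl
  have h4 : HasFDerivAt (fun y => a y * b y) _ x := (a.hasFDerivAt x).mul (b.hasFDerivAt x)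
  rw [h3, h4.fderiv]
  simp
  ring

lemma inner_opD (l : Fin d) (φ ψ : SchwartzL2 d) :
    inner ℂ (opD l φ) ψ = - inner ℂ φ (opD l ψ) := by
  have h := SchwartzMap.integral_bilinear_lineDerivOp_right_eq_neg_left (μ := volume)
    (of.symm φ) (of.symm ψ) ((ContinuousLinearMap.mul ℝ ℂ) ∘L (Complex.conjCLE : ℂ →L[ℝ] ℂ))
    (basisVec l)
  have h1 : inner ℂ (opD l φ) ψ
      = ∫ x, inner ℂ ((∂_{basisVec l} (of.symm φ) : 𝓢(Space d, ℂ)) x) (of.symm ψ x) :=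
    inner_of (∂_{basisVec l} (of.symm φ)) (of.symm ψ)
  have h2 : inner ℂ φ (opD l ψ)
      = ∫ x, inner ℂ (of.symm φ x) ((∂_{basisVec l} (of.symm ψ) : 𝓢(Space d, ℂ)) x) :=
    inner_of (of.symm φ) (∂_{basisVec l} (of.symm ψ))
  rw [h1, h2]
  simp only [RCLike.inner_apply']
  simpa [eq_neg_iff_add_eq_zero, add_comm] using h

lemma inner_opM (a : Coef d) (φ ψ : SchwartzL2 d) :
    inner ℂ (opM a φ) ψ = inner ℂ φ (opM a ψ) := by
  have h1 := inner_of (of.symm (opM a φ)) (of.symm ψ)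
  have h2 := inner_of (of.symm φ) (of.symm (opM a ψ))
  rw [LinearEquiv.apply_symm_apply, LinearEquiv.apply_symm_apply] at h1 h2
  rw [h1, h2]
  refine integral_congr_ae (Filter.Eventually.of_forall fun x => ?_)
  have e1 := opM_of_apply a (of.symm φ) x
  have e2 := opM_of_apply a (of.symm ψ) x
  rw [LinearEquiv.apply_symm_apply] at e1 e2
  simp only [e1, e2, RCLike.inner_apply, map_mul, Complex.conj_ofReal]
  ring

lemma norm_opM_le {a : Coef d} {K : ℝ} (hK : 0 ≤ K) (h : ∀ x, |a x| ≤ K) (φ : SchwartzL2 d) :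
    ‖opM a φ‖ ≤ K * ‖φ‖ := by
  refine norm_le_of_pointwise (φ := of.symm (opM a φ)) (ψ := of.symm φ) hK fun x => ?_
  have e1 := opM_of_apply a (of.symm φ) x
  rw [LinearEquiv.apply_symm_apply] at e1
  rw [e1, norm_mul, Complex.norm_real]
  gcongr
  exact h x

/-- The Fourier multiplier with symbol `g`. -/
noncomputable def opF (g : Space d → ℂ) : SchwartzOp d :=
  toOp (SchwartzMap.fourierMultiplierCLM ℂ g)

lemma fourier_opF {g : Space d → ℂ} (hg : g.HasTemperateGrowth) (φ : 𝓢(Space d, ℂ))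
    (ξ : Space d) : 𝓕 (of.symm (opF g (of φ))) ξ = g ξ * 𝓕 φ ξ := by
  have : of.symm (opF g (of φ)) = 𝓕⁻ (SchwartzMap.smulLeftCLM ℂ g (𝓕 φ)) := rfl
  rw [this, FourierTransform.fourier_fourierInv_eq, SchwartzMap.smulLeftCLM_apply_apply hg,
    smul_eq_mul]

lemma norm_fourier (φ : 𝓢(Space d, ℂ)) : ‖of (𝓕 φ)‖ = ‖of φ‖ :=
  SchwartzMap.norm_fourier_toL2_eq φ

lemma inner_fourier (φ ψ : 𝓢(Space d, ℂ)) : inner ℂ (of (𝓕 φ)) (of (𝓕 ψ)) = inner ℂ (of φ) (of ψ) :=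
  SchwartzMap.inner_fourier_toL2_eq φ ψ

lemma inner_opF {g : Space d → ℝ} (hg : (fun ξ => (g ξ : ℂ)).HasTemperateGrowth)
    (φ ψ : SchwartzL2 d) :
    inner ℂ (opF (fun ξ => (g ξ : ℂ)) φ) ψ = inner ℂ φ (opF (fun ξ => (g ξ : ℂ)) ψ) := by
  have h1 := inner_fourier (of.symm (opF (fun ξ => (g ξ : ℂ)) φ)) (of.symm ψ)
  have h2 := inner_fourier (of.symm φ) (of.symm (opF (fun ξ => (g ξ : ℂ)) ψ))
  rw [LinearEquiv.apply_symm_apply, LinearEquiv.apply_symm_apply] at h1 h2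
  rw [← h1, ← h2, inner_of, inner_of]
  refine integral_congr_ae (Filter.Eventually.of_forall fun x => ?_)
  have e1 := fourier_opF hg (of.symm φ) x
  have e2 := fourier_opF hg (of.symm ψ) x
  rw [LinearEquiv.apply_symm_apply] at e1 e2
  simp only [e1, e2, RCLike.inner_apply, map_mul, Complex.conj_ofReal]
  ring

end

section

open scoped SchwartzMap LineDeriv
open SchwartzL2

variable {d : ℕ}

/-! ### The semiclassical resolvent -/

/-- The Fourier transform on `SchwartzL2`. -/
noncomputable def hat (φ : SchwartzL2 d) : 𝓢(Space d, ℂ) := 𝓕 (of.symm φ)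

lemma hat_add (φ ψ : SchwartzL2 d) : hat (φ + ψ) = hat φ + hat ψ := by
  simp only [hat, map_add, FourierTransform.fourier_add]

lemma hat_smul (c : ℂ) (φ : SchwartzL2 d) : hat (c • φ) = c • hat φ := by
  simp only [hat, map_smul, FourierTransform.fourier_smul]

lemma hat_sub (φ ψ : SchwartzL2 d) : hat (φ - ψ) = hat φ - hat ψ := by
  have := hat_add φ ((-1 : ℂ) • ψ)
  rw [hat_smul] at this
  simpa [sub_eq_add_neg] using this

lemma hat_injective : Function.Injective (hat (d := d)) := fun φ ψ h => by
  have h2 := congrArg (fun f : 𝓢(Space d, ℂ) => 𝓕⁻ f) h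
  simp only [hat, FourierTransform.fourierInv_fourier_eq] at h2
  exact of.symm.injective h2

lemma hat_sum {κ : Type*} (F : Finset κ) (φ : κ → SchwartzL2 d) :
    hat (∑ j ∈ F, φ j) = ∑ j ∈ F, hat (φ j) := by
  classical
  induction F using Finset.induction_on with
  | empty => simpa using hat_smul 0 (0 : SchwartzL2 d)
  | insert j F hj ih => rw [Finset.sum_insert hj, Finset.sum_insert hj, hat_add, ih]

lemma hat_opF {g : Space d → ℂ} (hg : g.HasTemperateGrowth) (φ : SchwartzL2 d) (ξ : Space d) :
    hat (opF g φ) ξ = g ξ * hat φ ξ := fourier_opF hg (of.symm φ) ξ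

lemma hat_opD (l : Fin d) (φ : SchwartzL2 d) (ξ : Space d) :
    hat (opD l φ) ξ = (2 * Real.pi * Complex.I * (ξ l : ℝ)) * hat φ ξ := by
  have h1 : hat (opD l φ) = 𝓕 (∂_{basisVec l} (of.symm φ) : 𝓢(Space d, ℂ)) := rfl
  rw [h1, SchwartzMap.fourier_lineDerivOp_eq, smul_apply,
    SchwartzMap.smulLeftCLM_apply_apply (by fun_prop)]
  have : inner ℝ ξ (basisVec l) = ξ l := by
    simp [basisVec, EuclideanSpace.inner_single_right]
  rw [this]
  simp only [smul_eq_mul, Complex.real_smul, hat]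
  ring

lemma norm_hat (φ : SchwartzL2 d) : ‖of (hat φ)‖ = ‖φ‖ := norm_fourier _

lemma norm_le_of_hat {φ ψ : SchwartzL2 d} {c : ℝ} (hc : 0 ≤ c)
    (h : ∀ ξ, ‖hat φ ξ‖ ≤ c * ‖hat ψ ξ‖) : ‖φ‖ ≤ c * ‖ψ‖ := by
  rw [← norm_hat φ, ← norm_hat ψ]
  exact norm_le_of_pointwise hc h

/-- The symbol of the semiclassical resolvent `(1 - h² Δ)⁻¹`. -/
noncomputable def resSymbol (h : ℝ) (ξ : Space d) : ℝ :=
  (1 + ‖(2 * Real.pi * h) • ξ‖ ^ 2) ^ (-1 : ℝ)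

lemma resSymbol_growth (h : ℝ) :
    Function.HasTemperateGrowth (fun ξ : Space d => (resSymbol h ξ : ℂ)) := by
  refine Function.Complex.hasTemperateGrowth_ofReal.comp ?_
  exact (Function.hasTemperateGrowth_one_add_norm_sq_rpow (Space d) (-1)).comp
    ((2 * Real.pi * h) • ContinuousLinearMap.id ℝ (Space d)).hasTemperateGrowth

lemma resSymbol_eq (h : ℝ) (ξ : Space d) :
    resSymbol h ξ = (1 + (2 * Real.pi * h) ^ 2 * ‖ξ‖ ^ 2)⁻¹ := by
  rw [resSymbol, Real.rpow_neg_one, norm_smul, mul_pow, Real.norm_eq_abs, sq_abs]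

/-- The semiclassical resolvent `(1 - h² Δ)⁻¹`. -/
noncomputable def opR (h : ℝ) : SchwartzOp d := opF (fun ξ => (resSymbol h ξ : ℂ))

/-- The Laplacian. -/
noncomputable def opLap : SchwartzOp d := ∑ l, opD l * opD l

/-- The operator `1 - h² Δ`. -/
noncomputable def opRinv (h : ℝ) : SchwartzOp d := 1 - ((h : ℂ) ^ 2) • opLap

lemma hat_opR (h : ℝ) (φ : SchwartzL2 d) (ξ : Space d) :
    hat (opR h φ) ξ = resSymbol h ξ * hat φ ξ := hat_opF (resSymbol_growth h) φ ξ

lemma hat_opRinv (h : ℝ) (φ : SchwartzL2 d) (ξ : Space d) :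
    hat (opRinv h φ) ξ = (1 + (2 * Real.pi * h) ^ 2 * ‖ξ‖ ^ 2 : ℝ) * hat φ ξ := by
  have h1 : opRinv h φ = φ - ((h : ℂ) ^ 2) • ∑ l, opD l (opD l φ) := by
    simp only [opRinv, opLap, LinearMap.sub_apply, LinearMap.smul_apply, LinearMap.sum_apply]
    rfl
  rw [h1, hat_sub, hat_smul, hat_sum, sub_apply, smul_apply, _root_.sum_apply]
  simp only [hat_opD, smul_eq_mul]
  have h2 : ‖ξ‖ ^ 2 = ∑ l, (ξ l) ^ 2 := EuclideanSpace.real_norm_sq_eq ξ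
  have h3 : ∀ l, (2 * Real.pi * Complex.I * (ξ l : ℝ) : ℂ) * (2 * Real.pi * Complex.I * (ξ l : ℝ)
      * hat φ ξ) = -(2 * Real.pi) ^ 2 * hat φ ξ * ((ξ l ^ 2 : ℝ) : ℂ) := fun l => by
    have : Complex.I * Complex.I = -1 := Complex.I_mul_I
    push_cast
    linear_combination (2 * Real.pi * (ξ l : ℝ) : ℂ) ^ 2 * hat φ ξ * this
  simp only [h3, ← Finset.mul_sum]
  rw [h2]
  push_cast
  ring

lemma opR_mul_opRinv (h : ℝ) : opR h * opRinv h = (1 : SchwartzOp d) := by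
  refine LinearMap.ext fun φ => hat_injective (SchwartzMap.ext fun ξ => ?_)
  change hat (opR h (opRinv h φ)) ξ = hat φ ξ
  rw [hat_opR, hat_opRinv, resSymbol_eq, ← mul_assoc, ← Complex.ofReal_mul,
    inv_mul_cancel₀ (by positivity), Complex.ofReal_one, one_mul]

lemma opRinv_mul_opR (h : ℝ) : opRinv h * opR h = (1 : SchwartzOp d) := by
  refine LinearMap.ext fun φ => hat_injective (SchwartzMap.ext fun ξ => ?_)
  change hat (opRinv h (opR h φ)) ξ = hat φ ξ
  rw [hat_opRinv, hat_opR, resSymbol_eq, ← mul_assoc, ← Complex.ofReal_mul,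
    mul_inv_cancel₀ (by positivity), Complex.ofReal_one, one_mul]

lemma opR_comm_opD (h : ℝ) (l : Fin d) : opR h * opD l = opD l * opR h := by
  refine LinearMap.ext fun φ => hat_injective (SchwartzMap.ext fun ξ => ?_)
  change hat (opR h (opD l φ)) ξ = hat (opD l (opR h φ)) ξ
  rw [hat_opR, hat_opD, hat_opD, hat_opR]
  ring

lemma norm_opR_le (h : ℝ) (φ : SchwartzL2 d) : ‖opR h φ‖ ≤ ‖φ‖ := by
  have := norm_le_of_hat (φ := opR h φ) (ψ := φ) zero_le_one fun ξ => by
    rw [hat_opR, norm_mul, Complex.norm_real]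
    gcongr
    rw [resSymbol_eq, Real.norm_of_nonneg (by positivity)]
    refine inv_le_one_of_one_le₀ ?_
    have : 0 ≤ (2 * Real.pi * h) ^ 2 * ‖ξ‖ ^ 2 := by positivity
    linarith
  simpa using this

lemma abs_coord_le (ξ : Space d) (l : Fin d) : |ξ l| ≤ ‖ξ‖ := by
  simpa using PiLp.norm_apply_le ξ l

/-- On the Fourier side this is t / (1 + t²) ≤ 1 with t = 2πh|ξ|. -/
lemma norm_opD_opR_le {h : ℝ} (hh : 0 < h) (l : Fin d) (φ : SchwartzL2 d) :
    ‖opD l (opR h φ)‖ ≤ h⁻¹ * ‖φ‖ := by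
  refine norm_le_of_hat (by positivity) fun ξ => ?_
  rw [hat_opD, hat_opR, ← mul_assoc, norm_mul]
  gcongr
  have h1 := abs_coord_le ξ l
  simp only [norm_mul, Complex.norm_real, Complex.norm_I, Complex.norm_ofNat, Real.norm_eq_abs,
    mul_one]
  have h0 : 0 ≤ (1 + (2 * Real.pi * h) ^ 2 * ‖ξ‖ ^ 2)⁻¹ := by positivity
  rw [resSymbol_eq, abs_of_pos Real.pi_pos, abs_of_nonneg h0,
    ← div_eq_mul_inv, div_le_iff₀ (by positivity), inv_mul_eq_div, le_div_iff₀ hh]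
  nlinarith [sq_nonneg (2 * Real.pi * h * ‖ξ‖ - 1), mul_le_mul_of_nonneg_left h1
    (by positivity : 0 ≤ 2 * Real.pi * h)]

lemma norm_opD_opD_opR_le {h : ℝ} (hh : 0 < h) (k l : Fin d) (φ : SchwartzL2 d) :
    ‖opD k (opD l (opR h φ))‖ ≤ (h ^ 2)⁻¹ * ‖φ‖ := by
  refine norm_le_of_hat (by positivity) fun ξ => ?_
  rw [hat_opD, hat_opD, hat_opR, ← mul_assoc, ← mul_assoc, norm_mul]
  gcongr
  have h1 := abs_coord_le ξ l
  have h2 := abs_coord_le ξ k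
  simp only [norm_mul, Complex.norm_real, Complex.norm_I, Complex.norm_ofNat, Real.norm_eq_abs,
    mul_one]
  have h0 : 0 ≤ (1 + (2 * Real.pi * h) ^ 2 * ‖ξ‖ ^ 2)⁻¹ := by positivity
  rw [resSymbol_eq, abs_of_pos Real.pi_pos, abs_of_nonneg h0,
    ← div_eq_mul_inv, div_le_iff₀ (by positivity), inv_mul_eq_div, le_div_iff₀ (by positivity)]
  have h3 : |ξ k| * |ξ l| ≤ ‖ξ‖ * ‖ξ‖ := by gcongr
  nlinarith [mul_le_mul_of_nonneg_left h3 (by positivity : 0 ≤ (2 * Real.pi * h) ^ 2)]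

/-! ### Families of coefficients -/

variable {ι : Type*}

/-- The partial derivative of a family of coefficients. -/
noncomputable def pd (l : Fin d) (a : ι → Coef d) : ι → Coef d := fun i => ∂_{basisVec l} (a i)

/-- Multiplication by a family of coefficients. -/
noncomputable def famM (a : ι → Coef d) : ι → SchwartzOp d := fun i => opM (a i)

/-- The product of two families of coefficients. -/
noncomputable def fmul (a b : ι → Coef d) : ι → Coef d := fun i => coefMul (a i) (b i)

/-- The constant family `∂_l`. -/
noncomputable def famD (ι : Type*) (l : Fin d) : ι → SchwartzOp d := fun _ => opD l

/-- The family of semiclassical resolvents. -/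
noncomputable def famR (h : ι → ℝ) : ι → SchwartzOp d := fun i => opR (h i)

/-- The family of operators `1 - h² Δ`. -/
noncomputable def famL (h : ι → ℝ) : ι → SchwartzOp d := fun i => opRinv (h i)

/-- The vector field with coefficients `a`. -/
noncomputable def fld (a : Fin d → ι → Coef d) : ι → SchwartzOp d := ∑ l, famM (a l) * famD ι l

/-- The divergence. -/
noncomputable def fdiv (a : Fin d → ι → Coef d) : ι → Coef d := ∑ l, pd l (a l)

/-- The derivative of the family `g` along the vector field with coefficients `a`. -/
noncomputable def along (a : Fin d → ι → Coef d) (g : ι → Coef d) : ι → Coef d :=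
  ∑ l, fmul (a l) (pd l g)

/-- The bracket of two vector fields. -/
noncomputable def brk (a b : Fin d → ι → Coef d) : Fin d → ι → Coef d :=
  fun l => along a (b l) - along b (a l)

/-- Uniformly bounded families of coefficients. -/
def FBdd (a : ι → Coef d) : Prop := ∃ K : ℝ, 0 ≤ K ∧ ∀ i x, |a i x| ≤ K

/-- Families of coefficients that are uniformly bounded multipliers from `H¹` to `L²`. -/
def FHardy (g : ι → Coef d) : Prop :=
  ∃ K : ℝ, 0 ≤ K ∧ ∀ i (φ : SchwartzL2 d), ‖opM (g i) φ‖ ≤ K * (‖φ‖ + ∑ l, ‖opD l φ‖)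

/-- Families of coefficients with uniformly bounded derivatives of order at most `m`, and with
derivatives of order `m + 1` that are uniformly bounded multipliers from `H¹` to `L²`. -/
def FCls : ℕ → (ι → Coef d) → Prop
  | 0, a => FBdd a ∧ ∀ l, FHardy (pd l a)
  | m + 1, a => FBdd a ∧ ∀ l, FCls m (pd l a)

lemma famM_sub (a b : ι → Coef d) : famM (a - b) = famM a - famM b :=
  funext fun _ => opM_sub _ _
lemma famM_mul (a b : ι → Coef d) : famM (fmul a b) = famM a * famM b :=
  funext fun _ => opM_mul _ _
lemma famM_comm (a b : ι → Coef d) : famM a * famM b = famM b * famM a :=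
  funext fun _ => opM_comm _ _
lemma famM_sum {κ : Type*} (F : Finset κ) (a : κ → ι → Coef d) :
    famM (∑ j ∈ F, a j) = ∑ j ∈ F, famM (a j) := by
  funext i
  simp only [famM, Finset.sum_apply, opM_sum]
lemma famD_comm (k l : Fin d) : famD ι k * famD ι l = famD ι l * famD ι k :=
  funext fun _ => opD_comm k l
lemma famD_mul_famM (l : Fin d) (a : ι → Coef d) :
    famD ι l * famM a = famM a * famD ι l + famM (pd l a) :=
  funext fun _ => opD_mul_opM l _
lemma famR_comm_famD (h : ι → ℝ) (l : Fin d) : famR h * famD ι l = famD ι l * famR h :=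
  funext fun _ => opR_comm_opD _ l
lemma pd_add (l : Fin d) (a b : ι → Coef d) : pd l (a + b) = pd l a + pd l b :=
  funext fun _ => LineDeriv.lineDerivOp_add _ _ _
lemma pd_sub (l : Fin d) (a b : ι → Coef d) : pd l (a - b) = pd l a - pd l b :=
  funext fun i => by simp only [pd, Pi.sub_apply, sub_eq_add_neg, LineDeriv.lineDerivOp_add,
    LineDeriv.lineDerivOp_neg]
lemma pd_mul (l : Fin d) (a b : ι → Coef d) :
    pd l (fmul a b) = fmul (pd l a) b + fmul a (pd l b) :=
  funext fun _ => lineDerivOp_mul l _ _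

lemma FBdd.add {a b : ι → Coef d} (ha : FBdd a) (hb : FBdd b) : FBdd (a + b) := by
  obtain ⟨K, hK, H⟩ := ha
  obtain ⟨K', hK', H'⟩ := hb
  exact ⟨K + K', by positivity, fun i x => (abs_add_le _ _).trans (add_le_add (H i x) (H' i x))⟩

lemma FBdd.neg {a : ι → Coef d} (ha : FBdd a) : FBdd (-a) := by
  obtain ⟨K, hK, H⟩ := ha
  exact ⟨K, hK, fun i x => by simpa using H i x⟩

lemma FBdd.mul {a b : ι → Coef d} (ha : FBdd a) (hb : FBdd b) : FBdd (fmul a b) := by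
  obtain ⟨K, hK, H⟩ := ha
  obtain ⟨K', hK', H'⟩ := hb
  refine ⟨K * K', by positivity, fun i x => ?_⟩
  simp only [fmul, coefMul_apply, abs_mul]
  exact mul_le_mul (H i x) (H' i x) (abs_nonneg _) hK

lemma FHardy.add {a b : ι → Coef d} (ha : FHardy a) (hb : FHardy b) : FHardy (a + b) := by
  obtain ⟨K, hK, H⟩ := ha
  obtain ⟨K', hK', H'⟩ := hb
  refine ⟨K + K', by positivity, fun i φ => ?_⟩
  rw [Pi.add_apply, opM_add, add_mul]
  exact (norm_add_le _ _).trans (add_le_add (H i φ) (H' i φ))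

lemma FHardy.neg {a : ι → Coef d} (ha : FHardy a) : FHardy (-a) := by
  obtain ⟨K, hK, H⟩ := ha
  refine ⟨K, hK, fun i φ => ?_⟩
  rw [Pi.neg_apply, opM_neg, LinearMap.neg_apply, norm_neg]
  exact H i φ

lemma FHardy.bdd_mul {a b : ι → Coef d} (ha : FBdd a) (hb : FHardy b) : FHardy (fmul a b) := by
  obtain ⟨K, hK, H⟩ := ha
  obtain ⟨K', hK', H'⟩ := hb
  refine ⟨K * K', by positivity, fun i φ => ?_⟩
  simp only [fmul, opM_mul]
  rw [mul_assoc]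
  exact (norm_opM_le hK (H i) _).trans (by gcongr; exact H' i φ)

lemma fmul_comm (a b : ι → Coef d) : fmul a b = fmul b a := by
  funext i; ext x; simp [fmul, coefMul_apply, mul_comm]

lemma FBdd.hardy {a : ι → Coef d} (ha : FBdd a) : FHardy a := by
  obtain ⟨K, hK, H⟩ := ha
  refine ⟨K, hK, fun i φ => (norm_opM_le hK (H i) _).trans ?_⟩
  gcongr
  have : 0 ≤ ∑ l, ‖opD l φ‖ := by positivity
  linarith

lemma FCls.bdd : ∀ {m : ℕ} {a : ι → Coef d}, FCls m a → FBdd a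
  | 0, _, h => h.1
  | _ + 1, _, h => h.1

lemma FCls.pd {m : ℕ} {a : ι → Coef d} (h : FCls (m + 1) a) (l : Fin d) :
    FCls m (pd l a) := h.2 l

/-- A bounded function is in particular a multiplier from H¹ to L². -/
lemma FCls.of_succ : ∀ {m : ℕ} {a : ι → Coef d}, FCls (m + 1) a → FCls m a
  | 0, _, h => ⟨h.1, fun l => (h.2 l).bdd.hardy⟩
  | _ + 1, _, h => ⟨h.1, fun l => (h.2 l).of_succ⟩

lemma FCls.add : ∀ {m : ℕ} {a b : ι → Coef d}, FCls m a → FCls m b → FCls m (a + b)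
  | 0, a, b, h, h' => ⟨h.1.add h'.1, fun l => by rw [pd_add]; exact (h.2 l).add (h'.2 l)⟩
  | _ + 1, a, b, h, h' => ⟨h.1.add h'.1, fun l => by rw [pd_add]; exact (h.2 l).add (h'.2 l)⟩

lemma FCls.neg : ∀ {m : ℕ} {a : ι → Coef d}, FCls m a → FCls m (-a)
  | 0, a, h => ⟨h.1.neg, fun l => by
      have : RoughOperator.pd l (-a) = -RoughOperator.pd l a :=
        funext fun i => LineDeriv.lineDerivOp_neg _ _
      rw [this]; exact (h.2 l).neg⟩
  | _ + 1, a, h => ⟨h.1.neg, fun l => by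
      have : RoughOperator.pd l (-a) = -RoughOperator.pd l a :=
        funext fun i => LineDeriv.lineDerivOp_neg _ _
      rw [this]; exact (h.2 l).neg⟩

lemma FCls.sub {m : ℕ} {a b : ι → Coef d} (ha : FCls m a) (hb : FCls m b) : FCls m (a - b) := by
  rw [sub_eq_add_neg]; exact ha.add hb.neg

/-- By Leibniz, in the lowest class a Hardy multiplier is only ever multiplied by a bounded
coefficient, never by another Hardy multiplier. -/
lemma FCls.mul : ∀ {m : ℕ} {a b : ι → Coef d}, FCls m a → FCls m b → FCls m (fmul a b)
  | 0, a, b, h, h' => ⟨h.1.mul h'.1, fun l => by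
      rw [pd_mul, fmul_comm (RoughOperator.pd l a)]
      exact (FHardy.bdd_mul h'.1 (h.2 l)).add (FHardy.bdd_mul h.1 (h'.2 l))⟩
  | _ + 1, a, b, h, h' => ⟨h.1.mul h'.1, fun l => by
      rw [pd_mul]
      exact ((h.2 l).mul h'.of_succ).add (h.of_succ.mul (h'.2 l))⟩

lemma FBdd.zero : FBdd (0 : ι → Coef d) := ⟨0, le_rfl, fun i x => by simp⟩

lemma FCls.zero : ∀ {m : ℕ}, FCls m (0 : ι → Coef d) := by
  have hz : ∀ l : Fin d, RoughOperator.pd l (0 : ι → Coef d) = 0 := fun l => by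
    simpa using pd_sub l (0 : ι → Coef d) 0
  intro m
  induction m with
  | zero => exact ⟨FBdd.zero, fun l => by rw [hz]; exact FBdd.zero.hardy⟩
  | succ m ih => exact ⟨FBdd.zero, fun l => by rw [hz]; exact ih⟩

lemma FCls.sum {κ : Type*} {m : ℕ} (F : Finset κ) {a : κ → ι → Coef d}
    (h : ∀ j ∈ F, FCls m (a j)) : FCls m (∑ j ∈ F, a j) := by
  classical
  induction F using Finset.induction_on with
  | empty => exact FCls.zero
  | insert j F hj ih =>
    rw [Finset.sum_insert hj]
    exact (h j (by simp)).add (ih fun k hk => h k (by simp [hk]))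

lemma FBdd.const (a : Coef d) : FBdd (fun _ : ι => a) :=
  ⟨SchwartzMap.seminorm ℝ 0 0 a, apply_nonneg _ _, fun _ x => SchwartzMap.norm_le_seminorm ℝ a x⟩

lemma FCls.const : ∀ (m : ℕ) (a : Coef d), FCls m (fun _ : ι => a)
  | 0, a => ⟨FBdd.const a, fun _ => (FBdd.const _).hardy⟩
  | m + 1, a => ⟨FBdd.const a, fun _ => FCls.const m _⟩

lemma FCls.along {m : ℕ} {a : Fin d → ι → Coef d} {g : ι → Coef d} (ha : ∀ l, FCls m (a l))
    (hg : FCls (m + 1) g) : FCls m (along a g) :=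
  FCls.sum _ fun l _ => (ha l).mul (hg.pd l)

lemma FCls.brk {m : ℕ} {a b : Fin d → ι → Coef d} (ha : ∀ l, FCls (m + 1) (a l))
    (hb : ∀ l, FCls (m + 1) (b l)) (l : Fin d) : FCls m (brk a b l) :=
  (FCls.along (fun l => (ha l).of_succ) (hb l)).sub (FCls.along (fun l => (hb l).of_succ) (ha l))

lemma FCls.fdiv {m : ℕ} {a : Fin d → ι → Coef d} (ha : ∀ l, FCls (m + 1) (a l)) :
    FCls m (fdiv a) := FCls.sum _ fun l _ => (ha l).pd l

/-- Bounds uniform in the mollification index stay uniform once the coefficients are indexed by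
triples of a function, a value of h and that index. -/
lemma FCls.comp {κ : Type*} (f : κ → ι) :
    ∀ {m : ℕ} {a : ι → Coef d}, FCls m a → FCls m (fun k => a (f k))
  | 0, _, ⟨⟨K, hK, H⟩, h⟩ => ⟨⟨K, hK, fun k => H (f k)⟩, fun l => by
      obtain ⟨K', hK', H'⟩ := h l
      exact ⟨K', hK', fun k => H' (f k)⟩⟩
  | _ + 1, _, ⟨⟨K, hK, H⟩, h⟩ => ⟨⟨K, hK, fun k => H (f k)⟩, fun l => FCls.comp f (h l)⟩

end

section

open scoped SchwartzMap LineDeriv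
open SchwartzL2

variable {d : ℕ} {ι : Type*}

/-! ### Semiclassical estimates for vector fields -/

variable {h N : ι → ℝ}

lemma famR_resolvent (h : ι → ℝ) :
    IsResolvent h (famR h : ι → SchwartzOp d) (famL h) where
  mul_L := funext fun i => opR_mul_opRinv _
  L_mul := funext fun i => opRinv_mul_opR _
  symm x y := funext fun i => inner_opF (resSymbol_growth (h i)) (x i) (y i)
  bound := ⟨1, zero_le_one, fun i φ => by
    rw [Real.rpow_zero, one_mul, one_mul]; exact norm_opR_le (h i) φ⟩

lemma bound_famR (h : ι → ℝ) : OpBound h 0 (famR h : ι → SchwartzOp d) :=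
  (famR_resolvent h).bound

lemma bound_D_R (hh : SmallParam h) (l : Fin d) : OpBound h (-1) (famD ι l * famR h) :=
  ⟨1, zero_le_one, fun i φ => by
    rw [one_mul, Real.rpow_neg_one]; exact norm_opD_opR_le (hh i).1 l φ⟩

lemma bound_D_D_R (hh : SmallParam h) (k l : Fin d) :
    OpBound h (-2) (famD ι k * famD ι l * famR h) :=
  ⟨1, zero_le_one, fun i φ => by
    rw [one_mul, Real.rpow_neg (hh i).1.le, Real.rpow_two]
    exact norm_opD_opD_opR_le (hh i).1 k l φ⟩

lemma bound_R_D (hh : SmallParam h) (l : Fin d) : OpBound h (-1) (famR h * famD ι l) := by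
  rw [famR_comm_famD]; exact bound_D_R hh l

lemma bound_R_D_D (hh : SmallParam h) (k l : Fin d) :
    OpBound h (-2) (famR h * famD ι k * famD ι l) := by
  rw [famR_comm_famD, mul_assoc, famR_comm_famD, ← mul_assoc]; exact bound_D_D_R hh k l

lemma FBdd.bound {a : ι → Coef d} (ha : FBdd a) : OpBound h 0 (famM a) := by
  obtain ⟨K, hK, H⟩ := ha
  exact ⟨K, hK, fun i φ => by
    rw [Real.rpow_zero, mul_one]; exact norm_opM_le hK (H i) φ⟩

/-- The H¹ norm of Rφ is at most a constant times h⁻¹‖φ‖, so a Hardy multiplier next to R costs no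
more than a derivative would. -/
lemma FHardy.mul_R {g : ι → Coef d} (hh : SmallParam h) (hg : FHardy g) :
    OpBound h (-1) (famM g * famR h) := by
  obtain ⟨K, hK, H⟩ := hg
  refine ⟨K * (1 + d), by positivity, fun i φ => (H i _).trans ?_⟩
  have h0 := (hh i).1
  have h1 : (1 : ℝ) ≤ (h i)⁻¹ := (one_le_inv₀ h0).2 (hh i).2
  have h2 : ‖famR h i φ‖ ≤ (h i)⁻¹ * ‖φ‖ :=
    (norm_opR_le _ φ).trans (le_mul_of_one_le_left (norm_nonneg _) h1)
  have h3 : ∑ l, ‖opD l (famR h i φ)‖ ≤ ∑ _l : Fin d, (h i)⁻¹ * ‖φ‖ :=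
    Finset.sum_le_sum fun l _ => norm_opD_opR_le h0 l φ
  rw [Finset.sum_const, Finset.card_univ, Fintype.card_fin, nsmul_eq_mul] at h3
  rw [Real.rpow_neg_one]
  calc K * (‖famR h i φ‖ + ∑ l, ‖opD l (famR h i φ)‖)
      ≤ K * ((h i)⁻¹ * ‖φ‖ + d * ((h i)⁻¹ * ‖φ‖)) := by gcongr
    _ = _ := by ring

lemma famM_symm (a : ι → Coef d) (x y : ι → SchwartzL2 d) :
    ip (famM a • x) y = ip x (famM a • y) :=
  funext fun i => inner_opM (a i) (x i) (y i)

lemma FHardy.R_mul {g : ι → Coef d} (hh : SmallParam h) (hg : FHardy g) :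
    OpBound h (-1) (famR h * famM g) := by
  refine (hg.mul_R hh).adjoint hh fun x y => ?_
  rw [mul_smul, mul_smul, famM_symm, (famR_resolvent h).symm]

lemma fld_mul_R (hh : SmallParam h) {a : Fin d → ι → Coef d} (ha : ∀ l, FBdd (a l)) :
    OpBound h (-1) (fld a * famR h) := by
  rw [fld, Finset.sum_mul]
  refine OpBound.sum _ fun l _ => ?_
  rw [mul_assoc]
  exact ((ha l).bound.mul hh (bound_D_R hh l)).mono hh (by norm_num)

/-- Each derivative is brought next to R, at the cost of differentiating the coefficient once. -/
lemma R_mul_fld_eq (a : Fin d → ι → Coef d) :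
    famR h * fld a = ∑ l, (famR h * famD ι l * famM (a l) - famR h * famM (pd l (a l))) := by
  rw [fld, Finset.mul_sum]
  refine Finset.sum_congr rfl fun l _ => ?_
  rw [mul_assoc, famD_mul_famM]
  noncomm_ring

/-- The divergence produced by moving the derivatives need not be bounded: as a Hardy multiplier it
also costs h⁻¹. -/
lemma R_mul_fld (hh : SmallParam h) {a : Fin d → ι → Coef d} (ha : ∀ l, FCls 0 (a l)) :
    OpBound h (-1) (famR h * fld a) := by
  rw [R_mul_fld_eq]
  refine OpBound.sum _ fun l _ => ?_
  exact (((bound_R_D hh l).mul hh (ha l).1.bound).mono hh (by norm_num)).sub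
    (((ha l).2 l).R_mul hh)

lemma fld_adj (a : Fin d → ι → Coef d) (x y : ι → SchwartzL2 d) :
    ip (fld a • x) y = - ip x (fld a • y) - ip x (famM (fdiv a) • y) := by
  have h1 : ∀ l (x y : ι → SchwartzL2 d), ip (famD ι l • x) y = - ip x (famD ι l • y) :=
    fun l x y => funext fun i => inner_opD l (x i) (y i)
  have h2 : ∀ (F : Finset (Fin d)), ip ((∑ l ∈ F, famM (a l) * famD ι l) • x) y
      = - ip x ((∑ l ∈ F, famM (a l) * famD ι l) • y)
        - ip x ((∑ l ∈ F, famM (pd l (a l))) • y) := by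
    classical
    intro F
    induction F using Finset.induction_on with
    | empty => funext i; simp [ip]
    | insert l F hl ih =>
      rw [Finset.sum_insert hl, Finset.sum_insert hl, add_smul, add_smul, add_smul, ip_add_left,
        ip_add_right, ip_add_right, ih, mul_smul, famM_symm, h1, ← mul_smul, famD_mul_famM,
        add_smul, ip_add_right]
      ring
  rw [fdiv, famM_sum]
  exact h2 _

lemma famD_comm_fld (k : Fin d) (a : Fin d → ι → Coef d) :
    famD ι k * fld a = fld a * famD ι k + fld (fun l => pd k (a l)) := by
  simp only [fld, Finset.mul_sum, Finset.sum_mul, ← Finset.sum_add_distrib]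
  refine Finset.sum_congr rfl fun l _ => ?_
  rw [← mul_assoc, famD_mul_famM, add_mul, mul_assoc, famD_comm k l, ← mul_assoc]

/-- The family of Laplacians. -/
noncomputable def famLap (ι : Type*) (d : ℕ) : ι → SchwartzOp d := ∑ l, famD ι l * famD ι l

/-- Only the part h²Δ fails to commute. Its factor h² pays for the h⁻² of a second order operator
adjacent to R, which makes commutators with the resolvent harmless. -/
lemma comm_famL (T : ι → SchwartzOp d) :
    T * famL h - famL h * T = fun i => ((h i : ℂ) ^ 2) • ((famLap ι d * T - T * famLap ι d) i) := by
  have hLap : ∀ i, famLap ι d i = opLap := fun i => by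
    simp only [famLap, opLap, Finset.sum_apply]; rfl
  funext i
  simp only [Pi.sub_apply, Pi.mul_apply, famL, opRinv, hLap, mul_sub, sub_mul, mul_one, one_mul,
    mul_smul_comm, smul_mul_assoc, smul_sub]
  abel

lemma OpBound.scale_sq (hh : SmallParam h) {T : ι → SchwartzOp d} {s t : ℝ} (hT : OpBound h s T)
    (hst : t ≤ s + 2) : OpBound h t (fun i => ((h i : ℂ) ^ 2) • T i) := by
  refine OpBound.mono (s := s + 2) hh ?_ hst
  obtain ⟨c, hc, H⟩ := hT
  refine ⟨c, hc, fun i φ => ?_⟩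
  have h0 := (hh i).1
  rw [LinearMap.smul_apply, norm_smul, norm_pow, Complex.norm_real, Real.norm_of_nonneg h0.le,
    Real.rpow_add h0, Real.rpow_two]
  calc h i ^ 2 * ‖T i φ‖ ≤ h i ^ 2 * (c * h i ^ s * ‖φ‖) := by gcongr; exact H i φ
    _ = _ := by ring

lemma R_comm_bound (hh : SmallParam h) {T : ι → SchwartzOp d} {s : ℝ} (hs : -2 ≤ s)
    (hT : OpBound h s (famR h * (famLap ι d * T - T * famLap ι d))) :
    OpBound h 0 (famR h * (T * famL h - famL h * T)) := by
  have : famR h * (T * famL h - famL h * T)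
      = fun i => ((h i : ℂ) ^ 2) • ((famR h * (famLap ι d * T - T * famLap ι d) : ι → SchwartzOp d) i) := by
    rw [comm_famL]
    funext i
    simp only [Pi.mul_apply, mul_smul_comm]
  rw [this]
  exact hT.scale_sq hh (by linarith)

lemma comm_R_bound (hh : SmallParam h) {T : ι → SchwartzOp d} {s : ℝ} (hs : -2 ≤ s)
    (hT : OpBound h s ((famLap ι d * T - T * famLap ι d) * famR h)) :
    OpBound h 0 ((T * famL h - famL h * T) * famR h) := by
  have : (T * famL h - famL h * T) * famR h
      = fun i => ((h i : ℂ) ^ 2) • (((famLap ι d * T - T * famLap ι d) * famR h : ι → SchwartzOp d) i) := by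
    rw [comm_famL]
    funext i
    simp only [Pi.mul_apply, smul_mul_assoc]
  rw [this]
  exact hT.scale_sq hh (by linarith)

lemma famLap_comm {T : ι → SchwartzOp d} {T' : Fin d → ι → SchwartzOp d}
    (hT : ∀ k, famD ι k * T = T * famD ι k + T' k) :
    famLap ι d * T - T * famLap ι d = ∑ k, (famD ι k * T' k + T' k * famD ι k) := by
  rw [famLap, Finset.sum_mul, Finset.mul_sum, ← Finset.sum_sub_distrib]
  refine Finset.sum_congr rfl fun k _ => ?_
  rw [mul_assoc, hT, mul_add, ← mul_assoc, hT]
  noncomm_ring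

/-- [Δ, g] = ∑ (2 ∂_k (∂_k g) - ∂_k² g) as operators, with the derivative on the left so that R
absorbs it. Second derivatives of g enter only as Hardy multipliers; for g a divergence these are
third derivatives of the field. -/
lemma R_comm_famM (hh : SmallParam h) {g : ι → Coef d} (hg : FCls 1 g) :
    OpBound h 0 (famR h * (famM g * famL h - famL h * famM g)) := by
  refine R_comm_bound (s := -1) hh (by norm_num) ?_
  rw [famLap_comm fun k => famD_mul_famM k g, Finset.mul_sum]
  refine OpBound.sum _ fun k _ => ?_
  have : famR h * (famD ι k * famM (pd k g) + famM (pd k g) * famD ι k)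
      = famR h * famD ι k * famM (pd k g) + famR h * famD ι k * famM (pd k g)
        - famR h * famM (pd k (pd k g)) := by
    rw [mul_assoc, famD_mul_famM]
    noncomm_ring
  rw [this]
  have h1 : OpBound h (-1) (famR h * famD ι k * famM (pd k g)) :=
    ((bound_R_D hh k).mul hh (hg.pd k).1.bound).mono hh (by norm_num)
  exact (h1.add h1).sub (((hg.pd k).2 k).R_mul hh)

/-- With R on the left all derivatives are moved to the left of the coefficients. Up to three
derivatives may fall on a coefficient, and the third ones appear only through `R_mul_fld`, that is,
as Hardy multipliers. -/
lemma R_comm_fld (hh : SmallParam h) {a : Fin d → ι → Coef d} (ha : ∀ l, FCls 2 (a l)) :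
    OpBound h 0 (famR h * (fld a * famL h - famL h * fld a)) := by
  refine R_comm_bound (s := -2) hh (by norm_num) ?_
  rw [famLap_comm fun k => famD_comm_fld k a, Finset.mul_sum]
  refine OpBound.sum _ fun k _ => ?_
  set b : Fin d → ι → Coef d := fun l => pd k (a l) with hb
  have hb1 : ∀ l, FCls 1 (b l) := fun l => (ha l).pd k
  have : famR h * (famD ι k * fld b + fld b * famD ι k)
      = famR h * famD ι k * fld b + famR h * famD ι k * fld b
        - famR h * fld (fun l => pd k (b l)) := by
    have h1 : fld b * famD ι k = famD ι k * fld b - fld (fun l => pd k (b l)) := by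
      rw [famD_comm_fld]; abel
    rw [h1]
    noncomm_ring
  rw [this]
  have h1 : OpBound h (-2) (famR h * famD ι k * fld b) := by
    rw [fld, Finset.mul_sum]
    refine OpBound.sum _ fun l _ => ?_
    have : famR h * famD ι k * (famM (b l) * famD ι l)
        = famR h * famD ι k * famD ι l * famM (b l) - famR h * famD ι k * famM (pd l (b l)) := by
      have h2 : famM (b l) * famD ι l = famD ι l * famM (b l) - famM (pd l (b l)) := by
        rw [famD_mul_famM]; abel
      rw [h2]
      noncomm_ring
    rw [this]
    exact (((bound_R_D_D hh k l).mul hh (hb1 l).bdd.bound).mono hh (by norm_num)).sub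
      (((bound_R_D hh k).mul hh ((hb1 l).pd l).bdd.bound).mono hh (by norm_num))
  exact (h1.add h1).sub ((R_mul_fld hh fun l => (hb1 l).pd k).mono hh (by norm_num))

/-- With R on the right the derivatives already stand next to it, so at most two fall on the
coefficients and boundedness suffices. -/
lemma comm_R_fld (hh : SmallParam h) {a : Fin d → ι → Coef d} (ha : ∀ l, FCls 2 (a l)) :
    OpBound h 0 ((fld a * famL h - famL h * fld a) * famR h) := by
  refine comm_R_bound (s := -2) hh (by norm_num) ?_
  rw [famLap_comm fun k => famD_comm_fld k a, Finset.sum_mul]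
  refine OpBound.sum _ fun k _ => ?_
  set b : Fin d → ι → Coef d := fun l => pd k (a l) with hb
  have hb1 : ∀ l, FCls 1 (b l) := fun l => (ha l).pd k
  rw [famD_comm_fld, add_mul, add_mul]
  have h1 : OpBound h (-2) (fld b * famD ι k * famR h) := by
    rw [fld, Finset.sum_mul, Finset.sum_mul]
    refine OpBound.sum _ fun l _ => ?_
    rw [mul_assoc, mul_assoc, ← mul_assoc (famD ι l)]
    exact ((hb1 l).bdd.bound.mul hh (bound_D_D_R hh l k)).mono hh (by norm_num)
  exact (h1.add ((fld_mul_R hh fun l => ((hb1 l).pd k).bdd).mono hh (by norm_num))).add h1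

lemma fld_fieldLike (hh : SmallParam h) {a : Fin d → ι → Coef d} (ha : ∀ l, FCls 2 (a l)) :
    FieldLike h (famR h) (famL h) (fld a) (famM (fdiv a)) where
  adj := fld_adj a
  R_mul := R_mul_fld hh fun l => (ha l).of_succ.of_succ
  mul_R := fld_mul_R hh fun l => (ha l).bdd
  R_comm := R_comm_fld hh ha
  comm_R := comm_R_fld hh ha
  bound := (FCls.fdiv ha).bdd.bound
  R_comm_zero := R_comm_famM hh (FCls.fdiv ha)

lemma fld_comm_famM (a : Fin d → ι → Coef d) (g : ι → Coef d) :
    fld a * famM g - famM g * fld a = famM (along a g) := by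
  rw [fld, Finset.sum_mul, Finset.mul_sum, ← Finset.sum_sub_distrib, along, famM_sum]
  refine Finset.sum_congr rfl fun l _ => ?_
  rw [mul_assoc, famD_mul_famM, mul_add, ← mul_assoc, famM_comm (a l) g, famM_mul]
  noncomm_ring

lemma fld_mul_fld (a b : Fin d → ι → Coef d) :
    fld a * fld b = ∑ l, (famM (b l) * fld a * famD ι l + famM (along a (b l)) * famD ι l) := by
  conv_lhs => rw [fld.eq_1 b, Finset.mul_sum]
  refine Finset.sum_congr rfl fun l _ => ?_
  rw [← fld_comm_famM]
  noncomm_ring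

/-- The second order parts cancel because partial derivatives commute and multiplications commute.
-/
lemma fld_comm_fld (a b : Fin d → ι → Coef d) :
    fld a * fld b - fld b * fld a = fld (brk a b) := by
  have h1 : ∑ l, famM (b l) * fld a * famD ι l = ∑ l, famM (a l) * fld b * famD ι l := by
    simp only [fld, Finset.mul_sum, Finset.sum_mul]
    rw [Finset.sum_comm]
    refine Finset.sum_congr rfl fun k _ => Finset.sum_congr rfl fun l _ => ?_
    rw [← mul_assoc, famM_comm, mul_assoc, mul_assoc, mul_assoc, famD_comm, mul_assoc]
  rw [fld_mul_fld, fld_mul_fld, Finset.sum_add_distrib, Finset.sum_add_distrib, h1,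
    add_sub_add_left_eq_sub, ← Finset.sum_sub_distrib, fld]
  refine Finset.sum_congr rfl fun l _ => ?_
  rw [brk, famM_sub, sub_mul]

lemma fld_bracketLike (hh : SmallParam h) {a b : Fin d → ι → Coef d} (ha : ∀ l, FCls 1 (a l))
    (hb : ∀ l, FCls 2 (b l)) : BracketLike h (famR h) (fld a) (fld b) (famM (fdiv b)) where
  R_mul := by
    rw [fld_comm_fld]; exact R_mul_fld hh (FCls.brk ha fun l => (hb l).of_succ)
  mul_R := by
    rw [fld_comm_fld]
    exact fld_mul_R hh fun l => (FCls.brk ha (fun l => (hb l).of_succ) l).bdd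
  bound := by
    rw [fld_comm_famM]
    exact (FCls.along (m := 0) (fun l => (ha l).of_succ) (FCls.fdiv hb)).bdd.bound

lemma famM_mul_fld (c : ι → Coef d) (a : Fin d → ι → Coef d) :
    famM c * fld a = fld (fun l => fmul c (a l)) := by
  simp only [fld, Finset.mul_sum, famM_mul, mul_assoc]

/-- A gain for Wu must survive another field b placed in front of it. The derivative in b is pulled
out to meet one R, while the other R is commuted past the coefficient of b to stand in front of Wu,
giving h⁻¹ · h^(ε-1). -/
lemma RR_fld_fld_bound (hh : SmallParam h) (hN : 0 ≤ N) {b w : Fin d → ι → Coef d}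
    (hb : ∀ l, FCls 1 (b l)) (hw : ∀ l, FCls 0 (w l)) {u : ι → SchwartzL2 d} {ε : ℝ} (hε : ε ≤ 1)
    (hu : VecBound h N 0 u) (hWu : VecBound h N (ε - 1) (famR (d := d) h • fld w • u)) :
    VecBound h N (ε - 2) (famR (d := d) h • famR (d := d) h • fld b • fld w • u) := by
  have hR := famR_resolvent (d := d) h
  have e1 : famR (d := d) h • famR (d := d) h • fld b • fld w • u
      = ∑ l, ((famR h * famD ι l) • (famM (b l) • famR (d := d) h • fld w • u
          + (famR h * (famM (b l) * famL h - famL h * famM (b l))) • famR (d := d) h • fld w • u)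
        - famR (d := d) h • (famR h * fld (fun k => fmul (pd l (b l)) (w k))) • u) := by
    rw [← mul_smul (famR h) (fld b), R_mul_fld_eq, Finset.sum_smul, Finset.smul_sum]
    refine Finset.sum_congr rfl fun l _ => ?_
    rw [← hR.R_smul, ← famM_mul_fld, sub_smul, smul_sub]
    congr 1
    simp only [← mul_smul, ← mul_assoc]
    congr 1
    rw [mul_assoc (famR h) (famD ι l) (famR h), ← famR_comm_famD]
    simp only [mul_assoc]
  rw [e1]
  refine VecBound.sum _ fun l _ => VecBound.sub ?_ ?_
  · refine ((bound_R_D hh l).smul hh (VecBound.add (s := ε - 1) ?_ ?_)).mono hh hN (by linarith)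
    · exact ((hb l).bdd.bound.smul hh hWu).mono hh hN (by linarith)
    · exact ((R_comm_famM hh (hb l)).smul hh hWu).mono hh hN (by linarith)
  · exact ((bound_famR h).smul hh ((R_mul_fld hh fun k => ((hb l).pd l).mul (hw k)).smul hh
      hu)).mono hh hN (by linarith)

/-! ### Bracket estimates for vector fields -/

/-- The bracket step for vector fields. -/
theorem fld_bracket_bound (hh : SmallParam h) (hN : 0 ≤ N) {a w : Fin d → ι → Coef d}
    (ha : ∀ l, FCls 2 (a l)) (hw : ∀ m l, FCls m (w l)) {u : ι → SchwartzL2 d}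
    (hu : VecBound h N 0 u) (hau : VecBound h N 0 (fld a • u)) {ε : ℝ} (hε : ε ≤ 1)
    (hwu : VecBound h N (ε - 1) (famR (d := d) h • fld w • u)) :
    VecBound h N (ε / 2 - 1) (famR (d := d) h • fld (brk a w) • u) := by
  -- Each bracket lowers the class by one: [a, w] is in class 1 and [a, [a, w]] in class 0, the
  -- lowest that `R_mul_fld` accepts.
  have hB : ∀ l, FCls 1 (brk a w l) := FCls.brk ha (hw 2)
  refine bracket_bound hh hN (famR_resolvent h) (fld_fieldLike hh ha) (fld_fieldLike hh (hw 2))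
    (fld_comm_fld a w).symm (R_mul_fld hh fun l => (hB l).of_succ) ?_ ?_ hu hau hε hwu
    (RR_fld_fld_bound hh hN hB (hw 0) hε hu hwu)
  · rw [fld_comm_fld]
    exact R_mul_fld hh (FCls.brk (fun l => (ha l).of_succ) hB)
  · rw [fld_comm_fld]
    exact R_mul_fld hh (FCls.brk (hw 1) hB)

/-- The estimate for the drift field. -/
theorem fld_drift_bound (hh : SmallParam h) (hN : 0 ≤ N) {κ : Type*} [Fintype κ]
    {x : Fin d → ι → Coef d} {y : κ → Fin d → ι → Coef d}
    (hx : ∀ m l, FCls m (x l)) (hy : ∀ j l, FCls 2 (y j l)) {u F : ι → SchwartzL2 d}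
    (hu : VecBound h N 0 u) (hyu : ∀ j, VecBound h N 0 (fld (y j) • u)) (hFN : VecBound h N 0 F)
    (hF : ∀ v, ip (fld x • u) v = ip F v - ∑ j, ip (fld (y j) • u) (fld (y j) • v)) :
    VecBound h N (-1 / 2) (famR (d := d) h • fld x • u) := by
  refine drift_bound hh hN (famR_resolvent h) (fld_fieldLike hh (hx 2))
    (fun j => fld_fieldLike hh (hy j)) (fun j => ?_) hu hyu hFN hF
  exact (fld_bracketLike hh (fun l => (hy j l).of_succ) (hx 2)).R_mul

/-- The bracket step for the drift field. -/
theorem fld_drift_bracket_bound (hh : SmallParam h) (hN : 0 ≤ N) {κ : Type*} [Fintype κ]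
    {x w : Fin d → ι → Coef d} {y : κ → Fin d → ι → Coef d}
    (hx : ∀ m l, FCls m (x l)) (hw : ∀ m l, FCls m (w l)) (hy : ∀ j l, FCls 2 (y j l))
    {u F : ι → SchwartzL2 d}
    (hu : VecBound h N 0 u) (hyu : ∀ j, VecBound h N 0 (fld (y j) • u)) (hFN : VecBound h N 0 F)
    (hF : ∀ v, ip (fld x • u) v = ip F v - ∑ j, ip (fld (y j) • u) (fld (y j) • v))
    {δ : ℝ} (hδ0 : 0 ≤ δ) (hδ : δ ≤ 1 / 4)
    (hwu : VecBound h N (4 * δ - 1) (famR (d := d) h • fld w • u)) :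
    VecBound h N (δ - 1) (famR (d := d) h • fld (brk x w) • u) := by
  have hz : ∀ m l, FCls m (brk x w l) := fun m => FCls.brk (hx (m + 1)) (hw (m + 1))
  refine drift_bracket_bound hh hN (famR_resolvent h) (fld_fieldLike hh (hx 2))
    (fld_fieldLike hh (hw 2)) (fld_fieldLike hh (hz 2)) (fun j => fld_fieldLike hh (hy j))
    (fld_comm_fld x w).symm (fun j => fld_bracketLike hh (fun l => (hy j l).of_succ) (hw 2))
    (fun j => fld_bracketLike hh (fun l => (hy j l).of_succ) (hz 2))
    (fld_bracketLike hh (hx 1) (hw 2)) (fld_bracketLike hh (hx 1) (hz 2))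
    (fld_bracketLike hh (hz 1) (hw 2)).R_mul hu hyu hFN hF hδ0 hδ
    (fld_drift_bound hh hN hx hy hu hyu hFN hF) hwu fun j => ?_
  rw [fld_comm_fld]
  -- The gain 4δ of w is halved to 2δ for its bracket with y_j.
  have := fld_bracket_bound hh hN (hy j) hw hu (hyu j) (ε := 4 * δ) (by linarith) hwu
  convert this using 2
  ring

end

section

open scoped SchwartzMap LineDeriv
open SchwartzL2

variable {d : ℕ} {ι : Type*}

/-! ### Smooth vector fields -/

lemma SmoothCompact.coord {V : Space d → Space d} (hV : SmoothCompact V) (l : Fin d) :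
    SmoothCompact (fun x => V x l) := by
  refine ⟨contDiff_euclidean.1 hV.1 l, hV.2.mono fun x hx => ?_⟩
  simp only [Function.mem_support, ne_eq] at hx ⊢
  contrapose! hx
  simp [hx]

open Classical in
/-- The coefficients of a smooth compactly supported vector field. -/
noncomputable def coef (V : Space d → Space d) (l : Fin d) : Coef d :=
  if h : SmoothCompact V then (h.coord l).2.toSchwartzMap (h.coord l).1 else 0

lemma coef_apply {V : Space d → Space d} (hV : SmoothCompact V) (l : Fin d) (x : Space d) :
    coef V l x = V x l := by
  rw [coef, dif_pos hV]; rfl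

/-- The coefficients of a smooth vector field as a constant family. -/
noncomputable def vf (ι : Type*) (V : Space d → Space d) : Fin d → ι → Coef d :=
  fun l _ => coef V l

lemma vf_cls (V : Space d → Space d) (m : ℕ) (l : Fin d) : FCls m (vf ι V l) := FCls.const m _

lemma sum_basisVec (v : Space d) : v = ∑ l, v l • basisVec l := by
  ext k
  simp [basisVec, Finset.sum_apply, Pi.single_apply]

lemma clm_apply_eq_sum {F : Type*} [NormedAddCommGroup F] [NormedSpace ℝ F] (T : Space d →L[ℝ] F)
    (v : Space d) : T v = ∑ l, v l • T (basisVec l) := by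
  conv_lhs => rw [sum_basisVec v]
  simp

lemma opD_apply (l : Fin d) (φ : SchwartzL2 d) (x : Space d) :
    of.symm (opD l φ) x = fderiv ℝ (of.symm φ) x (basisVec l) :=
  SchwartzMap.lineDerivOp_apply_eq_fderiv _ _ _

lemma opM_apply (a : Coef d) (φ : SchwartzL2 d) (x : Space d) :
    of.symm (opM a φ) x = (a x : ℂ) * of.symm φ x :=
  opM_of_apply a (of.symm φ) x

lemma of_symm_add (φ ψ : SchwartzL2 d) (x : Space d) :
    of.symm (φ + ψ) x = of.symm φ x + of.symm ψ x := by
  rw [map_add, add_apply]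

lemma of_symm_sum {κ : Type*} (F : Finset κ) (φ : κ → SchwartzL2 d) (x : Space d) :
    of.symm (∑ j ∈ F, φ j) x = ∑ j ∈ F, of.symm (φ j) x := by
  rw [map_sum, _root_.sum_apply]

lemma fld_apply (a : Fin d → ι → Coef d) (i : ι) (φ : SchwartzL2 d) (x : Space d) :
    of.symm (fld a i φ) x = ∑ l, (a l i x : ℂ) * fderiv ℝ (of.symm φ) x (basisVec l) := by
  have : fld a i φ = ∑ l, opM (a l i) (opD l φ) := by
    simp only [fld, Finset.sum_apply, LinearMap.sum_apply]; rfl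
  rw [this, of_symm_sum]
  simp only [opM_apply, opD_apply]

lemma fld_vf_apply {V : Space d → Space d} (hV : SmoothCompact V) (i : ι) (φ : SchwartzL2 d) :
    (of.symm (fld (vf ι V) i φ) : Space d → ℂ) = applyField V (of.symm φ) := by
  funext x
  rw [fld_apply, applyField, clm_apply_eq_sum]
  simp only [vf, coef_apply hV, Complex.real_smul]

lemma SmoothCompact.lieBracket {V W : Space d → Space d} (hV : SmoothCompact V)
    (hW : SmoothCompact W) : SmoothCompact (VectorField.lieBracket ℝ V W) := by
  constructor
  · rw [contDiff_iff_contDiffAt]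
    intro x
    have h1 : ContDiff ℝ ∞ (fun x => fderiv ℝ W x (V x) - fderiv ℝ V x (W x)) := by
      have h2 : ContDiff ℝ ∞ (fderiv ℝ W) := hW.1.fderiv_right (by simp)
      have h3 : ContDiff ℝ ∞ (fderiv ℝ V) := hV.1.fderiv_right (by simp)
      exact (h2.clm_apply hV.1).sub (h3.clm_apply hW.1)
    exact h1.contDiffAt
  · refine HasCompactSupport.intro (hV.2.isCompact.union hW.2.isCompact) fun x hx => ?_
    simp only [Set.mem_union, not_or] at hx
    have h1 : V x = 0 := image_eq_zero_of_notMem_tsupport hx.1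
    have h2 : W x = 0 := image_eq_zero_of_notMem_tsupport hx.2
    simp [VectorField.lieBracket, h1, h2]

lemma along_apply (a : Fin d → ι → Coef d) (g : ι → Coef d) (i : ι) (x : Space d) :
    along a g i x = ∑ l, a l i x * fderiv ℝ (g i) x (basisVec l) := by
  simp only [along, Finset.sum_apply]
  rw [_root_.sum_apply]
  simp only [fmul, coefMul_apply, pd, SchwartzMap.lineDerivOp_apply_eq_fderiv]

/-- The convention of `VectorField.lieBracket` is DW·V - DV·W, which agrees with VW - WV as
operators. -/
lemma vf_lieBracket {V W : Space d → Space d} (hV : SmoothCompact V) (hW : SmoothCompact W) :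
    vf ι (VectorField.lieBracket ℝ V W) = brk (vf ι V) (vf ι W) := by
  funext l i
  ext x
  have key : ∀ {V W : Space d → Space d}, SmoothCompact V → SmoothCompact W →
      along (vf ι V) (vf ι W l) i x = (fderiv ℝ W x (V x)) l := fun {V W} hV hW => by
    rw [along_apply]
    have h1 : ((vf ι W l i : Coef d) : Space d → ℝ)
        = fun y => (EuclideanSpace.proj l : Space d →L[ℝ] ℝ) (W y) := by
      funext y; exact coef_apply hW l y
    have h2 : HasFDerivAt (fun y => (EuclideanSpace.proj l : Space d →L[ℝ] ℝ) (W y)) _ x :=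
      (EuclideanSpace.proj l : Space d →L[ℝ] ℝ).hasFDerivAt.comp x
        ((hW.1.differentiable (by simp)) x).hasFDerivAt
    rw [h1, h2.fderiv, clm_apply_eq_sum (fderiv ℝ W x) (V x)]
    simp [vf, coef_apply hV]
  have h3 : brk (vf ι V) (vf ι W) l i x
      = along (vf ι V) (vf ι W l) i x - along (vf ι W) (vf ι V l) i x := by
    simp only [brk, Pi.sub_apply]; rw [sub_apply]
  rw [h3, key hV hW, key hW hV]
  simp only [vf]
  rw [coef_apply (hV.lieBracket hW)]
  simp [VectorField.lieBracket]

lemma SmoothCompact.add {V W : Space d → Space d} (hV : SmoothCompact V)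
    (hW : SmoothCompact W) : SmoothCompact (V + W) := ⟨hV.1.add hW.1, hV.2.add hW.2⟩

lemma SmoothCompact.smul {V : Space d → Space d} (hV : SmoothCompact V) (c : ℝ) :
    SmoothCompact (c • V) := ⟨contDiff_const.smul hV.1, by
      have := hV.2.smul_left (f := fun _ : Space d => c); exact this⟩

lemma SmoothCompact.zero : SmoothCompact (0 : Space d → Space d) :=
  ⟨contDiff_const, HasCompactSupport.zero⟩

lemma fld_vf_add {V W : Space d → Space d} (hV : SmoothCompact V) (hW : SmoothCompact W) :
    fld (vf ι (V + W)) = fld (vf ι V) + fld (vf ι W) := by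
  funext i
  refine LinearMap.ext fun φ => of.symm.injective (SchwartzMap.ext fun x => ?_)
  rw [Pi.add_apply, LinearMap.add_apply, of_symm_add, fld_vf_apply (hV.add hW), fld_vf_apply hV,
    fld_vf_apply hW]
  simp [applyField]

lemma fld_vf_smul {V : Space d → Space d} (hV : SmoothCompact V) (c : ℝ) :
    fld (vf ι (c • V)) = fun i => (c : ℂ) • fld (vf ι V) i := by
  funext i
  refine LinearMap.ext fun φ => of.symm.injective (SchwartzMap.ext fun x => ?_)
  rw [LinearMap.smul_apply, map_smul, smul_apply, fld_vf_apply (hV.smul c), fld_vf_apply hV]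
  simp [applyField]

end

section

open scoped SchwartzMap LineDeriv
open SchwartzL2

variable {d : ℕ}

/-! ### Sobolev norms from resolvent estimates -/

lemma eLpNorm_two_sq (u : Space d → ℂ) : eLpNorm u 2 volume ^ 2 = ∫⁻ x, ‖u x‖ₑ ^ 2 := by
  rw [eLpNorm_eq_lintegral_rpow_enorm_toReal (by norm_num) (by norm_num), ← ENNReal.rpow_natCast,
    ← ENNReal.rpow_mul]
  norm_num

lemma lintegral_enorm_sq (φ : 𝓢(Space d, ℂ)) :
    ∫⁻ x, ‖φ x‖ₑ ^ 2 = ENNReal.ofReal (‖of φ‖ ^ 2) := by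
  rw [← eLpNorm_two_sq, ← enorm_of, ENNReal.ofReal_pow (norm_nonneg _)]

/-- Choose n with 4ⁿ ≤ 1 + 4π²|ξ|² < 4ⁿ⁺¹. At h = 2⁻ⁿ the symbol of R is then at least 1/5, whence
the constant 25 = 5². -/
lemma rpow_le_dyadic {p : ℝ} (hp : 0 ≤ p) (ξ : Space d) :
    ∃ n : ℕ, (1 + 4 * Real.pi ^ 2 * ‖ξ‖ ^ 2) ^ (-p)
      ≤ 25 * ((4 : ℝ) ^ n) ^ (-p) * resSymbol ((1 / 2) ^ n) ξ ^ 2 := by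
  have h1 : 1 ≤ 1 + 4 * Real.pi ^ 2 * ‖ξ‖ ^ 2 := by
    have : 0 ≤ 4 * Real.pi ^ 2 * ‖ξ‖ ^ 2 := by positivity
    linarith
  obtain ⟨n, hn, hn'⟩ := exists_nat_pow_near h1 (by norm_num : (1 : ℝ) < 4)
  refine ⟨n, ?_⟩
  have h2 : (1 / 5 : ℝ) ≤ resSymbol ((1 / 2) ^ n) ξ := by
    rw [resSymbol_eq, one_div]
    refine inv_anti₀ (by positivity) ?_
    have h3 : (2 * Real.pi * (1 / 2) ^ n) ^ 2 * ‖ξ‖ ^ 2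
        = (4 * Real.pi ^ 2 * ‖ξ‖ ^ 2) / 4 ^ n := by
      have h5 : ((1 / 2 : ℝ) ^ n) ^ 2 = 1 / 4 ^ n := by
        rw [← pow_mul, mul_comm, pow_mul]; norm_num; rw [one_div, inv_pow]
      rw [mul_pow, h5]; ring
    have h4 : (4 * Real.pi ^ 2 * ‖ξ‖ ^ 2) / 4 ^ n ≤ 4 := by
      rw [div_le_iff₀ (by positivity)]
      rw [pow_succ (4 : ℝ) n] at hn'
      linarith
    rw [h3]; linarith
  calc (1 + 4 * Real.pi ^ 2 * ‖ξ‖ ^ 2) ^ (-p) ≤ ((4 : ℝ) ^ n) ^ (-p) :=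
        Real.rpow_le_rpow_of_nonpos (by positivity) hn (by linarith)
    _ = 25 * ((4 : ℝ) ^ n) ^ (-p) * (1 / 5) ^ 2 := by ring
    _ ≤ _ := by gcongr

/-- Uniform resolvent estimates imply a Sobolev estimate with an arbitrarily small loss. -/
theorem normSobolev_le_of_opR {ε γ : ℝ} (hε : ε ≤ 1) (hγ : 0 < γ) :
    ∃ c : ℝ, 0 < c ∧ ∀ (w : SchwartzL2 d) (B : ℝ), 0 ≤ B →
      (∀ h : ℝ, 0 < h → h ≤ 1 → ‖opR h w‖ ≤ B * h ^ (ε - 1)) →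
      normSobolev (ε - 1 - γ) (of.symm w) ≤ ENNReal.ofReal (c * B) := by
  -- Ratio of the dyadic series: the weight 4^(-np) and the squared bound (2⁻ⁿ)^(2(ε-1)) multiply to
  -- 4^(-nγ). The loss γ > 0 is what makes the series converge.
  set q : ℝ := 4 ^ (-γ) with hq
  have hq0 : 0 < q := by positivity
  have hq1 : q < 1 := Real.rpow_lt_one_of_one_lt_of_neg (by norm_num) (by linarith)
  refine ⟨√(25 * (1 - q)⁻¹), Real.sqrt_pos.2 (mul_pos (by norm_num) (inv_pos.2 (by linarith))),
    fun w B hB H => ?_⟩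
  set p : ℝ := 1 - ε + γ with hp
  have hpe : ε - 1 - γ = -p := by rw [hp]; ring
  have hkey : ∫⁻ ξ : Space d, ‖𝓕 (of.symm w : Space d → ℂ) ξ‖ₑ ^ 2 *
      ENNReal.ofReal ((1 + 4 * Real.pi ^ 2 * ‖ξ‖ ^ 2) ^ (ε - 1 - γ))
      ≤ ENNReal.ofReal (25 * (1 - q)⁻¹ * B ^ 2) := by
    calc ∫⁻ ξ : Space d, ‖𝓕 (of.symm w : Space d → ℂ) ξ‖ₑ ^ 2 *
          ENNReal.ofReal ((1 + 4 * Real.pi ^ 2 * ‖ξ‖ ^ 2) ^ (ε - 1 - γ))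
        ≤ ∫⁻ ξ : Space d, ∑' n : ℕ, ENNReal.ofReal (25 * ((4 : ℝ) ^ n) ^ (-p))
            * ‖hat (opR ((1 / 2) ^ n) w) ξ‖ₑ ^ 2 := by
          refine lintegral_mono fun ξ => ?_
          obtain ⟨n, hn⟩ := rpow_le_dyadic (d := d) (p := p) (by linarith) ξ
          -- For each ξ a single dyadic scale already dominates the weight; the sum over all scales
          -- removes the dependence of n on ξ.
          refine le_trans ?_ (ENNReal.le_tsum n)
          have h1 : ‖hat (opR ((1 / 2) ^ n) w) ξ‖ₑ ^ 2
              = ENNReal.ofReal (resSymbol ((1 / 2) ^ n) ξ ^ 2) * ‖𝓕 (of.symm w : Space d → ℂ) ξ‖ₑ ^ 2 := by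
            rw [hat_opR, enorm_mul, mul_pow, ← ofReal_norm (Complex.ofReal _), Complex.norm_real,
              ← ENNReal.ofReal_pow (norm_nonneg _), Real.norm_eq_abs, sq_abs]
            rfl
          rw [h1, ← mul_assoc, ← ENNReal.ofReal_mul (by positivity), mul_comm, hpe]
          gcongr
      _ = ∑' n : ℕ, ENNReal.ofReal (25 * ((4 : ℝ) ^ n) ^ (-p) * ‖opR ((1 / 2) ^ n) w‖ ^ 2) := by
          rw [lintegral_tsum]
          · refine tsum_congr fun n => ?_
            rw [lintegral_const_mul' _ _ ENNReal.ofReal_ne_top, lintegral_enorm_sq, norm_hat,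
              ← ENNReal.ofReal_mul (by positivity)]
          · intro n
            exact (((hat (opR ((1 / 2) ^ n) w)).continuous.measurable.enorm.pow_const 2).const_mul
              _).aemeasurable
      _ ≤ ∑' n : ℕ, ENNReal.ofReal (25 * B ^ 2 * q ^ n) := by
          refine ENNReal.tsum_le_tsum fun n => ENNReal.ofReal_le_ofReal ?_
          have h1 := H ((1 / 2) ^ n) (by positivity) (pow_le_one₀ (by norm_num) (by norm_num))
          have h2 : ((4 : ℝ) ^ n) ^ (-p) * (((1 / 2 : ℝ) ^ n) ^ (ε - 1)) ^ 2 = q ^ n := by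
            have e1 : ((1 / 2 : ℝ) ^ n) = 2 ^ (-(n : ℝ)) := by
              rw [Real.rpow_neg (by norm_num), Real.rpow_natCast]; simp
            have e2 : (4 : ℝ) = 2 ^ (2 : ℝ) := by norm_num
            rw [hq, e1, e2, ← Real.rpow_natCast, ← Real.rpow_natCast, ← Real.rpow_natCast,
              ← Real.rpow_mul (by norm_num), ← Real.rpow_mul (by norm_num),
              ← Real.rpow_mul (by norm_num), ← Real.rpow_mul (by norm_num),
              ← Real.rpow_mul (by norm_num), ← Real.rpow_mul (by norm_num),
              ← Real.rpow_add (by norm_num)]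
            congr 1
            rw [hp]; push_cast; ring
          calc 25 * ((4 : ℝ) ^ n) ^ (-p) * ‖opR ((1 / 2) ^ n) w‖ ^ 2
              ≤ 25 * ((4 : ℝ) ^ n) ^ (-p) * (B * ((1 / 2) ^ n) ^ (ε - 1)) ^ 2 := by gcongr
            _ = 25 * B ^ 2 * (((4 : ℝ) ^ n) ^ (-p) * (((1 / 2 : ℝ) ^ n) ^ (ε - 1)) ^ 2) := by ring
            _ ≤ _ := by rw [h2]
      _ = ENNReal.ofReal (25 * (1 - q)⁻¹ * B ^ 2) := by
          rw [← ENNReal.ofReal_tsum_of_nonneg (fun n => by positivity)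
            ((summable_geometric_of_lt_one hq0.le hq1).mul_left _), tsum_mul_left,
            tsum_geometric_of_lt_one hq0.le hq1]
          congr 1; ring
  rw [normSobolev]
  calc (∫⁻ ξ : Space d, ‖𝓕 (of.symm w : Space d → ℂ) ξ‖ₑ ^ 2 *
      ENNReal.ofReal ((1 + 4 * Real.pi ^ 2 * ‖ξ‖ ^ 2) ^ (ε - 1 - γ))) ^ (1 / 2 : ℝ)
      ≤ (ENNReal.ofReal (25 * (1 - q)⁻¹ * B ^ 2)) ^ (1 / 2 : ℝ) := by gcongr
    _ = _ := by
      have : 0 ≤ (1 - q)⁻¹ := inv_nonneg.2 (by linarith)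
      rw [ENNReal.ofReal_rpow_of_nonneg (by positivity) (by norm_num), ← Real.sqrt_eq_rpow,
        Real.sqrt_mul (by positivity), Real.sqrt_sq hB]

end

section

open scoped SchwartzMap LineDeriv ComplexConjugate
open SchwartzL2

variable {d : ℕ}

/-! ### The energy estimate -/

lemma integrable_norm_sq {u : Space d → ℂ} (hu : MemLp u 2 volume) :
    Integrable fun x => ‖u x‖ ^ 2 := hu.integrable_norm_pow two_ne_zero

lemma ofReal_integral_norm_sq {u : Space d → ℂ} (hu : MemLp u 2 volume) :
    ENNReal.ofReal (∫ x, ‖u x‖ ^ 2) = normL2 u ^ 2 := by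
  rw [normL2, eLpNorm_two_sq, ofReal_integral_eq_lintegral_ofReal (integrable_norm_sq hu)
    (Filter.Eventually.of_forall fun x => by positivity)]
  refine lintegral_congr fun x => ?_
  rw [ENNReal.ofReal_pow (norm_nonneg _), ofReal_norm]

lemma contDiff_applyField {n : WithTop ℕ∞} {Y : Space d → Space d} {u : Space d → ℂ}
    (hY : ContDiff ℝ n Y) (hu : ContDiff ℝ (n + 1) u) : ContDiff ℝ n (applyField Y u) :=
  (hu.fderiv_right le_rfl).clm_apply hY

lemma hasCompactSupport_applyField {Y : Space d → Space d} (u : Space d → ℂ)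
    (hY : HasCompactSupport Y) : HasCompactSupport (applyField Y u) :=
  hY.mono fun x hx => by
    simp only [Function.mem_support, ne_eq] at hx ⊢
    contrapose! hx
    simp [applyField, hx]

lemma hasCompactSupport_coord {Y : Space d → Space d} (hY : HasCompactSupport Y) (l : Fin d) :
    HasCompactSupport fun x => ((Y x l : ℝ) : ℂ) :=
  hY.mono fun x hx => by
    simp only [Function.mem_support, ne_eq] at hx ⊢
    contrapose! hx
    simp [hx]

lemma contDiff_coord {n : WithTop ℕ∞} {Y : Space d → Space d} (hY : ContDiff ℝ n Y) (l : Fin d) :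
    ContDiff ℝ n fun x => ((Y x l : ℝ) : ℂ) :=
  Complex.ofRealCLM.contDiff.comp (contDiff_euclidean.1 hY l)

lemma continuous_applyAdjoint {Y : Space d → Space d} {w : Space d → ℂ} (hY : ContDiff ℝ 1 Y)
    (hw : ContDiff ℝ 1 w) : Continuous (applyAdjoint Y w) := by
  unfold applyAdjoint
  refine (continuous_finsetSum _ fun l _ => ?_).neg
  exact (((contDiff_coord hY l).mul hw).continuous_fderiv (by norm_num)).clm_apply continuous_const

lemma hasCompactSupport_applyAdjoint {Y : Space d → Space d} (w : Space d → ℂ)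
    (hY : HasCompactSupport Y) : HasCompactSupport (applyAdjoint Y w) := by
  refine HasCompactSupport.intro hY.isCompact fun x hx => ?_
  have h : ∀ l : Fin d, fderiv ℝ (fun y => ((Y y l : ℝ) : ℂ) * w y) x = 0 := fun l => by
    have h1 : (fun y => ((Y y l : ℝ) : ℂ) * w y) =ᶠ[nhds x] fun _ => 0 := by
      filter_upwards [(isClosed_tsupport Y).isOpen_compl.mem_nhds hx] with y hy
      simp [image_eq_zero_of_notMem_tsupport hy]
    rw [h1.fderiv_eq]; simp
  simp [applyAdjoint, h]

/-- Integration by parts in each coordinate; the compact support of Y alone makes every integrand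
integrable. C¹ regularity suffices, so it applies to w = Y_j u with C¹ coefficients. -/
lemma integral_conj_mul_applyAdjoint {Y : Space d → Space d} {v w : Space d → ℂ}
    (hY : ContDiff ℝ 1 Y) (hYs : HasCompactSupport Y) (hv : ContDiff ℝ 1 v)
    (hw : ContDiff ℝ 1 w) :
    ∫ x, conj (v x) * applyAdjoint Y w x = ∫ x, conj (applyField Y v x) * w x := by
  have hcv : ContDiff ℝ 1 fun x => conj (v x) := Complex.conjCLE.contDiff.comp hv
  have hdv : ∀ x e, fderiv ℝ (fun x => conj (v x)) x e = conj (fderiv ℝ v x e) := fun x e => by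
    have h := (Complex.conjCLE.toContinuousLinearMap.hasFDerivAt (x := v x)).comp x
      ((hv.differentiable (by norm_num)) x).hasFDerivAt
    have h' : HasFDerivAt (fun x => conj (v x)) _ x := h
    rw [h'.fderiv]; rfl
  have hint : ∀ l : Fin d, Integrable fun x =>
      conj (v x) * fderiv ℝ (fun y => ((Y y l : ℝ) : ℂ) * w y) x (basisVec l) := fun l => by
    refine Continuous.integrable_of_hasCompactSupport ?_ ?_
    · exact hcv.continuous.mul ((((contDiff_coord hY l).mul hw).continuous_fderiv
        (by norm_num)).clm_apply continuous_const)
    · have := ((hasCompactSupport_coord hYs l).mul_right (f' := w)).fderiv_apply (𝕜 := ℝ) (basisVec l)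
      exact this.mul_left
  have hint' : ∀ l : Fin d, Integrable fun x =>
      fderiv ℝ (fun x => conj (v x)) x (basisVec l) * (((Y x l : ℝ) : ℂ) * w x) := fun l => by
    refine Continuous.integrable_of_hasCompactSupport ?_ ?_
    · exact ((hcv.continuous_fderiv (by norm_num)).clm_apply continuous_const).mul
        ((contDiff_coord hY l).continuous.mul hw.continuous)
    · exact ((hasCompactSupport_coord hYs l).mul_right (f' := w)).mul_left
  have hint'' : ∀ l : Fin d, Integrable fun x =>
      conj (v x) * (((Y x l : ℝ) : ℂ) * w x) := fun l => by
    refine Continuous.integrable_of_hasCompactSupport ?_ ?_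
    · exact hcv.continuous.mul ((contDiff_coord hY l).continuous.mul hw.continuous)
    · exact ((hasCompactSupport_coord hYs l).mul_right (f' := w)).mul_left
  calc ∫ x, conj (v x) * applyAdjoint Y w x
      = -∑ l, ∫ x, conj (v x) * fderiv ℝ (fun y => ((Y y l : ℝ) : ℂ) * w y) x (basisVec l) := by
        rw [← integral_finsetSum _ fun l _ => hint l, ← integral_neg]
        refine integral_congr_ae (Filter.Eventually.of_forall fun x => ?_)
        simp only [applyAdjoint, mul_neg, Finset.mul_sum]
    _ = ∑ l, ∫ x, fderiv ℝ (fun x => conj (v x)) x (basisVec l) * (((Y x l : ℝ) : ℂ) * w x) := by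
        rw [← Finset.sum_neg_distrib]
        refine Finset.sum_congr rfl fun l _ => ?_
        rw [integral_mul_fderiv_eq_neg_fderiv_mul_of_integrable (hint' l) (hint l) (hint'' l)
          (fun x _ => hcv.differentiable (by norm_num) x)
          (fun x _ => ((contDiff_coord hY l).mul hw).differentiable (by norm_num) x), neg_neg]
    _ = _ := by
        rw [← integral_finsetSum _ fun l _ => hint' l]
        refine integral_congr_ae (Filter.Eventually.of_forall fun x => ?_)
        simp only [hdv, applyField, clm_apply_eq_sum (fderiv ℝ v x) (Y x), map_sum, Finset.sum_mul]
        refine Finset.sum_congr rfl fun l _ => ?_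
        simp only [Complex.real_smul, map_mul, Complex.conj_ofReal]
        ring

/-- The divergence of a vector field. -/
noncomputable def divField (Y : Space d → Space d) (x : Space d) : ℝ :=
  ∑ l : Fin d, fderiv ℝ (fun y => Y y l) x (basisVec l)

lemma continuous_divField {Y : Space d → Space d} (hY : ContDiff ℝ 1 Y) :
    Continuous (divField Y) :=
  continuous_finsetSum _ fun l _ => ((contDiff_euclidean.1 hY l).continuous_fderiv
    (by norm_num)).clm_apply continuous_const

lemma hasCompactSupport_divField {Y : Space d → Space d} (hY : HasCompactSupport Y) :
    HasCompactSupport (divField Y) := by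
  refine HasCompactSupport.intro hY.isCompact fun x hx => ?_
  have h : ∀ l : Fin d, fderiv ℝ (fun y => Y y l) x = 0 := fun l => by
    have h1 : (fun y => Y y l) =ᶠ[nhds x] fun _ => 0 := by
      filter_upwards [(isClosed_tsupport Y).isOpen_compl.mem_nhds hx] with y hy
      simp [image_eq_zero_of_notMem_tsupport hy]
    rw [h1.fderiv_eq]; simp
  simp [divField, h]

lemma applyAdjoint_eq {Y : Space d → Space d} {w : Space d → ℂ} {x : Space d}
    (hY : DifferentiableAt ℝ Y x) (hw : DifferentiableAt ℝ w x) :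
    applyAdjoint Y w x = -applyField Y w x - divField Y x * w x := by
  have h : ∀ l : Fin d, fderiv ℝ (fun y => ((Y y l : ℝ) : ℂ) * w y) x (basisVec l)
      = (Y x l : ℂ) * fderiv ℝ w x (basisVec l)
        + ((fderiv ℝ (fun y => Y y l) x (basisVec l) : ℝ) : ℂ) * w x := fun l => by
    have h0 : HasFDerivAt (fun y => Y y l) _ x :=
      ((EuclideanSpace.proj l : Space d →L[ℝ] ℝ).hasFDerivAt.comp x hY.hasFDerivAt)
    have h1 : HasFDerivAt (fun y => ((Y y l : ℝ) : ℂ)) _ x :=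
      Complex.ofRealCLM.hasFDerivAt.comp x h0
    have h2 : HasFDerivAt (fun y => ((Y y l : ℝ) : ℂ) * w y) _ x := h1.mul hw.hasFDerivAt
    rw [h2.fderiv, h0.fderiv]
    simp [mul_comm]
  simp only [applyAdjoint, h, Finset.sum_add_distrib, applyField, divField,
    clm_apply_eq_sum (fderiv ℝ w x) (Y x), Complex.real_smul, Complex.ofReal_sum, Finset.sum_mul]
  ring

/-- Y + Y* is multiplication by -div Y. This gives the real part of the drift term in the energy
estimate and, for a radial field, Hardy's inequality. -/
lemma two_re_integral_conj_mul_applyField {Y : Space d → Space d} {u : Space d → ℂ}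
    (hY : ContDiff ℝ 1 Y) (hYs : HasCompactSupport Y) (hu : ContDiff ℝ 1 u) :
    2 * (∫ x, conj (u x) * applyField Y u x).re = -∫ x, divField Y x * ‖u x‖ ^ 2 := by
  have h1 := integral_conj_mul_applyAdjoint hY hYs hu hu
  have hYu : Continuous (applyField Y u) :=
    (contDiff_applyField (n := 0) (hY.of_le (by norm_num)) (by simpa using hu)).continuous
  have i1 : Integrable fun x => conj (u x) * applyField Y u x :=
    Continuous.integrable_of_hasCompactSupport
      ((Complex.continuous_conj.comp hu.continuous).mul hYu)
      (hasCompactSupport_applyField u hYs).mul_left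
  have i2 : Integrable fun x => divField Y x * ‖u x‖ ^ 2 :=
    Continuous.integrable_of_hasCompactSupport
      ((continuous_divField hY).mul (hu.continuous.norm.pow 2))
      (hasCompactSupport_divField hYs).mul_right
  have h2 : ∫ x, conj (u x) * applyAdjoint Y u x
      = -(∫ x, conj (u x) * applyField Y u x) - ((∫ x, divField Y x * ‖u x‖ ^ 2 : ℝ) : ℂ) := by
    rw [← integral_complex_ofReal, ← integral_neg]
    refine Eq.trans ?_ (integral_sub i1.neg i2.ofReal)
    refine integral_congr_ae (Filter.Eventually.of_forall fun x => ?_)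
    simp only
    rw [applyAdjoint_eq (hY.differentiable (by norm_num) x) (hu.differentiable (by norm_num) x)]
    have : conj (u x) * u x = ((‖u x‖ ^ 2 : ℝ) : ℂ) := by
      rw [mul_comm, Complex.mul_conj, Complex.normSq_eq_norm_sq]
    push_cast at this ⊢
    rw [← this]
    ring
  have h3 : ∫ x, conj (applyField Y u x) * u x = conj (∫ x, conj (u x) * applyField Y u x) := by
    rw [← integral_conj]
    refine integral_congr_ae (Filter.Eventually.of_forall fun x => ?_)
    simp [mul_comm]
  rw [h2, h3] at h1
  have h4 := congrArg Complex.re h1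
  simp only [Complex.sub_re, Complex.neg_re, Complex.ofReal_re, Complex.conj_re] at h4
  linarith

lemma BoundedMeasurableCompact.mul_memLp {f : Space d → ℝ} (hf : BoundedMeasurableCompact f)
    {u : Space d → ℂ} (hu : Continuous u) : MemLp (fun x => (f x : ℂ) * u x) 2 volume := by
  obtain ⟨h1, ⟨M, hM⟩, h3⟩ := hf
  obtain ⟨K, hK⟩ := h3.isCompact.exists_bound_of_continuousOn hu.continuousOn
  have hs : HasCompactSupport fun x => (f x : ℂ) * u x := h3.mono fun x hx => by
    simp only [Function.mem_support, ne_eq] at hx ⊢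
    contrapose! hx
    simp [hx]
  refine hs.memLp_of_bound (((Complex.measurable_ofReal.comp h1).mul
    hu.measurable).aestronglyMeasurable) (M * |K|) (Filter.Eventually.of_forall fun x => ?_)
  have hM0 : 0 ≤ M := (norm_nonneg _).trans (hM x)
  by_cases hx : x ∈ tsupport f
  · rw [norm_mul, Complex.norm_real]
    exact mul_le_mul (hM x) ((hK x hx).trans (le_abs_self K)) (norm_nonneg _) hM0
  · have : f x = 0 := image_eq_zero_of_notMem_tsupport hx
    simp only [this, Complex.ofReal_zero, zero_mul, norm_zero]
    positivity

lemma applyField_memLp {Y : Space d → Space d} (hY : BoundedMeasurableCompact Y) {u : Space d → ℂ}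
    (hu : ContDiff ℝ 1 u) : MemLp (applyField Y u) 2 volume := by
  have h : applyField Y u = fun x => ∑ l, ((Y x l : ℝ) : ℂ) * fderiv ℝ u x (basisVec l) := by
    funext x
    simp only [applyField, clm_apply_eq_sum (fderiv ℝ u x) (Y x), Complex.real_smul]
  rw [h]
  refine memLp_finsetSum _ fun l _ => BoundedMeasurableCompact.mul_memLp (f := fun x => Y x l)
    ⟨?_, ?_, ?_⟩ ((hu.continuous_fderiv (by norm_num)).clm_apply continuous_const)
  · exact (EuclideanSpace.proj l : Space d →L[ℝ] ℝ).continuous.measurable.comp hY.1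
  · obtain ⟨M, hM⟩ := hY.2.1
    exact ⟨M, fun x => (PiLp.norm_apply_le (Y x) l).trans (hM x)⟩
  · exact hY.2.2.mono fun x hx => by
      simp only [Function.mem_support, ne_eq] at hx ⊢
      contrapose! hx
      simp [hx]

lemma BoundedMeasurableCompact.of_continuous {Y : Space d → Space d} (hY : Continuous Y)
    (hs : HasCompactSupport Y) : BoundedMeasurableCompact Y :=
  ⟨hY.measurable, hs.exists_bound_of_continuous hY, hs⟩

variable {r : ℕ} {f : Space d → ℝ} {X₀ : Space d → Space d} {Y : Fin r → Space d → Space d}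

lemma adjoint_applyField_memLp (hA : AssumptionA1 f X₀ Y) {u : Space d → ℂ} (hu : ContDiff ℝ ∞ u)
    (j : Fin r) : MemLp (applyAdjoint (Y j) (applyField (Y j) u)) 2 volume := by
  obtain ⟨h1, h2⟩ := hA.2.2 j
  exact (continuous_applyAdjoint h1 (contDiff_applyField h1
    (hu.of_le (by norm_cast)))).memLp_of_hasCompactSupport
    (hasCompactSupport_applyAdjoint _ h2)

lemma opL_memLp (hA : AssumptionA1 f X₀ Y) {u : Space d → ℂ} (hu : ContDiff ℝ ∞ u) :
    MemLp (opL f X₀ Y u) 2 volume :=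
  ((hA.1.mul_memLp hu.continuous).add (applyField_memLp
    (.of_continuous hA.2.1.1.continuous hA.2.1.2) (hu.of_le (by norm_cast)))).add
    (memLp_finsetSum _ fun j _ => adjoint_applyField_memLp hA hu j)

lemma norm_integral_conj_mul_le {u g : Space d → ℂ} (hu : MemLp u 2 volume)
    (hg : MemLp g 2 volume) :
    ‖∫ x, conj (u x) * g x‖ ≤ (∫ x, ‖u x‖ ^ 2) + ∫ x, ‖g x‖ ^ 2 := by
  rw [← integral_add (integrable_norm_sq hu) (integrable_norm_sq hg)]
  refine norm_integral_le_of_norm_le ((integrable_norm_sq hu).add (integrable_norm_sq hg))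
    (Filter.Eventually.of_forall fun x => ?_)
  simp only [norm_mul, RCLike.norm_conj]
  nlinarith [sq_nonneg (‖u x‖ - ‖g x‖), norm_nonneg (u x), norm_nonneg (g x)]

lemma integrable_conj_mul {u g : Space d → ℂ} (hu : MemLp u 2 volume)
    (hg : MemLp g 2 volume) : Integrable fun x => conj (u x) * g x := by
  have h : MemLp (fun x => conj (u x)) 2 volume := hu.star
  exact hg.integrable_mul h |>.congr (Filter.Eventually.of_forall fun x => by simp [mul_comm])

/-- Real part of ⟨u, ℒu⟩: the squares give ∑ ‖Y_j u‖², the drift leaves only half its divergence,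
and f is bounded. -/
lemma energy_integral_le (hA : AssumptionA1 f X₀ Y) :
    ∃ C : ℝ, 0 < C ∧ ∀ u : Space d → ℂ, SmoothCompact u →
      ∑ j, ∫ x, ‖applyField (Y j) u x‖ ^ 2
        ≤ C * ((∫ x, ‖opL f X₀ Y u x‖ ^ 2) + ∫ x, ‖u x‖ ^ 2) := by
  obtain ⟨M, hM⟩ := hA.1.2.1
  obtain ⟨K, hK⟩ := (hasCompactSupport_divField hA.2.1.2).exists_bound_of_continuous
    (continuous_divField hA.2.1.1)
  have hM0 : 0 ≤ M := (norm_nonneg _).trans (hM 0)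
  have hK0 : 0 ≤ K := (norm_nonneg _).trans (hK 0)
  refine ⟨1 + M + K, by positivity, fun u hu => ?_⟩
  have hu1 : ContDiff ℝ 1 u := hu.1.of_le (by norm_cast)
  have mu : MemLp u 2 volume := hu.1.continuous.memLp_of_hasCompactSupport hu.2
  have mL := opL_memLp hA hu.1
  have mX : MemLp (applyField X₀ u) 2 volume :=
    applyField_memLp (.of_continuous hA.2.1.1.continuous hA.2.1.2) hu1
  have mf := hA.1.mul_memLp hu.1.continuous
  set U : ℝ := ∫ x, ‖u x‖ ^ 2 with hU
  have hU0 : 0 ≤ U := integral_nonneg fun x => by positivity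
  have hadj : ∀ j, ((∫ x, ‖applyField (Y j) u x‖ ^ 2 : ℝ) : ℂ)
      = ∫ x, conj (u x) * applyAdjoint (Y j) (applyField (Y j) u) x := fun j => by
    have h1 := (hA.2.2 j).1
    rw [integral_conj_mul_applyAdjoint h1 (hA.2.2 j).2 hu1 (contDiff_applyField h1
      (hu.1.of_le (by norm_cast))), ← integral_complex_ofReal]
    refine integral_congr_ae (Filter.Eventually.of_forall fun x => ?_)
    simp only
    rw [mul_comm, Complex.mul_conj, Complex.normSq_eq_norm_sq]
  have hsplit : ∫ x, conj (u x) * opL f X₀ Y u x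
      = ((∫ x, f x * ‖u x‖ ^ 2 : ℝ) : ℂ) + (∫ x, conj (u x) * applyField X₀ u x)
        + ∑ j, ((∫ x, ‖applyField (Y j) u x‖ ^ 2 : ℝ) : ℂ) := by
    simp only [hadj]
    have if' : Integrable fun x => conj (u x) * ((f x : ℂ) * u x) := integrable_conj_mul mu mf
    have iX : Integrable fun x => conj (u x) * applyField X₀ u x := integrable_conj_mul mu mX
    have iY : ∀ j, Integrable fun x => conj (u x) * applyAdjoint (Y j) (applyField (Y j) u) x :=
      fun j => integrable_conj_mul mu (adjoint_applyField_memLp hA hu.1 j)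
    have e1 : ((∫ x, f x * ‖u x‖ ^ 2 : ℝ) : ℂ) = ∫ x, conj (u x) * ((f x : ℂ) * u x) := by
      rw [← integral_complex_ofReal]
      refine integral_congr_ae (Filter.Eventually.of_forall fun x => ?_)
      have : conj (u x) * u x = ((‖u x‖ ^ 2 : ℝ) : ℂ) := by
        rw [mul_comm, Complex.mul_conj, Complex.normSq_eq_norm_sq]
      push_cast at this ⊢
      rw [← this]; ring
    rw [e1, ← integral_finsetSum _ fun j _ => iY j, ← integral_add if' iX]
    refine Eq.trans ?_ (integral_add (if'.add iX) (integrable_finsetSum _ fun j _ => iY j))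
    refine integral_congr_ae (Filter.Eventually.of_forall fun x => ?_)
    simp only [opL, Finset.mul_sum, mul_add]
  have hre := congrArg Complex.re hsplit
  simp only [Complex.add_re, Complex.ofReal_re, Complex.re_sum] at hre
  have hX := two_re_integral_conj_mul_applyField hA.2.1.1 hA.2.1.2 hu1
  have b1 : |(∫ x, conj (u x) * opL f X₀ Y u x).re| ≤ U + ∫ x, ‖opL f X₀ Y u x‖ ^ 2 :=
    (Complex.abs_re_le_norm _).trans (norm_integral_conj_mul_le mu mL)
  have hb : ∀ (g : Space d → ℝ) (c : ℝ), (∀ x, ‖g x‖ ≤ c) → |∫ x, g x * ‖u x‖ ^ 2| ≤ c * U := by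
    intro g c hg
    rw [hU, ← integral_const_mul, ← Real.norm_eq_abs]
    refine norm_integral_le_of_norm_le ((integrable_norm_sq mu).const_mul c)
      (Filter.Eventually.of_forall fun x => ?_)
    rw [norm_mul, norm_pow, norm_norm]
    exact mul_le_mul_of_nonneg_right (hg x) (by positivity)
  have b2 := abs_le.1 (hb f M hM)
  have b3 := abs_le.1 (hb (divField X₀) K hK)
  have b4 := abs_le.1 b1
  have hL0 : 0 ≤ ∫ x, ‖opL f X₀ Y u x‖ ^ 2 := integral_nonneg fun x => by positivity
  nlinarith [mul_nonneg hM0 hL0, mul_nonneg hK0 hL0, mul_nonneg hK0 hU0]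

/-- The energy estimate transferred from the Y_j to any comparable field. It requires no
differentiability of V, so it also covers Υ ∈ F₀ᴮ. -/
lemma comparison_bound (hA : AssumptionA1 f X₀ Y) {V : Space d → Space d} (hV : Comparison Y V) :
    ∃ C : ℝ, 0 < C ∧ ∀ u : Space d → ℂ, SmoothCompact u →
      normL2 (applyField V u) ≤ ENNReal.ofReal C * (normL2 (opL f X₀ Y u) + normL2 u) := by
  obtain ⟨C₁, hC₁, h1⟩ := energy_integral_le hA
  obtain ⟨C₂, hC₂, h2⟩ := hV
  refine ⟨√(C₂ * C₁), Real.sqrt_pos.2 (by positivity), fun u hu => ?_⟩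
  have hu1 : ContDiff ℝ 1 u := hu.1.of_le (by norm_cast)
  have mu : MemLp u 2 volume := hu.1.continuous.memLp_of_hasCompactSupport hu.2
  have mL := opL_memLp hA hu.1
  have mY : ∀ j, MemLp (applyField (Y j) u) 2 volume := fun j => applyField_memLp
    (.of_continuous (hA.2.2 j).1.continuous (hA.2.2 j).2) hu1
  rw [← ENNReal.pow_le_pow_left_iff (n := 2) (by norm_num)]
  calc normL2 (applyField V u) ^ 2
      ≤ ENNReal.ofReal C₂ * ∑ j, normL2 (applyField (Y j) u) ^ 2 := h2 u hu
    _ = ENNReal.ofReal C₂ * ENNReal.ofReal (∑ j, ∫ x, ‖applyField (Y j) u x‖ ^ 2) := by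
        rw [ENNReal.ofReal_sum_of_nonneg fun j _ => integral_nonneg fun x => by positivity]
        simp only [ofReal_integral_norm_sq (mY _)]
    _ ≤ ENNReal.ofReal C₂ * ENNReal.ofReal
          (C₁ * ((∫ x, ‖opL f X₀ Y u x‖ ^ 2) + ∫ x, ‖u x‖ ^ 2)) := by
        gcongr; exact h1 u hu
    _ = ENNReal.ofReal (C₂ * C₁) * (normL2 (opL f X₀ Y u) ^ 2 + normL2 u ^ 2) := by
        rw [ENNReal.ofReal_mul hC₁.le, ENNReal.ofReal_add (integral_nonneg fun x => by positivity)
          (integral_nonneg fun x => by positivity), ofReal_integral_norm_sq mL,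
          ofReal_integral_norm_sq mu, ENNReal.ofReal_mul hC₂.le, mul_assoc]
    _ ≤ ENNReal.ofReal (C₂ * C₁) * (normL2 (opL f X₀ Y u) + normL2 u) ^ 2 := by
        gcongr
        rw [add_sq]
        gcongr
        exact le_self_add
    _ = _ := by
        rw [mul_pow, ← ENNReal.ofReal_pow (Real.sqrt_nonneg _), Real.sq_sqrt (by positivity)]

lemma comparison_self (Y : Fin r → Space d → Space d) (j : Fin r) : Comparison Y (Y j) :=
  ⟨1, one_pos, fun u _ => by
    rw [ENNReal.ofReal_one, one_mul]
    exact Finset.single_le_sum (f := fun j => normL2 (applyField (Y j) u) ^ 2)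
      (fun _ _ => zero_le) (Finset.mem_univ j)⟩

end

section

open scoped SchwartzMap LineDeriv ComplexConjugate
open SchwartzL2

variable {d : ℕ}

/-! ### A Hardy inequality -/

/-- A fixed cutoff function, equal to one on the unit ball. -/
noncomputable def hardyBump (d : ℕ) : ContDiffBump (0 : Space d) := ⟨1, 2, one_pos, one_lt_two⟩

/-- The regularized and truncated weight `|x|^{-2γ}`. -/
noncomputable def hardyWeight (γ η : ℝ) (z : Space d) : ℝ :=
  hardyBump d z * (‖z‖ ^ 2 + η) ^ (-γ)

section
variable {γ η : ℝ}

lemma contDiff_hardyWeight (hη : 0 < η) : ContDiff ℝ 1 (hardyWeight (d := d) γ η) := by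
  refine (hardyBump d).contDiff.mul ?_
  refine ContDiff.rpow_const_of_ne ((contDiff_norm_sq ℝ).add contDiff_const) fun x => ?_
  positivity

lemma fderiv_hardyWeight_self (hη : 0 < η) (z : Space d) :
    fderiv ℝ (hardyWeight (d := d) γ η) z z = fderiv ℝ (hardyBump d) z z * (‖z‖ ^ 2 + η) ^ (-γ)
      - 2 * γ * hardyBump d z * (‖z‖ ^ 2 * (‖z‖ ^ 2 + η) ^ (-γ - 1)) := by
  have h1 : HasFDerivAt (fun z : Space d => ‖z‖ ^ 2 + η) (2 • (innerSL ℝ z)) z :=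
    (hasStrictFDerivAt_norm_sq z).hasFDerivAt.add_const η
  have h2 := h1.rpow_const (p := -γ) (Or.inl (by positivity))
  have h3 : HasFDerivAt (hardyBump d) _ z :=
    ((hardyBump d).contDiff (n := 1)).differentiable (by norm_num) z |>.hasFDerivAt
  have h4 : HasFDerivAt (hardyWeight (d := d) γ η) _ z := h3.mul h2
  rw [h4.fderiv]
  simp
  ring

lemma divField_hardy (hη : 0 < η) (y x : Space d) :
    divField (fun x => hardyWeight γ η (x - y) • (x - y)) x
      = d * hardyWeight γ η (x - y) + fderiv ℝ (hardyWeight (d := d) γ η) (x - y) (x - y) := by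
  have h0 : HasFDerivAt (fun x => x - y) (ContinuousLinearMap.id ℝ (Space d)) x :=
    (hasFDerivAt_id x).sub_const y
  have h1 : HasFDerivAt (fun x => hardyWeight (d := d) γ η (x - y)) _ x :=
    HasFDerivAt.comp (g := hardyWeight (d := d) γ η) (f := fun x => x - y) x
      ((contDiff_hardyWeight hη).differentiable (by norm_num) (x - y)).hasFDerivAt h0
  have h2 : ∀ l : Fin d, fderiv ℝ (fun x => (hardyWeight (d := d) γ η (x - y) • (x - y)) l) x
      (basisVec l) = hardyWeight γ η (x - y)
        + (x - y) l * fderiv ℝ (hardyWeight (d := d) γ η) (x - y) (basisVec l) := fun l => by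
    have h3 : HasFDerivAt (fun x => (x - y) l) _ x :=
      (EuclideanSpace.proj l : Space d →L[ℝ] ℝ).hasFDerivAt.comp x h0
    have h4 : HasFDerivAt (fun x => (hardyWeight (d := d) γ η (x - y) • (x - y)) l) _ x :=
      h1.mul h3
    rw [h4.fderiv]
    simp [basisVec]
  simp only [divField, h2, Finset.sum_add_distrib]
  rw [clm_apply_eq_sum (fderiv ℝ (hardyWeight (d := d) γ η) (x - y)) (x - y)]
  simp

lemma exists_fderiv_hardyBump_bound (d : ℕ) :
    ∃ M : ℝ, 0 ≤ M ∧ ∀ z : Space d, (‖z‖ < 1 → fderiv ℝ (hardyBump d) z = 0) ∧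
      |fderiv ℝ (hardyBump d) z z| ≤ M := by
  have h1 : Continuous fun z : Space d => fderiv ℝ (hardyBump d) z z :=
    (((hardyBump d).contDiff (n := 1)).continuous_fderiv (by norm_num)).clm_apply continuous_id
  have h2 : HasCompactSupport fun z : Space d => fderiv ℝ (hardyBump d) z z :=
    ((hardyBump d).hasCompactSupport.fderiv (𝕜 := ℝ)).mono fun x hx => by
      simp only [Function.mem_support, ne_eq] at hx ⊢
      contrapose! hx
      simp [hx]
  obtain ⟨M, hM⟩ := h2.exists_bound_of_continuous h1
  refine ⟨M, (norm_nonneg _).trans (hM 0), fun z => ⟨fun hz => ?_, hM z⟩⟩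
  have : (hardyBump d : Space d → ℝ) =ᶠ[nhds z] fun _ => 1 := by
    filter_upwards [Metric.isOpen_ball.mem_nhds (by simpa using hz : z ∈ Metric.ball (0 : Space d) 1)] with w hw
    exact (hardyBump d).one_of_mem_closedBall (Metric.ball_subset_closedBall hw)
  rw [this.fderiv_eq]; simp

lemma hardyWeight_nonneg (hη : 0 < η) (z : Space d) : 0 ≤ hardyWeight γ η z :=
  mul_nonneg (hardyBump d).nonneg (by positivity)

/-- The radial derivative of |z|^(-2γ) contributes -2γ times the weight, leaving the factor d - 2γ.
The derivative of the cutoff vanishes for |z| < 1, and elsewhere the power is at most 1, so it costs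
only the constant M. -/
lemma divField_hardy_ge {M : ℝ} (hγ : 0 ≤ γ) (hη : 0 < η)
    (hM : ∀ z : Space d, (‖z‖ < 1 → fderiv ℝ (hardyBump d) z = 0) ∧
      |fderiv ℝ (hardyBump d) z z| ≤ M) (y x : Space d) :
    (d - 2 * γ) * hardyWeight γ η (x - y) - M
      ≤ divField (fun x => hardyWeight γ η (x - y) • (x - y)) x := by
  rw [divField_hardy hη, fderiv_hardyWeight_self hη]
  set z := x - y
  have hz : 0 < ‖z‖ ^ 2 + η := by positivity
  have h1 : ‖z‖ ^ 2 * (‖z‖ ^ 2 + η) ^ (-γ - 1) ≤ (‖z‖ ^ 2 + η) ^ (-γ) := by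
    rw [Real.rpow_sub_one hz.ne', mul_div_assoc', div_le_iff₀ hz]
    have := (Real.rpow_pos_of_pos hz (-γ)).le
    nlinarith
  have h2 : -M ≤ fderiv ℝ (hardyBump d) z z * (‖z‖ ^ 2 + η) ^ (-γ) := by
    have hM0 : 0 ≤ M := (abs_nonneg _).trans (hM z).2
    rcases lt_or_ge ‖z‖ 1 with h | h
    · rw [(hM z).1 h]; simpa using hM0
    · have h3 : (‖z‖ ^ 2 + η) ^ (-γ) ≤ 1 :=
        Real.rpow_le_one_of_one_le_of_nonpos (by nlinarith) (by linarith)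
      have h4 := (abs_le.1 (hM z).2).1
      have h5 := (Real.rpow_pos_of_pos hz (-γ)).le
      nlinarith
  have h3 := mul_le_mul_of_nonneg_left h1 (mul_nonneg (mul_nonneg zero_le_two hγ)
    ((hardyBump d).nonneg (x := z)))
  have h4 : hardyWeight γ η z = hardyBump d z * (‖z‖ ^ 2 + η) ^ (-γ) := rfl
  rw [h4]
  linarith

/-- On the support |z| ≤ 2 the product is at most (|z|² + η)^(1-γ) ≤ 5; the condition γ < 1 enters
here. -/
lemma hardyWeight_mul_sq_le (hγ : 0 ≤ γ) (hγ1 : γ < 1) (hη : 0 < η) (hη1 : η ≤ 1) (z : Space d) :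
    hardyWeight γ η z * ‖z‖ ^ 2 ≤ 5 := by
  rcases lt_or_ge ‖z‖ 2 with h | h
  · have hz : 0 < ‖z‖ ^ 2 + η := by positivity
    have h1 : (‖z‖ ^ 2 + η) ^ (-γ) * ‖z‖ ^ 2 ≤ 5 := by
      have h2 : (‖z‖ ^ 2 + η) ^ (-γ) * (‖z‖ ^ 2 + η) = (‖z‖ ^ 2 + η) ^ (1 - γ) := by
        rw [← Real.rpow_add_one hz.ne']; congr 1; ring
      have h3 : (‖z‖ ^ 2 + η) ^ (1 - γ) ≤ 5 := by
        calc (‖z‖ ^ 2 + η) ^ (1 - γ) ≤ (5 : ℝ) ^ (1 - γ) :=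
              Real.rpow_le_rpow hz.le (by nlinarith [norm_nonneg z]) (by linarith)
          _ ≤ (5 : ℝ) ^ (1 : ℝ) := Real.rpow_le_rpow_of_exponent_le (by norm_num) (by linarith)
          _ = 5 := by norm_num
      have h5 := (Real.rpow_pos_of_pos hz (-γ)).le
      nlinarith
    have h6 := (hardyBump d).le_one (x := z)
    have h7 := (hardyBump d).nonneg (x := z)
    have h8 : 0 ≤ (‖z‖ ^ 2 + η) ^ (-γ) * ‖z‖ ^ 2 := by positivity
    rw [hardyWeight, mul_assoc]
    nlinarith
  · have : hardyBump d z = 0 := (hardyBump d).zero_of_le_dist (by simpa [hardyBump] using h)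
    simp [hardyWeight, this]

lemma norm_fderiv_sq_le {φ : Space d → ℂ} (x : Space d) :
    ‖fderiv ℝ φ x‖ ^ 2 ≤ d * ∑ l, ‖fderiv ℝ φ x (basisVec l)‖ ^ 2 := by
  have h1 : ‖fderiv ℝ φ x‖ ≤ ∑ l, ‖fderiv ℝ φ x (basisVec l)‖ := by
    refine ContinuousLinearMap.opNorm_le_bound _ (by positivity) fun v => ?_
    rw [clm_apply_eq_sum, Finset.sum_mul]
    refine (norm_sum_le _ _).trans (Finset.sum_le_sum fun l _ => ?_)
    rw [norm_smul, mul_comm]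
    exact mul_le_mul_of_nonneg_left (PiLp.norm_apply_le v l) (norm_nonneg _)
  calc ‖fderiv ℝ φ x‖ ^ 2 ≤ (∑ l, ‖fderiv ℝ φ x (basisVec l)‖) ^ 2 := by gcongr
    _ ≤ _ := by simpa using sq_sum_le_card_mul_sum_sq (s := Finset.univ)
                  (f := fun l : Fin d => ‖fderiv ℝ φ x (basisVec l)‖)

/-- The divergence identity for the field w(x - y)(x - y). Its divergence dominates (d - 2γ)w,
positive since 2γ < d, while the first order term is absorbed by Cauchy-Schwarz. The constant
depends neither on the regularization η nor on the centre y. -/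
lemma integral_hardyWeight_le (hγ : 0 ≤ γ) (hγ1 : γ < 1) (hγd : 2 * γ < d) :
    ∃ K : ℝ, 0 ≤ K ∧ ∀ η : ℝ, 0 < η → η ≤ 1 → ∀ (y : Space d) (φ : 𝓢(Space d, ℂ)),
      ∫ x, hardyWeight γ η (x - y) * ‖φ x‖ ^ 2 ≤ K * (‖of φ‖ ^ 2 + ∑ l, ‖opD l (of φ)‖ ^ 2) := by
  obtain ⟨M, hM0, hM⟩ := exists_fderiv_hardyBump_bound d
  set c : ℝ := d - 2 * γ with hc
  have hc0 : 0 < c := by rw [hc]; linarith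
  refine ⟨2 / c * (M + 10 / c * d), by positivity, fun η hη hη1 y φ => ?_⟩
  set Z : Space d → Space d := fun x => hardyWeight γ η (x - y) • (x - y) with hZ
  have hw : ContDiff ℝ 1 fun x : Space d => hardyWeight γ η (x - y) :=
    (contDiff_hardyWeight hη).comp (contDiff_id.sub contDiff_const)
  have hws : HasCompactSupport fun x : Space d => hardyWeight γ η (x - y) := by
    have h1 : HasCompactSupport (hardyWeight (d := d) γ η) :=
      (hardyBump d).hasCompactSupport.mul_right
    exact h1.comp_homeomorph (Homeomorph.subRight y)
  have hZ1 : ContDiff ℝ 1 Z := hw.smul (contDiff_id.sub contDiff_const)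
  have hZs : HasCompactSupport Z := hws.smul_right
  have hφ1 : ContDiff ℝ 1 φ := φ.smooth 1
  have key := two_re_integral_conj_mul_applyField hZ1 hZs hφ1
  have mφ : MemLp φ 2 volume := φ.memLp 2 volume
  have mZ : MemLp (applyField Z φ) 2 volume :=
    applyField_memLp (.of_continuous hZ1.continuous hZs) hφ1
  have iφ := integrable_norm_sq mφ
  have iD : ∀ l, Integrable fun x => ‖fderiv ℝ φ x (basisVec l)‖ ^ 2 := fun l => by
    have := integrable_norm_sq ((∂_{basisVec l} φ).memLp 2 (volume : Measure (Space d)))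
    simpa only [SchwartzMap.lineDerivOp_apply_eq_fderiv] using this
  have iW : Integrable fun x => hardyWeight γ η (x - y) * ‖φ x‖ ^ 2 :=
    (hw.continuous.mul (φ.continuous.norm.pow 2)).integrable_of_hasCompactSupport hws.mul_right
  have iV : Integrable fun x => divField Z x * ‖φ x‖ ^ 2 :=
    ((continuous_divField hZ1).mul (φ.continuous.norm.pow 2)).integrable_of_hasCompactSupport
      (hasCompactSupport_divField hZs).mul_right
  have lower : c * (∫ x, hardyWeight γ η (x - y) * ‖φ x‖ ^ 2) - M * ∫ x, ‖φ x‖ ^ 2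
      ≤ ∫ x, divField Z x * ‖φ x‖ ^ 2 := by
    rw [← integral_const_mul, ← integral_const_mul, ← integral_sub (iW.const_mul c) (iφ.const_mul M)]
    refine integral_mono ((iW.const_mul c).sub (iφ.const_mul M)) iV fun x => ?_
    have h1 := mul_le_mul_of_nonneg_right (divField_hardy_ge hγ hη hM y x)
      (by positivity : 0 ≤ ‖φ x‖ ^ 2)
    simp only
    linarith
  have upper : |(∫ x, conj (φ x) * applyField Z φ x).re|
      ≤ c / 4 * (∫ x, hardyWeight γ η (x - y) * ‖φ x‖ ^ 2)
        + 5 / c * d * ∑ l, ∫ x, ‖fderiv ℝ φ x (basisVec l)‖ ^ 2 := by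
    rw [← integral_finsetSum _ fun l _ => iD l, ← integral_const_mul, ← integral_const_mul]
    have iS := (integrable_finsetSum Finset.univ fun l _ => iD l).const_mul (5 / c * d)
    rw [← integral_add (iW.const_mul _) iS]
    refine (Complex.abs_re_le_norm _).trans (norm_integral_le_of_norm_le
      ((iW.const_mul _).add iS) (Filter.Eventually.of_forall fun x => ?_))
    simp only [norm_mul, RCLike.norm_conj]
    have h1 : ‖applyField Z φ x‖ ≤ ‖fderiv ℝ φ x‖ * (hardyWeight γ η (x - y) * ‖x - y‖) := by
      refine (ContinuousLinearMap.le_opNorm _ _).trans (le_of_eq ?_)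
      rw [hZ, norm_smul, Real.norm_of_nonneg (hardyWeight_nonneg hη _)]
    have h2 := hardyWeight_mul_sq_le hγ hγ1 hη hη1 (x - y)
    have h3 := norm_fderiv_sq_le (φ := φ) x
    have h0 := hardyWeight_nonneg (γ := γ) hη (x - y)
    set w := hardyWeight γ η (x - y)
    set a := ‖φ x‖
    set b := ‖fderiv ℝ φ x‖
    set z := ‖x - y‖
    have ha : 0 ≤ a := norm_nonneg _
    -- The share c/4 is chosen so that, after the factor 2 in the divergence identity, half of c·W
    -- remains on the left.
    have h4 : a * (b * (w * z)) ≤ c / 4 * (w * a ^ 2) + 1 / c * (w * z ^ 2 * b ^ 2) := by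
      have h5 : 0 ≤ w / c * (c / 2 * a - z * b) ^ 2 := by positivity
      have h6 : w / c * (c / 2 * a - z * b) ^ 2
          = c / 4 * (w * a ^ 2) + 1 / c * (w * z ^ 2 * b ^ 2) - a * (b * (w * z)) := by
        field_simp
        ring
      linarith
    have h7 : 1 / c * (w * z ^ 2 * b ^ 2) ≤ 1 / c * (5 * b ^ 2) := by gcongr
    have h8 : 1 / c * (5 * b ^ 2) ≤ 5 / c * d * ∑ l, ‖fderiv ℝ φ x (basisVec l)‖ ^ 2 := by
      calc 1 / c * (5 * b ^ 2) = 5 / c * b ^ 2 := by ring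
        _ ≤ 5 / c * (d * ∑ l, ‖fderiv ℝ φ x (basisVec l)‖ ^ 2) := by gcongr
        _ = _ := by ring
    calc a * ‖applyField Z φ x‖ ≤ a * (b * (w * z)) := by gcongr
      _ ≤ _ := by linarith
  have hnorm : ∀ l, ‖opD l (of φ)‖ ^ 2 = ∫ x, ‖fderiv ℝ φ x (basisVec l)‖ ^ 2 := fun l => by
    rw [opD_of, norm_of_sq]
    simp only [SchwartzMap.lineDerivOp_apply_eq_fderiv]
  simp only [hnorm, norm_of_sq]
  have hup := (abs_le.1 upper).1
  set W := ∫ x, hardyWeight γ η (x - y) * ‖φ x‖ ^ 2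
  set S := ∑ l, ∫ x, ‖fderiv ℝ φ x (basisVec l)‖ ^ 2
  have hS : 0 ≤ S := Finset.sum_nonneg fun l _ => integral_nonneg fun x => by positivity
  have hU : 0 ≤ ∫ x, ‖φ x‖ ^ 2 := integral_nonneg fun x => by positivity
  set U := ∫ x, ‖φ x‖ ^ 2
  have h1 : c / 2 * W ≤ M * U + 10 / c * d * S := by
    have : 10 / c * d * S = 2 * (5 / c * d * S) := by ring
    linarith
  calc W = 2 / c * (c / 2 * W) := by field_simp
    _ ≤ 2 / c * (M * U + 10 / c * d * S) := by gcongr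
    _ ≤ 2 / c * (M * (U + S) + 10 / c * d * (U + S)) := by gcongr <;> linarith
    _ = _ := by ring

/-- Hardy's inequality with an arbitrary centre. -/
theorem hardy_inequality (hγ : 0 ≤ γ) (hγ1 : γ < 1) (hγd : 2 * γ < d) :
    ∃ K : ℝ, 0 ≤ K ∧ ∀ (y : Space d) (φ : 𝓢(Space d, ℂ)),
      ∫⁻ x, ENNReal.ofReal ((‖x - y‖ ^ (-γ)) ^ 2) * ‖φ x‖ₑ ^ 2
        ≤ ENNReal.ofReal (K * (‖of φ‖ ^ 2 + ∑ l, ‖opD l (of φ)‖ ^ 2)) := by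
  obtain ⟨K, hK, H⟩ := integral_hardyWeight_le hγ hγ1 hγd
  refine ⟨K + 1, by positivity, fun y φ => ?_⟩
  set R := ‖of φ‖ ^ 2 + ∑ l, ‖opD l (of φ)‖ ^ 2 with hR
  have hR0 : 0 ≤ R := by positivity
  -- The regularization is removed along this sequence by Fatou's lemma.
  let η : ℕ → ℝ := fun n => 1 / ((n : ℝ) + 1)
  have hη0 : ∀ n, 0 < η n := fun n => by positivity
  have hη1 : ∀ n, η n ≤ 1 := fun n => by
    rw [div_le_one (by positivity)]; linarith [(Nat.cast_nonneg n : (0 : ℝ) ≤ n)]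
  have hηt : Filter.Tendsto η Filter.atTop (nhds 0) := tendsto_one_div_add_atTop_nhds_zero_nat
  have hmeas : ∀ n, Measurable fun x => ENNReal.ofReal (hardyWeight γ (η n) (x - y)) * ‖φ x‖ₑ ^ 2 :=
    fun n => (((contDiff_hardyWeight (hη0 n)).continuous.comp
      (continuous_id.sub continuous_const)).measurable.ennreal_ofReal).mul
      (φ.continuous.measurable.enorm.pow_const 2)
  have hbound : ∀ n, ∫⁻ x, ENNReal.ofReal (hardyWeight γ (η n) (x - y)) * ‖φ x‖ₑ ^ 2
      ≤ ENNReal.ofReal (K * R) := fun n => by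
    have iW : Integrable fun x => hardyWeight γ (η n) (x - y) * ‖φ x‖ ^ 2 := by
      have hws : HasCompactSupport fun x : Space d => hardyWeight γ (η n) (x - y) := by
        have h1 : HasCompactSupport (hardyWeight (d := d) γ (η n)) :=
          (hardyBump d).hasCompactSupport.mul_right
        exact h1.comp_homeomorph (Homeomorph.subRight y)
      exact ((((contDiff_hardyWeight (hη0 n)).continuous.comp
        (continuous_id.sub continuous_const))).mul
        (φ.continuous.norm.pow 2)).integrable_of_hasCompactSupport hws.mul_right
    refine le_trans (le_of_eq ?_) (ENNReal.ofReal_le_ofReal (H (η n) (hη0 n) (hη1 n) y φ))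
    rw [ofReal_integral_eq_lintegral_ofReal iW (Filter.Eventually.of_forall fun x =>
      mul_nonneg (hardyWeight_nonneg (hη0 n) _) (by positivity))]
    refine lintegral_congr fun x => ?_
    rw [ENNReal.ofReal_mul (hardyWeight_nonneg (hη0 n) _), ENNReal.ofReal_pow (norm_nonneg _),
      ofReal_norm]
  -- Inside the unit ball around y the truncated weights converge to |x - y|^(-2γ); outside it the
  -- weight is at most 1. The extra term accounts for the constant K + 1.
  have hpt : ∀ x, ENNReal.ofReal ((‖x - y‖ ^ (-γ)) ^ 2) * ‖φ x‖ₑ ^ 2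
      ≤ Filter.liminf (fun n => ENNReal.ofReal (hardyWeight γ (η n) (x - y)) * ‖φ x‖ₑ ^ 2)
          Filter.atTop + ‖φ x‖ₑ ^ 2 := by
    intro x
    have easy : ‖x - y‖ ^ (-γ) ≤ 1 → ENNReal.ofReal ((‖x - y‖ ^ (-γ)) ^ 2) * ‖φ x‖ₑ ^ 2
      ≤ Filter.liminf (fun n => ENNReal.ofReal (hardyWeight γ (η n) (x - y)) * ‖φ x‖ₑ ^ 2)
          Filter.atTop + ‖φ x‖ₑ ^ 2 := fun h => by
      refine le_trans ?_ le_add_self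
      calc _ ≤ ENNReal.ofReal 1 * ‖φ x‖ₑ ^ 2 := by
            gcongr; exact pow_le_one₀ (by positivity) h
        _ = _ := by simp
    -- At x = y the real power takes the conventional value of 0^(-γ), which is at most 1.
    rcases eq_or_lt_of_le (norm_nonneg (x - y)) with h0 | h0
    · apply easy
      rw [← h0]
      exact Real.zero_rpow_le_one _
    rcases lt_or_ge 1 ‖x - y‖ with h1 | h1
    · exact easy (Real.rpow_le_one_of_one_le_of_nonpos h1.le (by linarith))
    · have hlim : Filter.Tendsto (fun n => ENNReal.ofReal (hardyWeight γ (η n) (x - y)) * ‖φ x‖ₑ ^ 2)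
          Filter.atTop (nhds (ENNReal.ofReal ((‖x - y‖ ^ (-γ)) ^ 2) * ‖φ x‖ₑ ^ 2)) := by
        refine ENNReal.Tendsto.mul_const ?_ (Or.inr (by simp))
        refine ENNReal.tendsto_ofReal ?_
        have hb : hardyBump d (x - y) = 1 :=
          (hardyBump d).one_of_mem_closedBall (by simpa [hardyBump] using h1)
        have e : (‖x - y‖ ^ (-γ)) ^ 2 = (‖x - y‖ ^ 2 + 0) ^ (-γ) := by
          rw [add_zero, ← Real.rpow_natCast, ← Real.rpow_natCast, ← Real.rpow_mul h0.le,
            ← Real.rpow_mul h0.le, mul_comm]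
        simp only [hardyWeight, hb, one_mul]
        rw [e]
        exact ((tendsto_const_nhds.add hηt).rpow_const (Or.inl (by positivity)))
      rw [hlim.liminf_eq]
      exact le_self_add
  calc ∫⁻ x, ENNReal.ofReal ((‖x - y‖ ^ (-γ)) ^ 2) * ‖φ x‖ₑ ^ 2
      ≤ ∫⁻ x, (Filter.liminf (fun n => ENNReal.ofReal (hardyWeight γ (η n) (x - y)) * ‖φ x‖ₑ ^ 2)
          Filter.atTop + ‖φ x‖ₑ ^ 2) := lintegral_mono hpt
    _ = (∫⁻ x, Filter.liminf (fun n => ENNReal.ofReal (hardyWeight γ (η n) (x - y)) * ‖φ x‖ₑ ^ 2)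
          Filter.atTop) + ∫⁻ x, ‖φ x‖ₑ ^ 2 :=
        lintegral_add_right _ (φ.continuous.measurable.enorm.pow_const 2)
    _ ≤ ENNReal.ofReal (K * R) + ENNReal.ofReal (‖of φ‖ ^ 2) := by
        rw [lintegral_enorm_sq]
        gcongr
        refine (lintegral_liminf_le hmeas).trans ?_
        exact Filter.liminf_le_of_le (by isBoundedDefault) fun b hb =>
          (hb.exists.choose_spec).trans (hbound _)
    _ ≤ ENNReal.ofReal ((K + 1) * R) := by
        rw [← ENNReal.ofReal_add (by positivity) (by positivity)]
        apply ENNReal.ofReal_le_ofReal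
        have : ‖of φ‖ ^ 2 ≤ R := by
          rw [hR]; exact le_add_of_nonneg_right (by positivity)
        linarith
end

end

section

open scoped SchwartzMap LineDeriv ComplexConjugate
open SchwartzL2

variable {d : ℕ}

/-! ### Mollification of the coefficients -/

/-- The convolution of `b` with the test function `ρ`. -/
noncomputable def mollify (b : Space d → ℝ) (ρ : Coef d) (x : Space d) : ℝ :=
  ∫ t, b t * ρ (x - t)

lemma mollify_eq_convolution (b : Space d → ℝ) (ρ : Coef d) :
    mollify b ρ = convolution b ρ (ContinuousLinearMap.mul ℝ ℝ) volume := rfl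

lemma hasCompactSupport_pd {ρ : Coef d} (hρ : HasCompactSupport ρ) (e : Space d) :
    HasCompactSupport (∂_{e} ρ : Coef d) := by
  have h : ((∂_{e} ρ : Coef d) : Space d → ℝ) = fun x => fderiv ℝ ρ x e :=
    funext fun x => SchwartzMap.lineDerivOp_apply_eq_fderiv _ _ _
  rw [h]
  exact hρ.fderiv_apply (𝕜 := ℝ) e

lemma contDiff_mollify {b : Space d → ℝ} {ρ : Coef d} (hb : LocallyIntegrable b volume)
    (hρ : HasCompactSupport ρ) : ContDiff ℝ ∞ (mollify b ρ) := by
  rw [mollify_eq_convolution]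
  exact hρ.contDiff_convolution_right (ContinuousLinearMap.mul ℝ ℝ) hb (ρ.smooth ⊤)

lemma fderiv_mollify {b : Space d → ℝ} {ρ : Coef d} (hb : LocallyIntegrable b volume)
    (hρ : HasCompactSupport ρ) (x e : Space d) :
    fderiv ℝ (mollify b ρ) x e = mollify b (∂_{e} ρ) x := by
  have h := hρ.hasFDerivAt_convolution_right (ContinuousLinearMap.mul ℝ ℝ) hb (ρ.smooth 1) x
  rw [mollify_eq_convolution, h.fderiv, convolution_precompR_apply _ hb (hρ.fderiv ℝ)
    ((ρ.smooth 1).continuous_fderiv one_ne_zero)]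
  simp only [mollify, convolution, SchwartzMap.lineDerivOp_apply_eq_fderiv,
    ContinuousLinearMap.mul_apply']

/-- Here the derivative falls on b rather than on the mollifier, which preserves uniform bounds as
the mollifier shrinks. -/
lemma fderiv_mollify' {b : Space d → ℝ} {ρ : Coef d} (hb : ContDiff ℝ 1 b)
    (hbs : HasCompactSupport b) (x e : Space d) :
    fderiv ℝ (mollify b ρ) x e = mollify (fun t => fderiv ℝ b t e) ρ x := by
  have hρ : LocallyIntegrable ρ volume := ρ.continuous.locallyIntegrable
  have h := hbs.hasFDerivAt_convolution_right (ContinuousLinearMap.mul ℝ ℝ) hρ hb x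
  have hswap : ∀ b : Space d → ℝ, mollify b ρ = convolution ρ b (ContinuousLinearMap.mul ℝ ℝ) volume :=
    fun b => by
      funext x
      rw [convolution_eq_swap]
      simp only [mollify, ContinuousLinearMap.mul_apply', mul_comm]
  rw [hswap, hswap, h.fderiv, convolution_precompR_apply _ hρ (hbs.fderiv ℝ)
    (hb.continuous_fderiv one_ne_zero)]

/-- The test function `t ↦ ρ (x - t)`. -/
noncomputable def reflect (x : Space d) {ρ : Coef d} (hρ : HasCompactSupport ρ) : Coef d :=
  (hρ.comp_homeomorph (Homeomorph.subLeft x)).toSchwartzMap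
    ((ρ.smooth ⊤).comp (contDiff_const.sub contDiff_id))

lemma reflect_apply (x : Space d) {ρ : Coef d} (hρ : HasCompactSupport ρ) (t : Space d) :
    reflect x hρ t = ρ (x - t) := rfl

lemma lineDerivOp_reflect (x : Space d) {ρ : Coef d} (hρ : HasCompactSupport ρ) (e : Space d) :
    ∂_{e} (reflect x hρ) = -reflect x (hasCompactSupport_pd hρ e) := by
  ext t
  have h0 : HasFDerivAt (fun t => x - t) (-ContinuousLinearMap.id ℝ (Space d)) t :=
    (hasFDerivAt_id t).const_sub x
  have h1 : HasFDerivAt (reflect x hρ) _ t :=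
    HasFDerivAt.comp (g := ρ) (f := fun t => x - t) t
      ((ρ.smooth 1).differentiable one_ne_zero (x - t)).hasFDerivAt h0
  rw [SchwartzMap.lineDerivOp_apply_eq_fderiv, h1.fderiv, neg_apply, reflect_apply,
    SchwartzMap.lineDerivOp_apply_eq_fderiv]
  simp

/-- The weak derivative is tested on t ↦ ρ(x - t). Reflection gives (-1)³, which cancels the sign in
the definition of the weak derivative. -/
lemma mollify_weakPartial_three {b g : Space d → ℝ} {i : Fin 3 → Fin d} (h : IsWeakPartial i b g)
    {ρ : Coef d} (hρ : HasCompactSupport ρ) (x : Space d) :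
    mollify b (∂_{basisVec (i 0)} (∂_{basisVec (i 1)} (∂_{basisVec (i 2)} ρ))) x
      = mollify g ρ x := by
  have h1 := h.2 (reflect x hρ) ⟨(reflect x hρ).smooth ⊤,
    hρ.comp_homeomorph (Homeomorph.subLeft x)⟩
  have h2 : ∀ t, iteratedFDeriv ℝ 3 (reflect x hρ) t (fun k => basisVec (i k))
      = -(∂_{basisVec (i 0)} (∂_{basisVec (i 1)} (∂_{basisVec (i 2)} ρ)) : Coef d) (x - t) :=
    fun t => by
      rw [← SchwartzMap.iteratedLineDerivOp_eq_iteratedFDeriv]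
      simp only [LineDeriv.iteratedLineDerivOp_succ_left, LineDeriv.iteratedLineDerivOp_fin_zero,
        Fin.tail]
      have e1 : (0 : Fin 2).succ = (1 : Fin 3) := rfl
      have e2 : (0 : Fin 1).succ.succ = (2 : Fin 3) := rfl
      rw [e1, e2, lineDerivOp_reflect, LineDeriv.lineDerivOp_neg, lineDerivOp_reflect, neg_neg,
        lineDerivOp_reflect, neg_apply, reflect_apply]
  simp only [h2, mul_neg, integral_neg, reflect_apply] at h1
  have h3 : ((-1 : ℝ)) ^ 3 = -1 := by norm_num
  rw [h3, neg_one_mul, neg_inj] at h1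
  exact h1

lemma abs_mollify_le {b : Space d → ℝ} {K : ℝ} (hb : ∀ x, |b x| ≤ K) {ρ : Coef d}
    (hρ0 : ∀ x, 0 ≤ ρ x) (hρ1 : ∫ x, ρ x = 1) (x : Space d) : |mollify b ρ x| ≤ K := by
  have hi : Integrable fun t => ρ (x - t) := (ρ.integrable (μ := volume)).comp_sub_left x
  have h1 : ∫ t, K * ρ (x - t) = K := by
    rw [integral_const_mul, integral_sub_left_eq_self (fun t => ρ t) volume x, hρ1, mul_one]
  rw [← Real.norm_eq_abs, ← h1]
  refine norm_integral_le_of_norm_le (hi.const_mul K) (Filter.Eventually.of_forall fun t => ?_)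
  rw [norm_mul, Real.norm_of_nonneg (hρ0 _)]
  exact mul_le_mul_of_nonneg_right (hb t) (hρ0 _)

/-- Division by |x|^γ is legitimate almost everywhere: 2γ < d forces d > 0, so the origin is a null
set. -/
lemma weight_bound {γ : ℝ} (hγ : 0 ≤ γ) (hγd : 2 * γ < d) {g : Space d → ℝ}
    (hg : eLpNorm (fun x => g x * ‖x‖ ^ γ) ⊤ volume < ⊤) :
    ∃ M : ℝ, 0 ≤ M ∧ ∀ᵐ x, ‖g x‖ ≤ M * ‖x‖ ^ (-γ) := by
  have hd : 0 < d := by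
    have : (0 : ℝ) < d := by linarith
    exact_mod_cast this
  have : Nonempty (Fin d) := ⟨⟨0, hd⟩⟩
  have h0 : ∀ᵐ x : Space d, x ≠ 0 := by
    have : Nontrivial (Space d) := inferInstance
    exact compl_mem_ae_iff.2 (measure_singleton 0)
  refine ⟨(eLpNorm (fun x => g x * ‖x‖ ^ γ) ⊤ volume).toReal, ENNReal.toReal_nonneg, ?_⟩
  have h1 := ae_le_eLpNormEssSup (f := fun x : Space d => g x * ‖x‖ ^ γ) (μ := volume)
  filter_upwards [h0, h1] with x hx hx1
  rw [← eLpNorm_exponent_top] at hx1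
  have h2 := ENNReal.toReal_mono hg.ne hx1
  rw [toReal_enorm, norm_mul, Real.norm_of_nonneg (by positivity : 0 ≤ ‖x‖ ^ γ)] at h2
  have hx' : 0 < ‖x‖ := norm_pos_iff.2 hx
  rw [Real.rpow_neg hx'.le, ← div_eq_mul_inv, le_div_iff₀ (by positivity)]
  exact h2

/-- Jensen's inequality for the probability density ρ, from Cauchy-Schwarz with ρ = ρ^(1/2) ρ^(1/2).
-/
lemma lintegral_mul_sq_le {ρ w : Space d → ℝ≥0∞} (hρ : Measurable ρ) (hw : Measurable w)
    (hρ1 : ∫⁻ s, ρ s = 1) : (∫⁻ s, w s * ρ s) ^ 2 ≤ ∫⁻ s, w s ^ 2 * ρ s := by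
  have h := ENNReal.lintegral_mul_le_Lp_mul_Lq volume Real.HolderConjugate.two_two
    ((hw.mul (hρ.pow_const (1 / 2 : ℝ))).aemeasurable) (hρ.pow_const (1 / 2 : ℝ)).aemeasurable
  have e : ∀ a : ℝ≥0∞, a ^ (1 / 2 : ℝ) * a ^ (1 / 2 : ℝ) = a := fun a => by
    rw [← ENNReal.rpow_add_of_nonneg _ _ (by norm_num) (by norm_num)]; norm_num
  have e2 : ∀ s, (w s * ρ s ^ (1 / 2 : ℝ)) ^ (2 : ℝ) = w s ^ 2 * ρ s := fun s => by
    rw [ENNReal.rpow_two, mul_pow, sq (ρ s ^ (1 / 2 : ℝ)), e]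
  have e3 : ∀ s, (ρ s ^ (1 / 2 : ℝ)) ^ (2 : ℝ) = ρ s := fun s => by
    rw [ENNReal.rpow_two, sq, e]
  simp only [Pi.mul_apply, mul_assoc, e] at h
  simp only [e2, e3, hρ1, ENNReal.one_rpow, mul_one] at h
  calc (∫⁻ s, w s * ρ s) ^ 2 ≤ ((∫⁻ s, w s ^ 2 * ρ s) ^ (1 / 2 : ℝ)) ^ 2 := by gcongr
    _ = _ := by rw [sq, e]

/-- Mollification averages the singularity |x|^(-γ) over translates |x - s|^(-γ). By Jensen and
Tonelli the bound reduces to Hardy's inequality centred at s, averaged against ρ(s), so the result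
is independent of how concentrated ρ is. -/
lemma hardy_of_mollify {γ : ℝ} (hγ : 0 ≤ γ) (hγ1 : γ < 1) (hγd : 2 * γ < d) {g : Space d → ℝ}
    (hg : eLpNorm (fun x => g x * ‖x‖ ^ γ) ⊤ volume < ⊤) {ι : Type*} {ρ G : ι → Coef d}
    (hρ0 : ∀ n x, 0 ≤ ρ n x) (hρ1 : ∀ n, ∫ x, ρ n x = 1) (hG : ∀ n x, G n x = mollify g (ρ n) x) :
    FHardy G := by
  obtain ⟨M, hM0, hM⟩ := weight_bound hγ hγd hg
  obtain ⟨K, hK0, hK⟩ := hardy_inequality hγ hγ1 hγd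
  refine ⟨√(M ^ 2 * K), Real.sqrt_nonneg _, fun n φ => ?_⟩
  obtain ⟨φ, rfl⟩ : ∃ ψ : 𝓢(Space d, ℂ), of ψ = φ := ⟨of.symm φ, by simp⟩
  set R := ‖of φ‖ ^ 2 + ∑ l, ‖opD l (of φ)‖ ^ 2 with hR
  have hR0 : 0 ≤ R := by positivity
  have mρ : Measurable fun s => ENNReal.ofReal (ρ n s) :=
    (ρ n).continuous.measurable.ennreal_ofReal
  have hρl : ∫⁻ s, ENNReal.ofReal (ρ n s) = 1 := by
    rw [← ofReal_integral_eq_lintegral_ofReal (ρ n).integrable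
      (Filter.Eventually.of_forall (hρ0 n)), hρ1, ENNReal.ofReal_one]
  have hpt : ∀ x, ‖G n x‖ₑ ^ 2 ≤ ∫⁻ s, ENNReal.ofReal (M ^ 2) *
      ENNReal.ofReal ((‖x - s‖ ^ (-γ)) ^ 2) * ENNReal.ofReal (ρ n s) := fun x => by
    have h1 : ‖G n x‖ₑ ≤ ∫⁻ s, ENNReal.ofReal (M * ‖x - s‖ ^ (-γ)) * ENNReal.ofReal (ρ n s) := by
      rw [hG, mollify]
      calc ‖∫ t, g t * ρ n (x - t)‖ₑ ≤ ∫⁻ t, ‖g t * ρ n (x - t)‖ₑ := enorm_integral_le_lintegral_enorm _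
        _ ≤ ∫⁻ t, ENNReal.ofReal (M * ‖t‖ ^ (-γ)) * ENNReal.ofReal (ρ n (x - t)) := by
          refine lintegral_mono_ae ?_
          filter_upwards [hM] with t ht
          rw [enorm_mul, ← ofReal_norm (g t), ← ofReal_norm (ρ n (x - t)),
            Real.norm_of_nonneg (hρ0 n _)]
          gcongr
        _ = ∫⁻ s, ENNReal.ofReal (M * ‖x - s‖ ^ (-γ)) * ENNReal.ofReal (ρ n s) := by
          rw [← lintegral_sub_left_eq_self (fun s => ENNReal.ofReal (M * ‖x - s‖ ^ (-γ)) *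
            ENNReal.ofReal (ρ n s)) x]
          simp only [sub_sub_cancel]
    have mw' : Measurable fun s : Space d => ENNReal.ofReal (M * ‖x - s‖ ^ (-γ)) :=
      ((((measurable_const.sub measurable_id).norm).pow_const (-γ)).const_mul M).ennreal_ofReal
    calc ‖G n x‖ₑ ^ 2
        ≤ (∫⁻ s, ENNReal.ofReal (M * ‖x - s‖ ^ (-γ)) * ENNReal.ofReal (ρ n s)) ^ 2 := by gcongr
      _ ≤ ∫⁻ s, ENNReal.ofReal (M * ‖x - s‖ ^ (-γ)) ^ 2 * ENNReal.ofReal (ρ n s) :=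
        lintegral_mul_sq_le mρ mw' hρl
      _ = _ := by
        refine lintegral_congr fun s => ?_
        rw [ENNReal.ofReal_mul hM0, mul_pow, ← ENNReal.ofReal_pow hM0,
          ← ENNReal.ofReal_pow (by positivity)]
  have hsq : ENNReal.ofReal (‖opM (G n) (of φ)‖ ^ 2) ≤ ENNReal.ofReal (M ^ 2 * K * R) := by
    calc ENNReal.ofReal (‖opM (G n) (of φ)‖ ^ 2)
        = ∫⁻ x, ‖G n x‖ₑ ^ 2 * ‖φ x‖ₑ ^ 2 := by
          have h := lintegral_enorm_sq (of.symm (opM (G n) (of φ)))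
          rw [LinearEquiv.apply_symm_apply] at h
          rw [← h]
          refine lintegral_congr fun x => ?_
          rw [opM_apply, enorm_mul, mul_pow]
          congr 2
          rw [← ofReal_norm, Complex.norm_real, ofReal_norm]
      _ ≤ ∫⁻ x, ∫⁻ s, ENNReal.ofReal (M ^ 2) * ENNReal.ofReal ((‖x - s‖ ^ (-γ)) ^ 2) *
            ENNReal.ofReal (ρ n s) * ‖φ x‖ₑ ^ 2 := by
          refine lintegral_mono fun x => ?_
          rw [lintegral_mul_const' _ _ (by simp)]
          gcongr
          exact hpt x
      _ = ∫⁻ s, ∫⁻ x, ENNReal.ofReal (M ^ 2) * ENNReal.ofReal ((‖x - s‖ ^ (-γ)) ^ 2) *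
            ENNReal.ofReal (ρ n s) * ‖φ x‖ₑ ^ 2 := by
          refine lintegral_lintegral_swap (Measurable.aemeasurable ?_)
          have h1 : Measurable fun p : Space d × Space d => ENNReal.ofReal ((‖p.1 - p.2‖ ^ (-γ)) ^ 2) :=
            ((((measurable_fst.sub measurable_snd).norm).pow_const (-γ)).pow_const 2).ennreal_ofReal
          exact ((h1.const_mul _).mul (mρ.comp measurable_snd)).mul
            ((φ.continuous.measurable.enorm.pow_const 2).comp measurable_fst)
      _ = ∫⁻ s, ENNReal.ofReal (M ^ 2) * ENNReal.ofReal (ρ n s) *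
            ∫⁻ x, ENNReal.ofReal ((‖x - s‖ ^ (-γ)) ^ 2) * ‖φ x‖ₑ ^ 2 := by
          refine lintegral_congr fun s => ?_
          rw [← lintegral_const_mul' _ _ (ENNReal.mul_ne_top ENNReal.ofReal_ne_top
            ENNReal.ofReal_ne_top)]
          refine lintegral_congr fun x => ?_
          ring
      _ ≤ ∫⁻ s, ENNReal.ofReal (M ^ 2) * ENNReal.ofReal (ρ n s) * ENNReal.ofReal (K * R) := by
          refine lintegral_mono fun s => ?_
          gcongr
          exact hK s φ
      _ = ENNReal.ofReal (M ^ 2 * K * R) := by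
          rw [lintegral_mul_const' _ _ ENNReal.ofReal_ne_top,
            lintegral_const_mul' _ _ ENNReal.ofReal_ne_top, hρl, mul_one,
            ← ENNReal.ofReal_mul (by positivity), mul_assoc]
  have hsq' := (ENNReal.ofReal_le_ofReal_iff (by positivity)).1 hsq
  have hRle : R ≤ (‖of φ‖ + ∑ l, ‖opD l (of φ)‖) ^ 2 := by
    have h1 : ∑ l, ‖opD l (of φ)‖ ^ 2 ≤ (∑ l, ‖opD l (of φ)‖) ^ 2 :=
      Finset.sum_sq_le_sq_sum_of_nonneg fun l _ => norm_nonneg _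
    have h2 : 0 ≤ ‖of φ‖ * ∑ l, ‖opD l (of φ)‖ := by positivity
    nlinarith
  refine abs_le_of_sq_le_sq' ?_ (by positivity) |>.2
  rw [mul_pow, Real.sq_sqrt (by positivity)]
  exact hsq'.trans (by gcongr)

/-- A shrinking sequence of bump functions. -/
noncomputable def bump (d n : ℕ) : ContDiffBump (0 : Space d) :=
  ⟨1 / (2 * (n + 1)), 1 / (n + 1), by positivity, by
    have : (0 : ℝ) < n + 1 := by positivity
    rw [div_lt_div_iff₀ (by positivity) this]; linarith⟩

/-- The standard mollifier. -/
noncomputable def mollifier (d n : ℕ) : Coef d :=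
  (bump d n).hasCompactSupport_normed (μ := volume).toSchwartzMap (bump d n).contDiff_normed

lemma mollifier_apply (n : ℕ) (x : Space d) : mollifier d n x = (bump d n).normed volume x := rfl

lemma mollifier_hasCompactSupport (n : ℕ) : HasCompactSupport (mollifier d n) :=
  (bump d n).hasCompactSupport_normed

lemma mollifier_nonneg (n : ℕ) (x : Space d) : 0 ≤ mollifier d n x := (bump d n).nonneg_normed x

lemma integral_mollifier (n : ℕ) : ∫ x, mollifier d n x = 1 := (bump d n).integral_normed

lemma tendsto_mollify {b : Space d → ℝ} (hb : Continuous b) (x : Space d) :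
    Filter.Tendsto (fun n => mollify b (mollifier d n) x) Filter.atTop (nhds (b x)) := by
  have h := ContDiffBump.convolution_tendsto_right_of_continuous (μ := (volume : Measure (Space d)))
    (φ := fun n => bump d n) (l := Filter.atTop) tendsto_one_div_add_atTop_nhds_zero_nat hb x
  refine h.congr fun n => ?_
  rw [convolution_eq_swap]
  simp only [mollify, ContinuousLinearMap.lsmul_apply, smul_eq_mul, mollifier_apply, mul_comm]

/-- Two derivatives fall on a, which is C², and give uniform bounds. The third is put on the
mollifier and identified with a mollified weak derivative, to which Hardy's inequality applies. -/
theorem exists_mollification {γ : ℝ} (hγ : 0 ≤ γ) (hγ1 : γ < 1) (hγd : 2 * γ < d)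
    {a : Space d → ℝ} (ha : ContDiff ℝ 2 a) (has : HasCompactSupport a)
    (hw : WeightedDerivBound 3 γ a) :
    ∃ A : ℕ → Coef d, FCls 2 A ∧
      (∀ x, Filter.Tendsto (fun n => A n x) Filter.atTop (nhds (a x))) ∧
      ∀ l x, Filter.Tendsto (fun n => fderiv ℝ (A n) x (basisVec l)) Filter.atTop
        (nhds (fderiv ℝ a x (basisVec l))) := by
  have la : LocallyIntegrable a volume := ha.continuous.locallyIntegrable
  have ha1 : ContDiff ℝ 1 a := ha.of_le (by norm_num)
  have hρs := fun n => mollifier_hasCompactSupport (d := d) n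
  have hs : ∀ n, HasCompactSupport (mollify a (mollifier d n)) := fun n => by
    rw [mollify_eq_convolution]
    exact HasCompactSupport.convolution (ContinuousLinearMap.mul ℝ ℝ) has (hρs n)
  obtain ⟨A, hA⟩ : ∃ A : ℕ → Coef d, ∀ n, (A n : Space d → ℝ) = mollify a (mollifier d n) :=
    ⟨fun n => (hs n).toSchwartzMap (contDiff_mollify la (hρs n)), fun n => rfl⟩
  have hD : ∀ l : Fin d, ContDiff ℝ 1 fun t => fderiv ℝ a t (basisVec l) := fun l =>
    (ha.fderiv_right (m := 1) (by norm_num)).clm_apply contDiff_const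
  have hDs : ∀ l : Fin d, HasCompactSupport fun t => fderiv ℝ a t (basisVec l) := fun l =>
    has.fderiv_apply (𝕜 := ℝ) _
  have hA1 : ∀ l n, (pd l A n : Space d → ℝ) = mollify a (∂_{basisVec l} (mollifier d n)) :=
    fun l n => by
      funext x
      rw [pd, SchwartzMap.lineDerivOp_apply_eq_fderiv, hA, fderiv_mollify la (hρs n)]
  have hA1' : ∀ l n, (pd l A n : Space d → ℝ)
      = mollify (fun t => fderiv ℝ a t (basisVec l)) (mollifier d n) := fun l n => by
    funext x
    rw [pd, SchwartzMap.lineDerivOp_apply_eq_fderiv, hA, fderiv_mollify' ha1 has]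
  have hA2 : ∀ k l n, (pd k (pd l A) n : Space d → ℝ)
      = mollify a (∂_{basisVec k} (∂_{basisVec l} (mollifier d n))) := fun k l n => by
    funext x
    rw [pd, SchwartzMap.lineDerivOp_apply_eq_fderiv, hA1,
      fderiv_mollify la (hasCompactSupport_pd (hρs n) _)]
  have hA2' : ∀ k l n, (pd k (pd l A) n : Space d → ℝ)
      = mollify (fun t => fderiv ℝ (fun t => fderiv ℝ a t (basisVec l)) t (basisVec k))
          (mollifier d n) := fun k l n => by
    funext x
    rw [pd, SchwartzMap.lineDerivOp_apply_eq_fderiv, hA1', fderiv_mollify' (hD l) (hDs l)]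
  have bdd : ∀ {b : Space d → ℝ} {B : ℕ → Coef d}, Continuous b → HasCompactSupport b →
      (∀ n, (B n : Space d → ℝ) = mollify b (mollifier d n)) → FBdd B := by
    intro b B hb hbs hB
    obtain ⟨K, hK⟩ := hbs.exists_bound_of_continuous hb
    exact ⟨K, (norm_nonneg _).trans (hK 0), fun n x => by
      rw [hB]; exact abs_mollify_le hK (mollifier_nonneg n) (integral_mollifier n) x⟩
  refine ⟨A, ⟨bdd ha.continuous has hA, fun l => ⟨bdd (hD l).continuous (hDs l) (hA1' l),
    fun k => ⟨bdd (((hD l).continuous_fderiv one_ne_zero).clm_apply continuous_const)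
      ((hDs l).fderiv_apply (𝕜 := ℝ) _) (hA2' k l), fun j => ?_⟩⟩⟩, fun x => ?_, fun l x => ?_⟩
  -- The multi-index lists the derivatives from the outermost to the innermost.
  · obtain ⟨g, hg, hgb⟩ := hw ![j, k, l]
    refine hardy_of_mollify hγ hγ1 hγd hgb mollifier_nonneg integral_mollifier fun n x => ?_
    rw [← mollify_weakPartial_three hg (hρs n), pd, SchwartzMap.lineDerivOp_apply_eq_fderiv, hA2,
      fderiv_mollify la (hasCompactSupport_pd (hasCompactSupport_pd (hρs n) _) _)]
    rfl
  · simp only [hA]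
    exact tendsto_mollify ha.continuous x
  · have : ∀ n, fderiv ℝ (A n) x (basisVec l) = mollify (fun t => fderiv ℝ a t (basisVec l))
        (mollifier d n) x := fun n => by rw [hA, fderiv_mollify' ha1 has]
    simp only [this]
    exact tendsto_mollify (hD l).continuous x

end

section

open scoped SchwartzMap LineDeriv ComplexConjugate
open SchwartzL2

variable {d : ℕ}

/-! ### Convergence of the operators with mollified coefficients -/

/-- Uniformly bounded pointwise convergence. -/
structure BddTendsto (c : ℕ → Space d → ℝ) (c' : Space d → ℝ) : Prop where
  bdd : ∃ K : ℝ, 0 ≤ K ∧ ∀ n x, |c n x| ≤ K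
  tendsto : ∀ x, Filter.Tendsto (fun n => c n x) Filter.atTop (nhds (c' x))

lemma BddTendsto.mul {b c : ℕ → Space d → ℝ} {b' c' : Space d → ℝ} (hb : BddTendsto b b')
    (hc : BddTendsto c c') : BddTendsto (fun n x => b n x * c n x) (fun x => b' x * c' x) := by
  obtain ⟨K, hK, h1⟩ := hb.bdd
  obtain ⟨L, hL, h2⟩ := hc.bdd
  refine ⟨⟨K * L, by positivity, fun n x => ?_⟩, fun x => (hb.tendsto x).mul (hc.tendsto x)⟩
  rw [abs_mul]
  exact mul_le_mul (h1 n x) (h2 n x) (abs_nonneg _) hK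

lemma BddTendsto.sum {κ : Type*} (F : Finset κ) {c : κ → ℕ → Space d → ℝ} {c' : κ → Space d → ℝ}
    (h : ∀ j, BddTendsto (c j) (c' j)) :
    BddTendsto (fun n x => ∑ j ∈ F, c j n x) (fun x => ∑ j ∈ F, c' j x) := by
  choose K hK H using fun j => (h j).bdd
  refine ⟨⟨∑ j ∈ F, K j, Finset.sum_nonneg fun j _ => hK j, fun n x => ?_⟩,
    fun x => tendsto_finsetSum _ fun j _ => (h j).tendsto x⟩
  exact (Finset.abs_sum_le_sum_abs _ _).trans (Finset.sum_le_sum fun j _ => H j n x)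

/-- Pointwise convergence dominated by a square integrable function. -/
structure DomTendsto (ψ : ℕ → Space d → ℂ) (g : Space d → ℂ) : Prop where
  dom : ∃ θ : Space d → ℝ, MemLp θ 2 volume ∧ ∀ n x, ‖ψ n x‖ ≤ θ x
  tendsto : ∀ x, Filter.Tendsto (fun n => ψ n x) Filter.atTop (nhds (g x))

lemma DomTendsto.add {ψ χ : ℕ → Space d → ℂ} {g k : Space d → ℂ} (hψ : DomTendsto ψ g)
    (hχ : DomTendsto χ k) : DomTendsto (fun n x => ψ n x + χ n x) (fun x => g x + k x) := by
  obtain ⟨θ, h1, h2⟩ := hψ.dom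
  obtain ⟨η, h3, h4⟩ := hχ.dom
  exact ⟨⟨θ + η, h1.add h3, fun n x => (norm_add_le _ _).trans (add_le_add (h2 n x) (h4 n x))⟩,
    fun x => (hψ.tendsto x).add (hχ.tendsto x)⟩

lemma DomTendsto.neg {ψ : ℕ → Space d → ℂ} {g : Space d → ℂ} (hψ : DomTendsto ψ g) :
    DomTendsto (fun n x => -ψ n x) (fun x => -g x) := by
  obtain ⟨θ, h1, h2⟩ := hψ.dom
  exact ⟨⟨θ, h1, fun n x => by rw [norm_neg]; exact h2 n x⟩, fun x => (hψ.tendsto x).neg⟩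

lemma DomTendsto.sum {κ : Type*} (F : Finset κ) {ψ : κ → ℕ → Space d → ℂ} {g : κ → Space d → ℂ}
    (h : ∀ j, DomTendsto (ψ j) (g j)) :
    DomTendsto (fun n x => ∑ j ∈ F, ψ j n x) (fun x => ∑ j ∈ F, g j x) := by
  choose θ hθ H using fun j => (h j).dom
  refine ⟨⟨fun x => ∑ j ∈ F, θ j x, memLp_finsetSum _ fun j _ => hθ j, fun n x => ?_⟩,
    fun x => tendsto_finsetSum _ fun j _ => (h j).tendsto x⟩
  exact (norm_sum_le _ _).trans (Finset.sum_le_sum fun j _ => H j n x)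

lemma DomTendsto.mul {c : ℕ → Space d → ℝ} {c' : Space d → ℝ} {ψ : ℕ → Space d → ℂ}
    {g : Space d → ℂ} (hc : BddTendsto c c') (hψ : DomTendsto ψ g) :
    DomTendsto (fun n x => (c n x : ℂ) * ψ n x) (fun x => (c' x : ℂ) * g x) := by
  obtain ⟨K, hK, h1⟩ := hc.bdd
  obtain ⟨θ, h2, h3⟩ := hψ.dom
  refine ⟨⟨fun x => K * θ x, h2.const_mul K, fun n x => ?_⟩, fun x =>
    ((Complex.continuous_ofReal.tendsto _).comp (hc.tendsto x)).mul (hψ.tendsto x)⟩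
  rw [norm_mul, Complex.norm_real]
  exact mul_le_mul (h1 n x) (h3 n x) (norm_nonneg _) hK

lemma DomTendsto.const (φ : 𝓢(Space d, ℂ)) : DomTendsto (fun _ => φ) φ :=
  ⟨⟨fun x => ‖φ x‖, (φ.memLp 2 volume).norm, fun _ _ => le_rfl⟩, fun _ => tendsto_const_nhds⟩

/-- Dominated convergence applied to the squared moduli, with θ² as the integrable majorant. -/
lemma DomTendsto.norm {ψ : ℕ → SchwartzL2 d} {g : Space d → ℂ}
    (h : DomTendsto (fun n => of.symm (ψ n)) g) :
    Filter.Tendsto (fun n => ‖ψ n‖) Filter.atTop (nhds (normL2 g).toReal) := by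
  obtain ⟨θ, h1, h2⟩ := h.dom
  have hgm : AEStronglyMeasurable g volume := aestronglyMeasurable_of_tendsto_ae Filter.atTop
    (fun n => (of.symm (ψ n)).continuous.aestronglyMeasurable)
    (Filter.Eventually.of_forall h.tendsto)
  have hgb : ∀ x, ‖g x‖ ≤ θ x := fun x =>
    le_of_tendsto (h.tendsto x).norm (Filter.Eventually.of_forall fun n => h2 n x)
  have hg : MemLp g 2 volume := h1.mono' hgm (Filter.Eventually.of_forall hgb)
  have hθ : Integrable fun x => θ x ^ 2 := by
    have := h1.integrable_norm_pow two_ne_zero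
    simpa only [Real.norm_eq_abs, sq_abs] using this
  have hsq : ∀ n, ‖ψ n‖ = √(∫ x, ‖of.symm (ψ n) x‖ ^ 2) := fun n => by
    rw [← norm_of_sq, LinearEquiv.apply_symm_apply, Real.sqrt_sq (norm_nonneg _)]
  have hg2 : (normL2 g).toReal = √(∫ x, ‖g x‖ ^ 2) := by
    have h3 := congrArg ENNReal.toReal (ofReal_integral_norm_sq hg)
    rw [ENNReal.toReal_ofReal (integral_nonneg fun x => by positivity), ENNReal.toReal_pow] at h3
    rw [h3, Real.sqrt_sq ENNReal.toReal_nonneg]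
  simp only [hsq, hg2]
  refine (Real.continuous_sqrt.tendsto _).comp ?_
  refine tendsto_integral_of_dominated_convergence (fun x => θ x ^ 2)
    (fun n => ((of.symm (ψ n)).continuous.norm.pow 2).aestronglyMeasurable) hθ
    (fun n => Filter.Eventually.of_forall fun x => ?_)
    (Filter.Eventually.of_forall fun x => (h.tendsto x).norm.pow 2)
  rw [norm_pow, norm_norm]
  gcongr
  exact h2 n x

lemma applyField_eq_sum (Y : Space d → Space d) (u : Space d → ℂ) (x : Space d) :
    applyField Y u x = ∑ l, (Y x l : ℂ) * fderiv ℝ u x (basisVec l) := by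
  rw [applyField, clm_apply_eq_sum]
  simp only [Complex.real_smul]

/-- Expanded so that only the coefficients and their first derivatives occur, in the same shape as
`fld_fld_apply`; convergence can then be checked term by term. -/
lemma applyField_applyField {Y : Space d → Space d} {u : Space d → ℂ} {x : Space d}
    (hY : DifferentiableAt ℝ Y x) (hu : ContDiff ℝ 2 u) :
    applyField Y (applyField Y u) x = ∑ l, ((Y x l : ℂ) * ∑ k, (Y x k : ℂ) *
        fderiv ℝ (fun y => fderiv ℝ u y (basisVec l)) x (basisVec k)
      + ((∑ k, Y x k * fderiv ℝ (fun y => Y y l) x (basisVec k) : ℝ) : ℂ) *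
        fderiv ℝ u x (basisVec l)) := by
  have h0 : ∀ l : Fin d, HasFDerivAt (fun y => Y y l) (fderiv ℝ (fun y => Y y l) x) x := fun l =>
    ((EuclideanSpace.proj l : Space d →L[ℝ] ℝ).hasFDerivAt.comp x
      hY.hasFDerivAt).differentiableAt.hasFDerivAt
  have h1 : ∀ l : Fin d, HasFDerivAt (fun y => ((Y y l : ℝ) : ℂ)) _ x := fun l =>
    Complex.ofRealCLM.hasFDerivAt.comp x (h0 l)
  have h2 : ∀ l : Fin d, HasFDerivAt (fun y => fderiv ℝ u y (basisVec l)) _ x := fun l =>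
    (((hu.fderiv_right (m := 1) (by norm_num)).clm_apply contDiff_const).differentiable
      one_ne_zero x).hasFDerivAt
  have h3 : ∀ l : Fin d, HasFDerivAt (fun y => ((Y y l : ℝ) : ℂ) * fderiv ℝ u y (basisVec l)) _ x :=
    fun l => (h1 l).mul (h2 l)
  have h4 : HasFDerivAt (fun y => ∑ l, ((Y y l : ℝ) : ℂ) * fderiv ℝ u y (basisVec l)) _ x :=
    HasFDerivAt.fun_sum fun l _ => h3 l
  have h5 : applyField Y u = fun y => ∑ l, ((Y y l : ℝ) : ℂ) * fderiv ℝ u y (basisVec l) :=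
    funext fun y => applyField_eq_sum Y u y
  rw [applyField, h5, h4.fderiv, _root_.sum_apply]
  refine Finset.sum_congr rfl fun l _ => ?_
  simp only [add_apply, smul_apply,
    ContinuousLinearMap.comp_apply, Complex.ofRealCLM_apply, smul_eq_mul]
  rw [clm_apply_eq_sum (fderiv ℝ (fun y => fderiv ℝ u y (basisVec l)) x) (Y x),
    clm_apply_eq_sum (fderiv ℝ (fun y => Y y l) x) (Y x)]
  simp only [Complex.real_smul, smul_eq_mul]
  ring

lemma fld_fld_apply {ι : Type*} (a : Fin d → ι → Coef d) (i : ι) (φ : SchwartzL2 d) (x : Space d) :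
    of.symm (fld a i (fld a i φ)) x = ∑ l, ((a l i x : ℂ) * ∑ k, (a k i x : ℂ) *
        fderiv ℝ (fun y => fderiv ℝ (of.symm φ) y (basisVec l)) x (basisVec k)
      + ((∑ k, a k i x * fderiv ℝ (a l i) x (basisVec k) : ℝ) : ℂ) *
        fderiv ℝ (of.symm φ) x (basisVec l)) := by
  have h : fld a i (fld a i φ) = ∑ l, (opM (a l i) (fld a i (opD l φ))
      + opM (along a (a l) i) (opD l φ)) := by
    have := congrFun (fld_mul_fld a a) i
    rw [Finset.sum_apply] at this
    have h2 := congrArg (fun T : SchwartzOp d => T φ) this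
    simp only [LinearMap.sum_apply] at h2
    exact h2
  rw [h, of_symm_sum]
  refine Finset.sum_congr rfl fun l _ => ?_
  rw [of_symm_add, opM_apply, opM_apply, fld_apply, along_apply, opD_apply]
  have e : (of.symm (opD l φ) : Space d → ℂ) = fun y => fderiv ℝ (of.symm φ) y (basisVec l) :=
    funext fun y => opD_apply l φ y
  rw [e]

lemma fdiv_apply {ι : Type*} (a : Fin d → ι → Coef d) (i : ι) (x : Space d) :
    fdiv a i x = ∑ l, fderiv ℝ (a l i) x (basisVec l) := by
  simp only [fdiv, Finset.sum_apply]
  rw [_root_.sum_apply]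
  simp only [pd, SchwartzMap.lineDerivOp_apply_eq_fderiv]

section
variable {ι : Type*} {a : Fin d → ι → Coef d} {k : ℕ → ι} {Y : Space d → Space d}

lemma domTendsto_fld (ha : ∀ l, BddTendsto (fun n => a l (k n)) (fun x => Y x l))
    (φ : SchwartzL2 d) :
    DomTendsto (fun n => of.symm (fld a (k n) φ)) (applyField Y (of.symm φ)) := by
  have h := DomTendsto.sum Finset.univ fun l =>
    DomTendsto.mul (ha l) (DomTendsto.const (of.symm (opD l φ)))
  convert h using 1
  · funext n x
    rw [fld_apply]
    simp only [opD_apply]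
  · funext x
    rw [applyField_eq_sum]
    simp only [opD_apply]

/-- Y*Y u = -YYu - (div Y)Yu involves the coefficients and their first derivatives only, multiplied
by fixed Schwartz functions; no convergence of higher derivatives is needed. -/
lemma domTendsto_adjoint (hY : ContDiff ℝ 1 Y)
    (ha : ∀ l, BddTendsto (fun n => a l (k n)) (fun x => Y x l))
    (ha' : ∀ l m, BddTendsto (fun n x => fderiv ℝ (a l (k n)) x (basisVec m))
      (fun x => fderiv ℝ (fun y => Y y l) x (basisVec m))) (φ : SchwartzL2 d) :
    DomTendsto (fun n => of.symm (-fld a (k n) (fld a (k n) φ)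
        - opM (fdiv a (k n)) (fld a (k n) φ)))
      (applyAdjoint Y (applyField Y (of.symm φ))) := by
  have h1 := DomTendsto.sum Finset.univ fun l =>
    (DomTendsto.mul (ha l) (DomTendsto.sum Finset.univ fun m =>
      DomTendsto.mul (ha m) (DomTendsto.const (of.symm (opD m (opD l φ)))))).add
    (DomTendsto.mul (BddTendsto.sum Finset.univ fun m => (ha m).mul (ha' l m))
      (DomTendsto.const (of.symm (opD l φ))))
  have h2 := DomTendsto.mul (BddTendsto.sum Finset.univ fun l => ha' l l) (domTendsto_fld ha φ)
  have h := h1.neg.add h2.neg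
  have e : ∀ l, (of.symm (opD l φ) : Space d → ℂ) = fun y => fderiv ℝ (of.symm φ) y (basisVec l) :=
    fun l => funext fun y => opD_apply l φ y
  have hφ : ContDiff ℝ 2 (of.symm φ) := (of.symm φ).smooth 2
  convert h using 1
  · funext n x
    rw [sub_eq_add_neg, of_symm_add, map_neg, map_neg, neg_apply, neg_apply, fld_fld_apply,
      opM_apply, fdiv_apply]
    simp only [opD_apply, e]
  · funext x
    rw [applyAdjoint_eq (hY.differentiable one_ne_zero x)
      ((contDiff_applyField hY (hφ.of_le one_add_one_eq_two.le)).differentiable one_ne_zero x),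
      applyField_applyField (hY.differentiable one_ne_zero x) hφ, sub_eq_add_neg]
    simp only [opD_apply, e, divField]

end

end

section

open scoped SchwartzMap LineDeriv ComplexConjugate
open SchwartzL2

variable {d : ℕ}

/-! ### Uniform resolvent estimates -/

/-- Smooth compactly supported functions, as Schwartz functions. -/
abbrev Test (d : ℕ) : Type := {φ : 𝓢(Space d, ℂ) // HasCompactSupport φ}

/-- Pairs consisting of a test function and a semiclassical parameter. -/
abbrev Idx (d : ℕ) : Type := Test d × Set.Ioc (0 : ℝ) 1

lemma Test.smoothCompact (φ : Test d) : SmoothCompact (φ.1 : Space d → ℂ) := ⟨φ.1.smooth ⊤, φ.2⟩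

/-- The semiclassical parameter. -/
def Idx.param (i : Idx d) : ℝ := i.2

/-- The test function. -/
noncomputable def Idx.vec (i : Idx d) : SchwartzL2 d := of i.1.1

lemma Idx.small : SmallParam (Idx.param (d := d)) := fun i => i.2.2

variable {r : ℕ}

/-- The right-hand side `‖L u‖ + ‖u‖` of the estimates. -/
noncomputable def graphNorm (f : Space d → ℝ) (X₀ : Space d → Space d)
    (Y : Fin r → Space d → Space d) (i : Idx d) : ℝ :=
  (normL2 (opL f X₀ Y i.1.1)).toReal + ‖i.vec‖

/-- The estimate `‖(1 - h² Δ)⁻¹ V u‖ ≤ C h^{ε-1} (‖L u‖ + ‖u‖)`, uniformly in `u` and `h`. -/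
def ResolventEstimate (f : Space d → ℝ) (X₀ : Space d → Space d)
    (Y : Fin r → Space d → Space d) (V : Space d → Space d) (ε : ℝ) : Prop :=
  VecBound Idx.param (graphNorm f X₀ Y) (ε - 1)
    (famR (d := d) (Idx.param (d := d)) • fld (vf (Idx d) V) • Idx.vec (d := d))

variable {f : Space d → ℝ} {X₀ : Space d → Space d} {Y : Fin r → Space d → Space d}

lemma graphNorm_nonneg : 0 ≤ graphNorm f X₀ Y := fun _ =>
  add_nonneg ENNReal.toReal_nonneg (norm_nonneg _)

lemma vecBound_vec : VecBound Idx.param (graphNorm f X₀ Y) 0 Idx.vec :=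
  ⟨1, zero_le_one, fun i => by
    rw [Real.rpow_zero, one_mul, one_mul]
    exact le_add_of_nonneg_left ENNReal.toReal_nonneg⟩

lemma toReal_graphNorm (hA : AssumptionA1 f X₀ Y) (i : Idx d) :
    ENNReal.ofReal (graphNorm f X₀ Y i) = normL2 (opL f X₀ Y i.1.1) + normL2 i.1.1 := by
  have h : normL2 (opL f X₀ Y i.1.1) ≠ ⊤ := (opL_memLp hA i.1.smoothCompact.1).eLpNorm_lt_top.ne
  rw [graphNorm, ENNReal.ofReal_add ENNReal.toReal_nonneg (norm_nonneg _),
    ENNReal.ofReal_toReal h, Idx.vec, enorm_of]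
  rfl

lemma comparison_toReal (hA : AssumptionA1 f X₀ Y) {V : Space d → Space d} (hV : Comparison Y V) :
    ∃ C : ℝ, 0 < C ∧ ∀ i : Idx d,
      (normL2 (applyField V i.1.1)).toReal ≤ C * graphNorm f X₀ Y i := by
  obtain ⟨C, hC, H⟩ := comparison_bound hA hV
  refine ⟨C, hC, fun i => ENNReal.toReal_le_of_le_ofReal
    (mul_nonneg hC.le (graphNorm_nonneg i)) ?_⟩
  rw [ENNReal.ofReal_mul hC.le, toReal_graphNorm hA]
  exact H _ i.1.smoothCompact

lemma vecBound_familyZero (hA : AssumptionA1 f X₀ Y) {V : Space d → Space d}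
    (hV : V ∈ familyZero Y) :
    VecBound Idx.param (graphNorm f X₀ Y) 0 (fld (vf (Idx d) V) • Idx.vec (d := d)) := by
  obtain ⟨C, hC, H⟩ := comparison_toReal hA hV.2
  refine ⟨C, hC.le, fun i => ?_⟩
  rw [Real.rpow_zero, mul_one]
  refine le_trans (le_of_eq ?_) (H i)
  have h1 : (fld (vf (Idx d) V) • Idx.vec (d := d)) i = of (of.symm (fld (vf (Idx d) V) i (of i.1.1))) := by
    rw [LinearEquiv.apply_symm_apply]; rfl
  rw [h1, norm_of, fld_vf_apply hV.1]
  rfl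

lemma resolventEstimate_familyZero (hA : AssumptionA1 f X₀ Y) {V : Space d → Space d}
    (hV : V ∈ familyZero Y) : ResolventEstimate f X₀ Y V 1 := by
  have h := OpBound.smul Idx.small (bound_famR (d := d) (Idx.param (d := d))) (vecBound_familyZero hA hV)
  unfold ResolventEstimate
  convert h using 1
  norm_num

/-- V and W are smooth, so the coefficients of ℒ enter only through the bound for Vu, that is,
through the energy estimate. C¹ coefficients are therefore enough. -/
lemma ResolventEstimate.bracket (hA : AssumptionA1 f X₀ Y) {V W : Space d → Space d} {ε : ℝ}
    (hV : V ∈ familyZero Y) (hW : SmoothCompact W) (hε : ε ≤ 1)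
    (h : ResolventEstimate f X₀ Y W ε) :
    ResolventEstimate f X₀ Y (VectorField.lieBracket ℝ V W) (ε / 2) := by
  unfold ResolventEstimate
  rw [vf_lieBracket hV.1 hW]
  exact fld_bracket_bound Idx.small graphNorm_nonneg (fun l => vf_cls V 2 l)
    (fun m l => vf_cls W m l) vecBound_vec (vecBound_familyZero hA hV) hε h

lemma ResolventEstimate.mono {V : Space d → Space d} {ε δ : ℝ} (hδ : δ ≤ ε)
    (h : ResolventEstimate f X₀ Y V ε) : ResolventEstimate f X₀ Y V δ :=
  VecBound.mono Idx.small graphNorm_nonneg h (by linarith)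

lemma ResolventEstimate.add {V W : Space d → Space d} {ε : ℝ} (hV : SmoothCompact V)
    (hW : SmoothCompact W) (h1 : ResolventEstimate f X₀ Y V ε)
    (h2 : ResolventEstimate f X₀ Y W ε) : ResolventEstimate f X₀ Y (V + W) ε := by
  unfold ResolventEstimate at *
  rw [fld_vf_add hV hW, add_smul, smul_add]
  exact VecBound.add h1 h2

lemma ResolventEstimate.smul {V : Space d → Space d} {ε : ℝ} (hV : SmoothCompact V) (c : ℝ)
    (h : ResolventEstimate f X₀ Y V ε) : ResolventEstimate f X₀ Y (c • V) ε := by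
  unfold ResolventEstimate at *
  obtain ⟨C, hC, H⟩ := h
  refine ⟨|c| * C, by positivity, fun i => ?_⟩
  have e : (famR (d := d) (Idx.param (d := d)) • fld (vf (Idx d) (c • V)) • Idx.vec (d := d)) i
      = (c : ℂ) • (famR (d := d) (Idx.param (d := d)) • fld (vf (Idx d) V) • Idx.vec (d := d)) i := by
    rw [fld_vf_smul hV]
    exact (famR (d := d) (Idx.param (d := d)) i).map_smul (c : ℂ) (fld (vf (Idx d) V) i i.vec)
  rw [e, norm_smul, Complex.norm_real, Real.norm_eq_abs, mul_assoc, mul_assoc]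
  exact mul_le_mul_of_nonneg_left (by rw [← mul_assoc]; exact H i) (abs_nonneg c)

lemma ResolventEstimate.zero (ε : ℝ) : ResolventEstimate f X₀ Y 0 ε := by
  have h : ResolventEstimate f X₀ Y ((0 : ℝ) • (0 : Space d → Space d)) ε := by
    refine ⟨0, le_rfl, fun i => ?_⟩
    have e : (famR (d := d) (Idx.param (d := d)) • fld (vf (Idx d) ((0 : ℝ) • (0 : Space d → Space d)))
        • Idx.vec (d := d)) i = 0 := by
      rw [fld_vf_smul SmoothCompact.zero, Complex.ofReal_zero]
      simp only [zero_smul]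
      exact (famR (d := d) (Idx.param (d := d)) i).map_zero
    rw [e, norm_zero, zero_mul, zero_mul]
  rwa [zero_smul] at h

/-- A uniform resolvent estimate yields an estimate for Sobolev norms. -/
theorem ResolventEstimate.normSobolev_le (hA : AssumptionA1 f X₀ Y) {V : Space d → Space d}
    (hV : SmoothCompact V) {ε γ : ℝ} (hε : ε ≤ 1) (hγ : 0 < γ)
    (h : ResolventEstimate f X₀ Y V ε) :
    ∃ C : ℝ, 0 < C ∧ ∀ u : Space d → ℂ, SmoothCompact u →
      normSobolev (ε - 1 - γ) (applyField V u) ≤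
        ENNReal.ofReal C * (normL2 (opL f X₀ Y u) + normL2 u) := by
  obtain ⟨c, hc, H⟩ := normSobolev_le_of_opR (d := d) hε hγ
  obtain ⟨C, hC, h⟩ := h
  -- C may vanish, hence C + 1 for a positive constant.
  refine ⟨c * (C + 1), by positivity, fun u hu => ?_⟩
  let φ : Test d := ⟨hu.2.toSchwartzMap hu.1, hu.2⟩
  have hN : 0 ≤ graphNorm f X₀ Y (φ, ⟨1, by norm_num⟩) := graphNorm_nonneg _
  have h1 := H (fld (vf (Idx d) V) (φ, ⟨1, by norm_num⟩) (of φ.1))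
    ((C + 1) * graphNorm f X₀ Y (φ, ⟨1, by norm_num⟩)) (by positivity) fun t ht0 ht1 => by
      have h2 := h (φ, ⟨t, ht0, ht1⟩)
      have h3 : 0 ≤ t ^ (ε - 1) := by positivity
      calc ‖opR t (fld (vf (Idx d) V) (φ, ⟨1, by norm_num⟩) (of φ.1))‖
          = ‖opR t (fld (vf (Idx d) V) (φ, ⟨t, ht0, ht1⟩) (of φ.1))‖ := by
            congr 2
            refine of.symm.injective (SchwartzMap.ext fun x => ?_)
            rw [fld_vf_apply hV, fld_vf_apply hV]
        _ ≤ C * t ^ (ε - 1) * graphNorm f X₀ Y (φ, ⟨1, by norm_num⟩) := h2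
        _ ≤ (C + 1) * graphNorm f X₀ Y (φ, ⟨1, by norm_num⟩) * t ^ (ε - 1) := by
            have := mul_nonneg h3 hN
            nlinarith
  rw [fld_vf_apply hV] at h1
  rw [← mul_assoc, ENNReal.ofReal_mul (by positivity), toReal_graphNorm hA] at h1
  exact h1

/-! ### The estimate for Lie algebras generated by horizontal fields -/

lemma LieGenerated.smoothCompact {S : Set (Space d → Space d)} (hS : ∀ V ∈ S, SmoothCompact V)
    {V : Space d → Space d} (hV : LieGenerated S V) : SmoothCompact V := by
  induction hV with
  | of V hV => exact hS V hV
  | zero => exact SmoothCompact.zero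
  | add V W _ _ h1 h2 => exact h1.add h2
  | smul c V _ h => exact h.smul c
  | bracket V W _ _ h1 h2 => exact h1.lieBracket h2

/-- The Jacobi identity, for the estimates. -/
lemma ResolventEstimate.jacobi {V₁ V₂ W : Space d → Space d} {ε : ℝ} (h1 : SmoothCompact V₁)
    (h2 : SmoothCompact V₂) (hW : SmoothCompact W)
    (e1 : ResolventEstimate f X₀ Y
      (VectorField.lieBracket ℝ V₁ (VectorField.lieBracket ℝ V₂ W)) ε)
    (e2 : ResolventEstimate f X₀ Y
      (VectorField.lieBracket ℝ V₂ (VectorField.lieBracket ℝ V₁ W)) ε) :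
    ResolventEstimate f X₀ Y (VectorField.lieBracket ℝ (VectorField.lieBracket ℝ V₁ V₂) W) ε := by
  unfold ResolventEstimate at *
  -- With brackets written as commutators, the Jacobi identity is an identity in an associative
  -- ring.
  have key : fld (vf (Idx d) (VectorField.lieBracket ℝ (VectorField.lieBracket ℝ V₁ V₂) W))
      = fld (vf (Idx d) (VectorField.lieBracket ℝ V₁ (VectorField.lieBracket ℝ V₂ W)))
        - fld (vf (Idx d) (VectorField.lieBracket ℝ V₂ (VectorField.lieBracket ℝ V₁ W))) := by
    rw [vf_lieBracket (h1.lieBracket h2) hW, vf_lieBracket h1 (h2.lieBracket hW),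
      vf_lieBracket h2 (h1.lieBracket hW), ← fld_comm_fld, ← fld_comm_fld, ← fld_comm_fld,
      vf_lieBracket h1 h2, vf_lieBracket h2 hW, vf_lieBracket h1 hW, ← fld_comm_fld,
      ← fld_comm_fld, ← fld_comm_fld]
    noncomm_ring
  rw [key, sub_smul, smul_sub]
  exact VecBound.sub e1 e2

/-- Every field generated by the horizontal ones satisfies some estimate, and so does its bracket
with every smooth field that satisfies an estimate. -/
lemma LieGenerated.resolventEstimate (hA : AssumptionA1 f X₀ Y) {V : Space d → Space d}
    (hV : LieGenerated (familyZero Y) V) :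
    (∃ ε : ℝ, 0 < ε ∧ ε ≤ 1 ∧ ResolventEstimate f X₀ Y V ε) ∧
      ∀ W : Space d → Space d, SmoothCompact W → ∀ ε : ℝ, 0 < ε → ε ≤ 1 →
        ResolventEstimate f X₀ Y W ε → ∃ δ : ℝ, 0 < δ ∧ δ ≤ 1 ∧
          ResolventEstimate f X₀ Y (VectorField.lieBracket ℝ V W) δ := by
  have hS : ∀ V ∈ familyZero Y, SmoothCompact V := fun V hV => hV.1
  induction hV with
  | of V hV =>
    exact ⟨⟨1, one_pos, le_rfl, resolventEstimate_familyZero hA hV⟩, fun W hW ε hε0 hε1 h =>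
      ⟨ε / 2, by linarith, by linarith, h.bracket hA hV hW hε1⟩⟩
  | zero =>
    refine ⟨⟨1, one_pos, le_rfl, .zero 1⟩, fun W hW ε hε0 hε1 h => ⟨1, one_pos, le_rfl, ?_⟩⟩
    rw [VectorField.lieBracket_zero_left]
    exact .zero 1
  | add V₁ V₂ hV₁ hV₂ ih₁ ih₂ =>
    have s1 := hV₁.smoothCompact hS
    have s2 := hV₂.smoothCompact hS
    obtain ⟨⟨a, ha0, ha1, ha⟩, ha'⟩ := ih₁
    obtain ⟨⟨b, hb0, hb1, hb⟩, hb'⟩ := ih₂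
    refine ⟨⟨min a b, lt_min ha0 hb0, (min_le_left a b).trans ha1,
      (ha.mono (min_le_left a b)).add s1 s2 (hb.mono (min_le_right a b))⟩,
      fun W hW ε hε0 hε1 h => ?_⟩
    obtain ⟨α, hα0, hα1, hα⟩ := ha' W hW ε hε0 hε1 h
    obtain ⟨β, hβ0, hβ1, hβ⟩ := hb' W hW ε hε0 hε1 h
    refine ⟨min α β, lt_min hα0 hβ0, (min_le_left α β).trans hα1, ?_⟩
    have e : VectorField.lieBracket ℝ (V₁ + V₂) W
        = VectorField.lieBracket ℝ V₁ W + VectorField.lieBracket ℝ V₂ W := by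
      funext x
      exact VectorField.lieBracket_add_left (s1.1.differentiable (by simp) x)
        (s2.1.differentiable (by simp) x)
    rw [e]
    exact (hα.mono (min_le_left α β)).add (s1.lieBracket hW) (s2.lieBracket hW)
      (hβ.mono (min_le_right α β))
  | smul c V hV ih =>
    have s := hV.smoothCompact hS
    obtain ⟨⟨a, ha0, ha1, ha⟩, ha'⟩ := ih
    refine ⟨⟨a, ha0, ha1, ha.smul s c⟩, fun W hW ε hε0 hε1 h => ?_⟩
    obtain ⟨α, hα0, hα1, hα⟩ := ha' W hW ε hε0 hε1 h
    refine ⟨α, hα0, hα1, ?_⟩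
    have e : VectorField.lieBracket ℝ (c • V) W = c • VectorField.lieBracket ℝ V W := by
      funext x
      exact VectorField.lieBracket_const_smul_left (s.1.differentiable (by simp) x)
    rw [e]
    exact hα.smul (s.lieBracket hW) c
  | bracket V₁ V₂ hV₁ hV₂ ih₁ ih₂ =>
    have s1 := hV₁.smoothCompact hS
    have s2 := hV₂.smoothCompact hS
    obtain ⟨⟨b, hb0, hb1, hb⟩, hb'⟩ := ih₂
    -- The estimate for [V₁, V₂] is the second induction claim for V₁ applied to V₂. For [[V₁, V₂],
    -- W] both iterated brackets are estimated first and then combined by Jacobi; carrying the claim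
    -- for arbitrary W makes this induction close.
    refine ⟨ih₁.2 V₂ s2 b hb0 hb1 hb, fun W hW ε hε0 hε1 h => ?_⟩
    obtain ⟨α, hα0, hα1, hα⟩ := ih₁.2 W hW ε hε0 hε1 h
    obtain ⟨α', hα0', hα1', hα'⟩ := hb' _ (s1.lieBracket hW) α hα0 hα1 hα
    obtain ⟨β, hβ0, hβ1, hβ⟩ := hb' W hW ε hε0 hε1 h
    obtain ⟨β', hβ0', hβ1', hβ'⟩ := ih₁.2 _ (s2.lieBracket hW) β hβ0 hβ1 hβ
    exact ⟨min α' β', lt_min hα0' hβ0', (min_le_left _ _).trans hα1',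
      (hβ'.mono (min_le_right _ _)).jacobi s1 s2 hW (hα'.mono (min_le_left _ _))⟩

end

section

open scoped SchwartzMap LineDeriv ComplexConjugate
open SchwartzL2

variable {d r : ℕ} {f : Space d → ℝ} {X₀ : Space d → Space d} {Y : Fin r → Space d → Space d}

/-! ### The drift -/

lemma AssumptionA2.toA1 (h : AssumptionA2 f X₀ Y) : AssumptionA1 f X₀ Y :=
  ⟨h.1, ⟨h.2.1.1, h.2.1.2.2⟩, fun j => ⟨(h.2.2.1 j).1.of_le (by norm_num), (h.2.2.1 j).2.2⟩⟩

/-- The bound γ₁ < min(1, d/2) yields both conditions of Hardy's inequality, and the uniform class-2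
bounds give the domination. -/
lemma exists_coefficient_approximation (h : AssumptionA2 f X₀ Y) (j : Fin r) (l : Fin d) :
    ∃ A : ℕ → Coef d, FCls 2 A ∧ BddTendsto (fun n => A n) (fun x => Y j x l) ∧
      ∀ m, BddTendsto (fun n x => fderiv ℝ (A n) x (basisVec m))
        (fun x => fderiv ℝ (fun y => Y j y l) x (basisVec m)) := by
  obtain ⟨-, -, hY, γ, _, hγ0, hγ1, -, -, -, hw⟩ := h
  obtain ⟨A, hA, h1, h2⟩ := exists_mollification hγ0 (hγ1.trans_le (min_le_left _ _))
    (by linarith [hγ1.trans_le (min_le_right 1 ((d : ℝ) / 2))])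
    (contDiff_euclidean.1 (hY j).1 l) ((hY j).2.2.mono fun x hx => by
      simp only [Function.mem_support, ne_eq] at hx ⊢
      contrapose! hx
      simp [hx]) (hw j l).1
  refine ⟨A, hA, ⟨hA.bdd, h1⟩, fun m => ⟨?_, h2 m⟩⟩
  obtain ⟨K, hK, H⟩ := (hA.pd m).bdd
  refine ⟨K, hK, fun n x => ?_⟩
  rw [← SchwartzMap.lineDerivOp_apply_eq_fderiv]
  exact H n x

/-- The drift applied to `u`, corrected by the square terms, for the approximating fields. -/
noncomputable def correctedDrift {ι κ : Type*} [Fintype κ] (x : Fin d → ι → Coef d)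
    (y : κ → Fin d → ι → Coef d) (u : ι → SchwartzL2 d) : ι → SchwartzL2 d :=
  fld x • u + ∑ j, (-(fld (y j) • fld (y j) • u) - famM (fdiv (y j)) • fld (y j) • u)

/-- The right-hand side F is defined from the approximating fields themselves, so the weak equation
holds exactly at every stage rather than up to an error. -/
lemma ip_correctedDrift {ι κ : Type*} [Fintype κ] (x : Fin d → ι → Coef d)
    (y : κ → Fin d → ι → Coef d) (u v : ι → SchwartzL2 d) :
    ip (fld x • u) v = ip (correctedDrift x y u) v
      - ∑ j, ip (fld (y j) • u) (fld (y j) • v) := by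
  have hsum : ∀ (F : Finset κ) (z : κ → ι → SchwartzL2 d),
      ip (∑ j ∈ F, z j) v = ∑ j ∈ F, ip (z j) v := fun F z => by
    funext i
    simp only [ip, Finset.sum_apply, sum_inner]
  rw [correctedDrift, ip_add_left, hsum, add_sub_assoc, ← Finset.sum_sub_distrib]
  have h : ∀ j, ip (-(fld (y j) • fld (y j) • u) - famM (fdiv (y j)) • fld (y j) • u) v
      - ip (fld (y j) • u) (fld (y j) • v) = 0 := fun j => by
    rw [ip_sub_left, ip_neg_left, fld_adj, famM_symm]
    ring
  simp only [h, Finset.sum_const_zero, add_zero]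

/-- The sum of the vector field `X` and of the second order terms of the operator. -/
noncomputable def principalPart (X : Space d → Space d) (Y : Fin r → Space d → Space d)
    (u : Space d → ℂ) (x : Space d) : ℂ :=
  applyField X u x + ∑ j, applyAdjoint (Y j) (applyField (Y j) u) x

/-- The principal part equals ℒu - fu - Υu; the last term is controlled by the energy estimate
because Υ is comparable to the Y_j. -/
lemma normL2_principalPart_le (hA : AssumptionA1 f X₀ Y) {X Υ : Space d → Space d}
    (hΥ : Υ ∈ familyZeroB Y) (hX : X₀ = X + Υ) :
    ∃ C : ℝ, 0 < C ∧ ∀ i : Idx d,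
      (normL2 (principalPart X Y i.1.1)).toReal ≤ C * graphNorm f X₀ Y i := by
  obtain ⟨C, hC, H⟩ := comparison_bound hA hΥ.2
  obtain ⟨M, hM⟩ := hA.1.2.1
  have hM0 : 0 ≤ M := (norm_nonneg _).trans (hM 0)
  refine ⟨1 + M + C, by positivity, fun i => ENNReal.toReal_le_of_le_ofReal
    (mul_nonneg (by positivity) (graphNorm_nonneg i)) ?_⟩
  have hi := i.1.smoothCompact
  have mu : MemLp i.1.1 2 volume := i.1.1.memLp 2 volume
  have mL := opL_memLp hA hi.1
  have mf := hA.1.mul_memLp hi.1.continuous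
  have mΥ : MemLp (applyField Υ i.1.1) 2 volume :=
    applyField_memLp hΥ.1 (hi.1.of_le (by norm_cast))
  have e : principalPart X Y i.1.1 = (opL f X₀ Y i.1.1 - fun x => (f x : ℂ) * i.1.1 x)
      - applyField Υ i.1.1 := by
    funext x
    simp only [principalPart, opL, Pi.sub_apply, hX, applyField, Pi.add_apply, map_add]
    ring
  have hf : normL2 (fun x => (f x : ℂ) * i.1.1 x) ≤ ENNReal.ofReal M * normL2 i.1.1 := by
    refine eLpNorm_le_mul_eLpNorm_of_ae_le_mul (Filter.Eventually.of_forall fun x => ?_) 2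
    rw [norm_mul, Complex.norm_real]
    exact mul_le_mul_of_nonneg_right (hM x) (norm_nonneg _)
  rw [ENNReal.ofReal_mul (by positivity), toReal_graphNorm hA, e]
  set L := normL2 (opL f X₀ Y i.1.1)
  set U := normL2 i.1.1
  calc normL2 ((opL f X₀ Y i.1.1 - fun x => (f x : ℂ) * i.1.1 x) - applyField Υ i.1.1)
      ≤ normL2 (opL f X₀ Y i.1.1 - fun x => (f x : ℂ) * i.1.1 x)
          + normL2 (applyField Υ i.1.1) :=
        eLpNorm_sub_le (mL.sub mf).aestronglyMeasurable mΥ.aestronglyMeasurable (by norm_num)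
    _ ≤ (L + normL2 fun x => (f x : ℂ) * i.1.1 x) + normL2 (applyField Υ i.1.1) := by
        gcongr
        exact eLpNorm_sub_le mL.aestronglyMeasurable mf.aestronglyMeasurable (by norm_num)
    _ ≤ ((L + U) + ENNReal.ofReal M * (L + U)) + ENNReal.ofReal C * (L + U) := by
        gcongr
        · exact le_self_add
        · exact hf.trans (by gcongr; exact le_add_self)
        · exact H _ hi
    _ = ENNReal.ofReal (1 + M + C) * (L + U) := by
        rw [ENNReal.ofReal_add (by positivity) hC.le, ENNReal.ofReal_add zero_le_one hM0,
          ENNReal.ofReal_one]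
        ring

/-- Approximation of the operator by operators with Schwartz coefficients. -/
lemma exists_approximation (h : AssumptionA2 f X₀ Y) {X Υ : Space d → Space d}
    (hXs : SmoothCompact X) (hΥ : Υ ∈ familyZeroB Y) (hX : X₀ = X + Υ) :
    ∃ (y : Fin r → Fin d → Idx d × ℕ → Coef d) (F : Idx d × ℕ → SchwartzL2 d) (N : Idx d × ℕ → ℝ),
      (∀ j l, FCls 2 (y j l)) ∧ (∀ p, graphNorm f X₀ Y p.1 ≤ N p) ∧
      (∀ j, VecBound (fun p : Idx d × ℕ => p.1.param) N 0 (fld (y j) • fun p : Idx d × ℕ => p.1.vec)) ∧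
      VecBound (fun p : Idx d × ℕ => p.1.param) N 0 F ∧
      (∀ v, ip (fld (vf (Idx d × ℕ) X) • fun p : Idx d × ℕ => p.1.vec) v = ip F v
        - ∑ j, ip (fld (y j) • fun p : Idx d × ℕ => p.1.vec) (fld (y j) • v)) ∧
      ∃ C : ℝ, 0 < C ∧ ∀ i : Idx d, ∃ L : ℝ, L ≤ C * graphNorm f X₀ Y i ∧
        Filter.Tendsto (fun n => N (i, n)) Filter.atTop (nhds L) := by
  have hA := h.toA1
  choose A hA2 hA0 hA1 using exists_coefficient_approximation h
  let y : Fin r → Fin d → Idx d × ℕ → Coef d := fun j l p => A j l p.2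
  let u : Idx d × ℕ → SchwartzL2 d := fun p => p.1.vec
  let F : Idx d × ℕ → SchwartzL2 d := correctedDrift (vf _ X) y u
  -- N contains every quantity that must be bounded, so all constants are 1 for each approximation.
  -- Comparison with the graph norm is needed only in the limit.
  let N : Idx d × ℕ → ℝ := fun p =>
    graphNorm f X₀ Y p.1 + ‖F p‖ + ∑ j, ‖fld (y j) p (u p)‖
  have hg : ∀ p : Idx d × ℕ, 0 ≤ graphNorm f X₀ Y p.1 := fun p => graphNorm_nonneg p.1
  have hs : ∀ p, 0 ≤ ∑ j, ‖fld (y j) p (u p)‖ := fun p =>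
    Finset.sum_nonneg fun j _ => norm_nonneg _
  refine ⟨y, F, N, fun j l => FCls.comp Prod.snd (hA2 j l), fun p => ?_, fun j => ⟨1, zero_le_one,
    fun p => ?_⟩, ⟨1, zero_le_one, fun p => ?_⟩, fun v => ip_correctedDrift _ y u v, ?_⟩
  · linarith [norm_nonneg (F p), hs p]
  · rw [Real.rpow_zero, one_mul, one_mul]
    have h1 : ‖fld (y j) p (u p)‖ ≤ ∑ j, ‖fld (y j) p (u p)‖ :=
      Finset.single_le_sum (f := fun j => ‖fld (y j) p (u p)‖) (fun _ _ => norm_nonneg _)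
        (Finset.mem_univ j)
    exact h1.trans (by linarith [norm_nonneg (F p), hg p])
  · rw [Real.rpow_zero, one_mul, one_mul]
    linarith [norm_nonneg (F p), hs p, hg p]
  · obtain ⟨C, hC, HC⟩ := normL2_principalPart_le hA hΥ hX
    choose K hK HK using fun j => comparison_toReal hA (comparison_self Y j)
    refine ⟨1 + C + ∑ j, K j, by
      have := Finset.sum_nonneg fun j (_ : j ∈ Finset.univ) => (hK j).le
      positivity, fun i => ⟨graphNorm f X₀ Y i + (normL2 (principalPart X Y i.1.1)).toReal
        + ∑ j, (normL2 (applyField (Y j) i.1.1)).toReal, ?_, ?_⟩⟩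
    · have h1 := Finset.sum_le_sum fun j (_ : j ∈ Finset.univ) => HK j i
      rw [← Finset.sum_mul] at h1
      linarith [HC i]
    · have hc : ∀ j, (∀ l, BddTendsto (fun n => y j l (i, n)) fun x => Y j x l) :=
        fun j l => hA0 j l
      have hc' : ∀ j, (∀ l m, BddTendsto (fun n x => fderiv ℝ (y j l (i, n)) x (basisVec m))
          fun x => fderiv ℝ (fun y => Y j y l) x (basisVec m)) := fun j l m => hA1 j l m
      have t1 : ∀ j, Filter.Tendsto (fun n => ‖fld (y j) (i, n) i.vec‖) Filter.atTop
          (nhds (normL2 (applyField (Y j) i.1.1)).toReal) := fun j =>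
        (domTendsto_fld (k := fun n => (i, n)) (hc j) i.vec).norm
      have t2 : Filter.Tendsto (fun n => ‖F (i, n)‖) Filter.atTop
          (nhds (normL2 (principalPart X Y i.1.1)).toReal) := by
        refine DomTendsto.norm ?_
        have h1 := (DomTendsto.const (of.symm (fld (vf (Idx d × ℕ) X) (i, 0) i.vec))).add
          (DomTendsto.sum Finset.univ fun j => domTendsto_adjoint (k := fun n => (i, n))
            ((hA.2.2 j).1) (hc j) (hc' j) i.vec)
        convert h1 using 1
        · funext n x
          have e1 : F (i, n) = fld (vf (Idx d × ℕ) X) (i, n) i.vec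
              + ∑ j, (-fld (y j) (i, n) (fld (y j) (i, n) i.vec)
                - opM (fdiv (y j) (i, n)) (fld (y j) (i, n) i.vec)) := by
            simp only [F, correctedDrift, Pi.add_apply, Finset.sum_apply]
            rfl
          rw [e1, of_symm_add, of_symm_sum, fld_vf_apply hXs, fld_vf_apply hXs]
        · funext x
          rw [fld_vf_apply hXs]
          rfl
      exact (tendsto_const_nhds.add t2).add (tendsto_finsetSum _ fun j _ => t1 j)

lemma VecBound.lift {N : Idx d × ℕ → ℝ} (hN : ∀ p, graphNorm f X₀ Y p.1 ≤ N p)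
    {x : Idx d → SchwartzL2 d} {s : ℝ} (h : VecBound Idx.param (graphNorm f X₀ Y) s x) :
    VecBound (fun p : Idx d × ℕ => p.1.param) N s (fun p => x p.1) := by
  obtain ⟨c, hc, H⟩ := h
  refine ⟨c, hc, fun p => (H p.1).trans (mul_le_mul_of_nonneg_left (hN p) ?_)⟩
  exact mul_nonneg hc (Real.rpow_nonneg (Idx.small p.1).1.le _)

/-- The left-hand side does not depend on the mollification index, and the constant in front of N is
uniform in it; at fixed u and h only N passes to the limit. -/
lemma resolventEstimate_of_approximation {N : Idx d × ℕ → ℝ} {C : ℝ}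
    (hN : ∀ i : Idx d, ∃ L : ℝ, L ≤ C * graphNorm f X₀ Y i ∧
      Filter.Tendsto (fun n => N (i, n)) Filter.atTop (nhds L)) (hC : 0 < C)
    {V : Space d → Space d} (hV : SmoothCompact V) {ε : ℝ}
    (h : VecBound (fun p : Idx d × ℕ => p.1.param) N (ε - 1)
      (famR (d := d) (fun p : Idx d × ℕ => p.1.param) • fld (vf (Idx d × ℕ) V) •
        fun p : Idx d × ℕ => p.1.vec)) : ResolventEstimate f X₀ Y V ε := by
  obtain ⟨c, hc, H⟩ := h
  refine ⟨c * C, by positivity, fun i => ?_⟩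
  obtain ⟨L, hL, hlim⟩ := hN i
  have hp : 0 ≤ c * i.param ^ (ε - 1) := mul_nonneg hc (Real.rpow_nonneg (Idx.small i).1.le _)
  have e : ∀ n : ℕ, fld (vf (Idx d) V) i i.vec = fld (vf (Idx d × ℕ) V) (i, n) i.vec := fun n =>
    of.symm.injective (SchwartzMap.ext fun x => by rw [fld_vf_apply hV, fld_vf_apply hV])
  have h1 : ‖opR i.param (fld (vf (Idx d) V) i i.vec)‖ ≤ c * i.param ^ (ε - 1) * L := by
    refine ge_of_tendsto (hlim.const_mul _) (Filter.Eventually.of_forall fun n => ?_)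
    rw [e n]
    exact H (i, n)
  calc ‖opR i.param (fld (vf (Idx d) V) i i.vec)‖ ≤ c * i.param ^ (ε - 1) * L := h1
    _ ≤ c * i.param ^ (ε - 1) * (C * graphNorm f X₀ Y i) := by gcongr
    _ = _ := by ring

lemma resolventEstimate_drift (h : AssumptionA2 f X₀ Y) {X Υ : Space d → Space d}
    (hXs : SmoothCompact X) (hΥ : Υ ∈ familyZeroB Y) (hX : X₀ = X + Υ) :
    ResolventEstimate f X₀ Y X (1 / 2) := by
  obtain ⟨y, F, N, hy, hN, hyu, hF, hid, C, hC, hlim⟩ := exists_approximation h hXs hΥ hX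
  have hN0 : 0 ≤ N := fun p => (graphNorm_nonneg p.1).trans (hN p)
  have hu : VecBound (fun p : Idx d × ℕ => p.1.param) N 0 (fun p : Idx d × ℕ => p.1.vec) :=
    vecBound_vec.lift hN
  refine resolventEstimate_of_approximation hlim hC hXs ?_
  have := fld_drift_bound (fun p => Idx.small p.1) hN0 (fun m l => vf_cls X m l) hy hu hyu hF hid
  convert this using 1
  norm_num

lemma ResolventEstimate.drift_bracket (h : AssumptionA2 f X₀ Y) {X Υ W : Space d → Space d}
    (hXs : SmoothCompact X) (hΥ : Υ ∈ familyZeroB Y) (hX : X₀ = X + Υ) (hW : SmoothCompact W)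
    {δ : ℝ} (hδ0 : 0 ≤ δ) (hδ : δ ≤ 1 / 4) (hest : ResolventEstimate f X₀ Y W (4 * δ)) :
    ResolventEstimate f X₀ Y (VectorField.lieBracket ℝ X W) δ := by
  obtain ⟨y, F, N, hy, hN, hyu, hF, hid, C, hC, hlim⟩ := exists_approximation h hXs hΥ hX
  have hN0 : 0 ≤ N := fun p => (graphNorm_nonneg p.1).trans (hN p)
  have hu : VecBound (fun p : Idx d × ℕ => p.1.param) N 0 (fun p : Idx d × ℕ => p.1.vec) :=
    vecBound_vec.lift hN
  have hWu : VecBound (fun p : Idx d × ℕ => p.1.param) N (4 * δ - 1)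
      (famR (d := d) (fun p : Idx d × ℕ => p.1.param) • fld (vf (Idx d × ℕ) W) •
        fun p : Idx d × ℕ => p.1.vec) := by
    obtain ⟨c, hc, H⟩ := hest.lift hN
    refine ⟨c, hc, fun p => ?_⟩
    have e : fld (vf (Idx d) W) p.1 p.1.vec = fld (vf (Idx d × ℕ) W) p p.1.vec :=
      of.symm.injective (SchwartzMap.ext fun x => by rw [fld_vf_apply hW, fld_vf_apply hW])
    refine le_trans (le_of_eq ?_) (H p)
    exact congrArg (fun z => ‖opR p.1.param z‖) e.symm
  refine resolventEstimate_of_approximation hlim hC (hXs.lieBracket hW) ?_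
  rw [vf_lieBracket hXs hW]
  exact fld_drift_bracket_bound (fun p => Idx.small p.1) hN0 (fun m l => vf_cls X m l)
    (fun m l => vf_cls W m l) hy hu hyu hF hid hδ0 hδ hWu

/-! ### The families of iterated brackets -/

lemma family_smoothCompact {X : Space d → Space d} (hX : SmoothCompact X) :
    ∀ (k : ℕ) (V : Space d → Space d), V ∈ family Y X k → SmoothCompact V := by
  have h1 : ∀ V, V ∈ familyOne Y X → SmoothCompact V := by
    rintro V (⟨V, hV, W, hW, rfl⟩ | rfl)
    · exact hV.1.lieBracket hW.1
    · exact hX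
  intro k
  induction k using Nat.strong_induction_on with
  | _ k ih =>
    match k with
    | 0 => exact fun V hV => hV.1
    | 1 => exact h1
    | k + 2 =>
      rintro V (⟨V, hV, W, hW, rfl⟩ | ⟨V, hV, W, hW, rfl⟩)
      · exact hV.1.lieBracket (ih (k + 1) (by omega) W hW)
      · exact (h1 V hV).lieBracket (ih k (by omega) W hW)

lemma family_resolventEstimate (h : AssumptionA2 f X₀ Y) {X Υ : Space d → Space d}
    (hXs : SmoothCompact X) (hΥ : Υ ∈ familyZeroB Y) (hX : X₀ = X + Υ) :
    ∀ (k : ℕ) (V : Space d → Space d), V ∈ family Y X k →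
      ResolventEstimate f X₀ Y V ((1 / 2) ^ k) := by
  have hA := h.toA1
  have hle : ∀ k : ℕ, (1 / 2 : ℝ) ^ k ≤ 1 := fun k => pow_le_one₀ (by norm_num) (by norm_num)
  intro k
  induction k using Nat.strong_induction_on with
  | _ k ih =>
    match k with
    | 0 =>
      intro V hV
      rw [pow_zero]
      exact resolventEstimate_familyZero hA hV
    | 1 =>
      rw [pow_one]
      rintro V (⟨V, hV, W, hW, rfl⟩ | rfl)
      · exact (resolventEstimate_familyZero hA hW).bracket hA hV hW.1 le_rfl
      · exact resolventEstimate_drift h hXs hΥ hX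
    | k + 2 =>
      rintro V (⟨V, hV, W, hW, rfl⟩ | ⟨V, hV, W, hW, rfl⟩)
      · have h1 := (ih (k + 1) (by omega) W hW).bracket hA hV
          (family_smoothCompact hXs _ W hW) (hle _)
        rwa [show (1 / 2 : ℝ) ^ (k + 1) / 2 = (1 / 2) ^ (k + 2) by ring] at h1
      · have hWs := family_smoothCompact hXs _ W hW
        have hW' := ih k (by omega) W hW
        rcases hV with ⟨V₁, h1, V₂, h2, rfl⟩ | rfl
        -- For V = [V₁, V₂] two bracket steps halve the gain twice, in either order, and Jacobi
        -- recombines them.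
        · have b1 := (hW'.bracket hA h2 hWs (hle _)).bracket hA h1 (h2.1.lieBracket hWs)
            (by linarith [hle k])
          have b2 := (hW'.bracket hA h1 hWs (hle _)).bracket hA h2 (h1.1.lieBracket hWs)
            (by linarith [hle k])
          rw [show (1 / 2 : ℝ) ^ k / 2 / 2 = (1 / 2) ^ (k + 2) by ring] at b1 b2
          exact b1.jacobi h1.1 h2.1 hWs b2
        -- For V = X the gain is quartered in one step: δ = (1/2)^(k+2) ≤ 1/4 and 4δ = (1/2)^k. So X
        -- costs as much as a bracket of two fields of F₀.
        · refine ResolventEstimate.drift_bracket h hXs hΥ hX hWs (by positivity) ?_ ?_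
          · have := hle k
            rw [pow_add]; linarith
          · rwa [show 4 * (1 / 2 : ℝ) ^ (k + 2) = (1 / 2) ^ k by ring]

end

end RoughOperator

/-! ### Conclusion: from resolvent estimates back to Sobolev norms -/

theorem theorem5 {d r : ℕ} (Ω : Set (Space d)) (hΩ_open : IsOpen Ω)
    (hΩ_bdd : Bornology.IsBounded Ω) (hΩ_zero : (0 : Space d) ∈ Ω)
    (f : Space d → ℝ) (X₀ : Space d → Space d) (Y : Fin r → Space d → Space d) :
    (AssumptionA2 f X₀ Y →
      ∀ X Υ : Space d → Space d, SmoothCompact X → Υ ∈ familyZeroB Y → X₀ = X + Υ →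
      ∀ Q : Set (Space d), IsCompact Q → Q ⊆ Ω →
      ∀ γ : ℝ, 0 < γ → γ < 1 →
      ∀ (k : ℕ) (V : Space d → Space d), V ∈ family Y X k →
      ∀ ε : ℝ, ε ≤ (2 : ℝ) ^ (-(k : ℤ)) →
      ∃ C : ℝ, 0 < C ∧ ∀ u : Space d → ℂ, SmoothSupportedIn Q u →
        normSobolev (ε - 1 - γ) (applyField V u) ≤
          ENNReal.ofReal C * (normL2 (opL f X₀ Y u) + normL2 u)) ∧
    (AssumptionA1 f X₀ Y →
      ∀ V : Space d → Space d, LieGenerated (familyZero Y) V →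
      ∀ Q : Set (Space d), IsCompact Q → Q ⊆ Ω →
      ∃ C ε : ℝ, 0 < C ∧ 0 < ε ∧ ∀ u : Space d → ℂ, SmoothSupportedIn Q u →
        normSobolev (ε - 1) (applyField V u) ≤
          ENNReal.ofReal C * (normL2 (opL f X₀ Y u) + normL2 u)) := by
  have hQ : ∀ {Q : Set (Space d)} {u : Space d → ℂ}, IsCompact Q → SmoothSupportedIn Q u →
      SmoothCompact u := fun hQ hu => ⟨hu.1, hQ.of_isClosed_subset (isClosed_tsupport _) hu.2⟩
  refine ⟨fun h X Υ hXs hΥ hX Q hQc _ γ hγ _ k V hV ε hε => ?_, fun hA V hV Q hQc _ => ?_⟩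
  · have hε' : ε ≤ (1 / 2 : ℝ) ^ k := by
      rwa [zpow_neg, zpow_natCast, ← inv_pow, ← one_div] at hε
    have hest := (family_resolventEstimate h hXs hΥ hX k V hV).mono hε'
    obtain ⟨C, hC, H⟩ := hest.normSobolev_le h.toA1 (family_smoothCompact hXs k V hV)
      (hε'.trans (pow_le_one₀ (by norm_num) (by norm_num))) hγ
    exact ⟨C, hC, fun u hu => H u (hQ hQc hu)⟩
  · obtain ⟨⟨ε, hε0, hε1, hest⟩, -⟩ := hV.resolventEstimate hA
    -- Half of the gain is spent as the loss γ = ε/2 of the dyadic summation; the other half is the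
    -- final exponent.
    obtain ⟨C, hC, H⟩ := hest.normSobolev_le hA (hV.smoothCompact fun V hV => hV.1) hε1
      (half_pos hε0)
    refine ⟨C, ε / 2, hC, half_pos hε0, fun u hu => ?_⟩
    rw [show ε / 2 - 1 = ε - 1 - ε / 2 by ring]
    exact H u (hQ hQc hu)
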